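/- **Conventions.** A *Feynman category* is a triple $\mathfrak F=(\mathcal V,\mathcal F,\iota)$ of a groupoid $\mathcal V$, a symmetric monoidal category $\mathcal F$ and a functor $\iota:\mathcal V\to\mathcal F$ such that (i) the induced symmetric monoidal functor $\iota^{\otimes}$ on the free symmetric monoidal category $\mathcal V^{\otimes}$ induces an equivalence $\mathcal V^{\otimes}\simeq Iso(\mathcal F)$; (ii) it induces an equivalence $Iso(\mathcal F\downarrow\mathcal V)^{\otimes}\simeq Iso(\mathcal F\downarrow\mathcal F)$; (iii) every comma category $(\mathcal F\downarrow \ast)$, $\ast\in\mathcal V$, is essentially small. A *morphism* $\mathfrak F\to\mathfrak F'$ is a pair $(v,f)$ of a functor $v:\mathcal V\to\mathcal V'$ and a strong symmetric monoidal functor $f:\mathcal F\to\mathcal F'$ together with an isomorphism $f\circ\iota\cong\iota'\circ v$ (the identity in the strict case); morphisms are composed in the evident way. Let $\mathcal C$ be a symmetric monoidal category whose objects have underlying sets given by a strong symmetric monoidal functor $U:\mathcal C\to(\mathcal Set,\times)$; "$a\in \mathcal O(X)$" means $a\in U(\mathcal O(X))$. (For $\mathcal C$ Cartesian monoidal and locally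 small one can take $U=Hom_{\mathcal C}(\mathbf 1,-)$.) An $\mathcal F$-$\mathcal Op$ in $\mathcal C$ is a strong symmetric monoidal functor $\mathcal O:\mathcal F\to\mathcal C$, and a morphism of these is a monoidal natural transformation. The *decoration* $\mathfrak F_{dec\,\mathcal O}=(\mathcal V_{dec\,\mathcal O},\mathcal F_{dec\,\mathcal O},\iota_{dec\,\mathcal O})$ has as objects of $\mathcal F_{dec\,\mathcal O}$ the pairs $(X,a_X)$ with $X\in\mathcal F$, $a_X\in\mathcal O(X)$, as morphisms $(X,a_X)\to(Y,a_Y)$ those $\phi:X\to Y$ with $\mathcal O(\phi)(a_X)=a_Y$, and the tensor product $(X,a_X)\otimes(Y,a_Y)=(X\otimes Y,\tau(a_X,a_Y))$, with $\tau$ induced by the structure map $\mathcal O(X)\otimes\mathcal O(Y)\to\mathcal O(X\otimes Y)$; $\mathcal V_{dec\,\mathcal O}$ is the analogous category of pairs $(\ast,a)$ with $a\in\mathcal O(\iota(\ast))$, and $\iota_{dec\,\mathcal O}(\ast,a)=(\iota(\ast),a)$. Let $forget:\mathfrak F_{dec\,\mathcal O}\to\mathfrak F$ forget decorations, and for $\sigma:\mathcal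 O\to\mathcal P$ let $\sigma_{dec}:\mathfrak F_{dec\,\mathcal O}\to\mathfrak F_{dec\,\mathcal P}$, $(X,a_X)\mapsto(X,\sigma_X(a_X))$. **Theorem.** Let $(v,f):\mathfrak F\to\mathfrak F'$ be a morphism of Feynman categories, and assume that $\mathcal C$ has all colimits indexed by the comma categories $(f\downarrow X')$, $X'\in\mathcal F'$, and that $\otimes$ preserves them in each variable. For an $\mathcal F$-$\mathcal Op$ $\mathcal O$ let $$f_*(\mathcal O)(X')=\operatorname{colim}_{(f\downarrow X')}\mathcal O\circ P,\qquad P(X,\phi:f(X)\to X')=X,$$ be its pointwise left Kan extension along $f$, and let $\mu_X:\mathcal O(X)\to f_*(\mathcal O)(f(X))$ be the colimit map belonging to $id_{f(X)}$. For every $\mathcal O$ there is exactly one strong symmetric monoidal structure on $f_*(\mathcal O)$ for which $\mu$ is a monoidal natural transformation; with it, $\mathfrak F_{dec\,\mathcal O}$ and $\mathfrak F'_{dec\,f_*(\mathcal O)}$ are Feynman categories, and there are morphisms of Feynman categories $$f^{\mathcal O}:\mathfrak F_{dec\,\mathcal O}\to\mathfrak F'_{dec\,f_*(\mathcal O)},\qquad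 f^{\mathcal O}(X,a_X)=(f(X),\mu_X(a_X)),$$ such that 1. $forget'\circ f^{\mathcal O}=f\circ forget$; 2. for every morphism $\sigma:\mathcal O\to\mathcal P$ of $\mathcal F$-$\mathcal Ops$, the transformation $\sigma':f_*(\mathcal O)\to f_*(\mathcal P)$ that $\sigma$ induces on colimits is a morphism of $\mathcal F'$-$\mathcal Ops$, and $f^{\mathcal P}\circ\sigma_{dec}=\sigma'_{dec}\circ f^{\mathcal O}$. -/

import Mathlib

open CategoryTheory MonoidalCategory Limits Opposite

universe w v u v₁ u₁ u₂ u₃ u₄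

/-! ### The free symmetric monoidal category -/

/-- The free symmetric monoidal category on `V`, in its unbiased form: an object is a finite
family `⨂_{i ∈ I} X_i` of objects of `V`. -/
structure FreeSymm (V : Type u) where
  /-- the finite index set -/
  idx : Type
  /-- the index set is finite -/
  fin : Finite idx
  /-- the members of the family -/
  obj : idx → V

namespace FreeSymm

variable {V : Type u} [Category.{v} V]

/-- A morphism `⨂_{i ∈ I} X_i ⟶ ⨂_{j ∈ J} Y_j` is a bijection `ψ : I → J` together with morphisms
`X_i ⟶ Y_{ψ i}` of `V`; the pair `⟨ψ i, X_i ⟶ Y_{ψ i}⟩` is `map i`. -/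
structure Hom (X Y : FreeSymm V) where
  /-- the index `ψ i` and the morphism `X_i ⟶ Y_{ψ i}` -/
  map : ∀ i : X.idx, Σ j : Y.idx, X.obj i ⟶ Y.obj j
  /-- `ψ` is a bijection -/
  bij : Function.Bijective fun i => (map i).1

theorem Hom.ext' {X Y : FreeSymm V} {f g : Hom X Y} (h : ∀ i, f.map i = g.map i) : f = g := by
  cases f; cases g; congr; exact funext h

instance : Category (FreeSymm V) where
  Hom := Hom
  id X := ⟨fun i => ⟨i, 𝟙 _⟩, Function.bijective_id⟩
  comp f g := ⟨fun i => ⟨(g.map (f.map i).1).1, (f.map i).2 ≫ (g.map (f.map i).1).2⟩,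
    g.bij.comp f.bij⟩
  id_comp f := Hom.ext' fun i => by simp
  comp_id f := Hom.ext' fun i => by simp
  assoc f g h := Hom.ext' fun i => by simp

theorem hom_ext {X Y : FreeSymm V} {f g : X ⟶ Y} (h : ∀ i, Hom.map f i = Hom.map g i) : f = g :=
  Hom.ext' h

@[simp] theorem id_map (X : FreeSymm V) (i : X.idx) : Hom.map (𝟙 X) i = ⟨i, 𝟙 _⟩ := rfl

@[simp] theorem comp_map {X Y Z : FreeSymm V} (f : X ⟶ Y) (g : Y ⟶ Z) (i : X.idx) :
    Hom.map (f ≫ g) i = ⟨(Hom.map g (Hom.map f i).1).1,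
      (Hom.map f i).2 ≫ (Hom.map g (Hom.map f i).1).2⟩ := rfl

/-- The inclusion of one-member families. -/
def of (V : Type u) [Category.{v} V] : V ⥤ FreeSymm V where
  obj X := ⟨Unit, inferInstance, fun _ => X⟩
  map f := ⟨fun _ => ⟨(), f⟩, Function.bijective_id⟩

/-- The tensor product: concatenation of families. -/
def tensor (X Y : FreeSymm V) : FreeSymm V :=
  ⟨X.idx ⊕ Y.idx, have := X.fin; have := Y.fin; inferInstance, Sum.elim X.obj Y.obj⟩

/-- The unit: the empty family. -/
def unit : FreeSymm V := ⟨Empty, inferInstance, Empty.elim⟩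

/-- The tensor product of two morphisms. -/
def tensorMap {X Y X' Y' : FreeSymm V} (f : X ⟶ Y) (g : X' ⟶ Y') :
    tensor X X' ⟶ tensor Y Y' :=
  ⟨fun i => match i with
    | .inl i => ⟨.inl (Hom.map f i).1, (Hom.map f i).2⟩
    | .inr i => ⟨.inr (Hom.map g i).1, (Hom.map g i).2⟩, by
    constructor
    · rintro (i | i) (j | j) h
      · exact congrArg _ (f.bij.1 (Sum.inl.inj h))
      · cases h
      · cases h
      · exact congrArg _ (g.bij.1 (Sum.inr.inj h))
    · rintro (j | j)
      · obtain ⟨i, hi⟩ := f.bij.2 j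
        exact ⟨.inl i, congrArg Sum.inl hi⟩
      · obtain ⟨i, hi⟩ := g.bij.2 j
        exact ⟨.inr i, congrArg Sum.inr hi⟩⟩

theorem bijective_of_eq {A B : Type*} {f : A → B} (e : A ≃ B) (h : ∀ a, f a = e a) :
    Function.Bijective f := (funext h : f = e) ▸ e.bijective

/-- The associativity constraint: reindexing along `(I ⊕ J) ⊕ K ≃ I ⊕ (J ⊕ K)`. -/
def assoc (X Y Z : FreeSymm V) : tensor (tensor X Y) Z ≅ tensor X (tensor Y Z) where
  hom := ⟨fun i => match i with
    | .inl (.inl i) => ⟨.inl i, 𝟙 (X.obj i)⟩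
    | .inl (.inr i) => ⟨.inr (.inl i), 𝟙 (Y.obj i)⟩
    | .inr i => ⟨.inr (.inr i), 𝟙 (Z.obj i)⟩, by
    refine bijective_of_eq (Equiv.sumAssoc X.idx Y.idx Z.idx) ?_
    rintro ((i | i) | i) <;> rfl⟩
  inv := ⟨fun i => match i with
    | .inl i => ⟨.inl (.inl i), 𝟙 (X.obj i)⟩
    | .inr (.inl i) => ⟨.inl (.inr i), 𝟙 (Y.obj i)⟩
    | .inr (.inr i) => ⟨.inr i, 𝟙 (Z.obj i)⟩, by
    refine bijective_of_eq (Equiv.sumAssoc X.idx Y.idx Z.idx).symm ?_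
    rintro (i | (i | i)) <;> rfl⟩
  hom_inv_id := hom_ext (by
    rintro ((i | i) | i) <;> exact Sigma.ext rfl (heq_of_eq (Category.id_comp (𝟙 _))))
  inv_hom_id := hom_ext (by
    rintro (i | (i | i)) <;> exact Sigma.ext rfl (heq_of_eq (Category.id_comp (𝟙 _))))

/-- The left unit constraint. -/
def leftUnit (X : FreeSymm V) : tensor unit X ≅ X where
  hom := ⟨fun i => match i with
    | .inr i => ⟨i, 𝟙 (X.obj i)⟩, by
    refine bijective_of_eq (Equiv.emptySum Empty X.idx) ?_
    rintro (i | i); exacts [i.elim, rfl]⟩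
  inv := ⟨fun i => ⟨.inr i, 𝟙 (X.obj i)⟩, (Equiv.emptySum Empty X.idx).symm.bijective⟩
  hom_inv_id := hom_ext (by
    rintro (i | i); exacts [i.elim, Sigma.ext rfl (heq_of_eq (Category.id_comp (𝟙 _)))])
  inv_hom_id := hom_ext fun i => Sigma.ext rfl (heq_of_eq (Category.id_comp (𝟙 _)))

/-- The right unit constraint. -/
def rightUnit (X : FreeSymm V) : tensor X unit ≅ X where
  hom := ⟨fun i => match i with
    | .inl i => ⟨i, 𝟙 (X.obj i)⟩, by
    refine bijective_of_eq (Equiv.sumEmpty X.idx Empty) ?_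
    rintro (i | i); exacts [rfl, i.elim]⟩
  inv := ⟨fun i => ⟨.inl i, 𝟙 (X.obj i)⟩, (Equiv.sumEmpty X.idx Empty).symm.bijective⟩
  hom_inv_id := hom_ext (by
    rintro (i | i); exacts [Sigma.ext rfl (heq_of_eq (Category.id_comp (𝟙 _))), i.elim])
  inv_hom_id := hom_ext fun i => Sigma.ext rfl (heq_of_eq (Category.id_comp (𝟙 _)))

/-- The commutativity constraint: reindexing along `I ⊕ J ≃ J ⊕ I`. -/
def swap (X Y : FreeSymm V) : tensor X Y ⟶ tensor Y X :=
  ⟨fun i => match i with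
    | .inl i => ⟨.inr i, 𝟙 (X.obj i)⟩
    | .inr i => ⟨.inl i, 𝟙 (Y.obj i)⟩, by
    refine bijective_of_eq (Equiv.sumComm X.idx Y.idx) ?_
    rintro (i | i) <;> rfl⟩

theorem swap_swap (X Y : FreeSymm V) : swap X Y ≫ swap Y X = 𝟙 (tensor X Y) := hom_ext (by
  rintro (i | i) <;> exact Sigma.ext rfl (heq_of_eq (Category.id_comp (𝟙 _))))

theorem sigma_comp_id {X Y : V} (f : X ⟶ Y) : f ≫ 𝟙 Y = 𝟙 X ≫ f := by simp

theorem id_comp_id₃ (X : V) : 𝟙 X ≫ 𝟙 X ≫ 𝟙 X = 𝟙 X ≫ 𝟙 X := by simp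

instance : MonoidalCategory (FreeSymm V) where
  tensorObj := tensor
  tensorUnit := unit
  tensorHom := tensorMap
  whiskerLeft X _ _ f := tensorMap (𝟙 X) f
  whiskerRight f Y := tensorMap f (𝟙 Y)
  associator := assoc
  leftUnitor := leftUnit
  rightUnitor := rightUnit
  tensorHom_def f g := hom_ext (by
    rintro (i | i)
    · exact Sigma.ext rfl (heq_of_eq (Category.comp_id _).symm)
    · exact Sigma.ext rfl (heq_of_eq (Category.id_comp _).symm))
  id_tensorHom_id X Y := hom_ext (by rintro (i | i) <;> rfl)
  tensorHom_comp_tensorHom _ _ _ _ := hom_ext (by rintro (i | i) <;> rfl)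
  whiskerLeft_id X Y := hom_ext (by rintro (i | i) <;> rfl)
  id_whiskerRight X Y := hom_ext (by rintro (i | i) <;> rfl)
  associator_naturality f g h := hom_ext (by
    rintro ((i | i) | i) <;> exact Sigma.ext rfl (heq_of_eq (sigma_comp_id _)))
  leftUnitor_naturality f := hom_ext (by
    rintro (i | i); exacts [i.elim, Sigma.ext rfl (heq_of_eq (sigma_comp_id _))])
  rightUnitor_naturality f := hom_ext (by
    rintro (i | i); exacts [Sigma.ext rfl (heq_of_eq (sigma_comp_id _)), i.elim])
  pentagon W X Y Z := hom_ext (by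
    rintro (((i | i) | i) | i) <;> exact Sigma.ext rfl (heq_of_eq (id_comp_id₃ _)))
  triangle X Y := hom_ext (by
    rintro ((i | i) | i)
    exacts [Sigma.ext rfl (heq_of_eq (Category.id_comp (𝟙 _))), i.elim,
      Sigma.ext rfl (heq_of_eq (Category.id_comp (𝟙 _)))])

instance : SymmetricCategory (FreeSymm V) where
  braiding X Y := ⟨swap X Y, swap Y X, swap_swap X Y, swap_swap Y X⟩
  braiding_naturality_right X _ _ f := hom_ext (by
    rintro (i | i) <;> exact Sigma.ext rfl (heq_of_eq (sigma_comp_id _)))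
  braiding_naturality_left f X := hom_ext (by
    rintro (i | i) <;> exact Sigma.ext rfl (heq_of_eq (sigma_comp_id _)))
  hexagon_forward X Y Z := hom_ext (by rintro ((i | i) | i) <;> rfl)
  hexagon_reverse X Y Z := hom_ext (by rintro (i | (i | i)) <;> rfl)
  symmetry X Y := swap_swap X Y

theorem exists_inv {G : Type u} [Groupoid.{v} G] {X Y : FreeSymm G} (f : X ⟶ Y) :
    ∃ g : Y ⟶ X, g ≫ f = 𝟙 Y ∧ f ≫ g = 𝟙 X := by
  let e := Equiv.ofBijective _ f.bij
  have key : ∀ j : Y.idx, ∃ p : Σ i : X.idx, Y.obj j ⟶ X.obj i,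
      (⟨(Hom.map f p.1).1, p.2 ≫ (Hom.map f p.1).2⟩ : Σ k : Y.idx, Y.obj j ⟶ Y.obj k) = ⟨j, 𝟙 _⟩ ∧
      p.1 = e.symm j := by
    intro j
    obtain ⟨i, rfl⟩ := e.surjective j
    exact ⟨⟨i, Groupoid.inv (Hom.map f i).2⟩, Sigma.ext rfl (heq_of_eq (Groupoid.inv_comp _)), by simp⟩
  choose p hp hp' using key
  have hb : Function.Bijective fun j => (p j).1 := by
    have : (fun j => (p j).1) = e.symm := funext hp'
    rw [this]; exact e.symm.bijective
  let g : Y ⟶ X := ⟨p, hb⟩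
  have hg : g ≫ f = 𝟙 Y := hom_ext hp
  refine ⟨g, hg, hom_ext fun i => ?_⟩
  have h : Hom.map ((f ≫ g) ≫ f) i = Hom.map f i := by
    rw [Category.assoc, hg, Category.comp_id]
  generalize f ≫ g = r at h ⊢
  have h1 : (Hom.map r i).1 = i := f.bij.1 (congrArg Sigma.fst h)
  rw [comp_map] at h
  rcases hr : Hom.map r i with ⟨k, a⟩
  rw [hr] at h1 h
  obtain rfl : k = i := h1
  have h2 : a ≫ (Hom.map f k).2 = (Hom.map f k).2 := by
    have := (Sigma.ext_iff.1 h).2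
    exact eq_of_heq this
  have : a = 𝟙 _ := by
    rw [← cancel_mono (Hom.map f k).2, h2, Category.id_comp]
  rw [this, id_map]

/-- The free symmetric monoidal category on a groupoid is a groupoid. -/
noncomputable instance {G : Type u} [Groupoid.{v} G] : Groupoid (FreeSymm G) where
  inv f := (exists_inv f).choose
  inv_comp f := (exists_inv f).choose_spec.1
  comp_inv f := (exists_inv f).choose_spec.2

end FreeSymm

/-! ### The symmetric monoidal category `(F ↓ F)` -/

section CommaMonoidal

variable {F : Type u} [Category.{v} F] [MonoidalCategory F]

/-- The comma category `(F ↓ F)` is monoidal for the tensor product of morphisms,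
`(φ : X ⟶ Y) ⊗ (φ' : X' ⟶ Y') = (φ ⊗ φ' : X ⊗ X' ⟶ Y ⊗ Y')`. -/
instance commaMonoidal : MonoidalCategory (Comma (𝟭 F) (𝟭 F)) where
  tensorObj A B := ⟨A.left ⊗ B.left, A.right ⊗ B.right, A.hom ⊗ₘ B.hom⟩
  tensorUnit := ⟨𝟙_ F, 𝟙_ F, 𝟙 _⟩
  tensorHom f g := ⟨f.left ⊗ₘ g.left, f.right ⊗ₘ g.right, by
    have hf := f.w
    have hg := g.w
    dsimp at hf hg ⊢
    rw [tensorHom_comp_tensorHom, tensorHom_comp_tensorHom, hf, hg]⟩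
  whiskerLeft A _ _ f := ⟨A.left ◁ f.left, A.right ◁ f.right, by
    have hf := f.w
    dsimp at hf ⊢
    rw [← id_tensorHom, ← id_tensorHom, tensorHom_comp_tensorHom, tensorHom_comp_tensorHom, hf]
    simp⟩
  whiskerRight f A := ⟨f.left ▷ A.left, f.right ▷ A.right, by
    have hf := f.w
    dsimp at hf ⊢
    rw [← tensorHom_id, ← tensorHom_id, tensorHom_comp_tensorHom, tensorHom_comp_tensorHom, hf]
    simp⟩
  associator A B C := Comma.isoMk (α_ _ _ _) (α_ _ _ _) (associator_naturality _ _ _).symm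
  leftUnitor A := Comma.isoMk (λ_ _) (λ_ _) (by dsimp; simp)
  rightUnitor A := Comma.isoMk (ρ_ _) (ρ_ _) (by dsimp; simp)
  tensorHom_def _ _ := by ext <;> simp [MonoidalCategory.tensorHom_def]
  id_tensorHom_id _ _ := by ext <;> simp
  tensorHom_comp_tensorHom _ _ _ _ := by ext <;> simp
  whiskerLeft_id _ _ := by ext <;> simp
  id_whiskerRight _ _ := by ext <;> simp
  associator_naturality f g h := by ext <;> simp
  leftUnitor_naturality f := by ext <;> simp
  rightUnitor_naturality f := by ext <;> simp
  pentagon A B C D := by ext <;> simp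
  triangle A B := by ext <;> simp

instance commaSymmetric [SymmetricCategory F] : SymmetricCategory (Comma (𝟭 F) (𝟭 F)) where
  braiding _ _ := Comma.isoMk (β_ _ _) (β_ _ _) (BraidedCategory.braiding_naturality _ _).symm
  braiding_naturality_right _ _ _ _ := Comma.hom_ext _ _
    (BraidedCategory.braiding_naturality_right _ _) (BraidedCategory.braiding_naturality_right _ _)
  braiding_naturality_left _ _ := Comma.hom_ext _ _
    (BraidedCategory.braiding_naturality_left _ _) (BraidedCategory.braiding_naturality_left _ _)
  hexagon_forward _ _ _ := Comma.hom_ext _ _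
    (BraidedCategory.hexagon_forward _ _ _) (BraidedCategory.hexagon_forward _ _ _)
  hexagon_reverse _ _ _ := Comma.hom_ext _ _
    (BraidedCategory.hexagon_reverse _ _ _) (BraidedCategory.hexagon_reverse _ _ _)
  symmetry _ _ := Comma.hom_ext _ _
    (SymmetricCategory.symmetry _ _) (SymmetricCategory.symmetry _ _)

end CommaMonoidal

/-! ### The category of elements of a monoidal functor -/

section Elements

variable {F : Type u} [Category.{v} F] [MonoidalCategory F]

open Functor.LaxMonoidal

theorem type_congr {A B : Type w} {f g : A ⟶ B} (h : f = g) (x : A) : f x = g x := by rw [h]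

/-- The element `τ (a, b)` of `D (X ⊗ Y)`, where `τ : D X × D Y → D (X ⊗ Y)` is the structure map
of `D`. -/
def tensorElt (D : F ⥤ Type w) [D.LaxMonoidal] {X Y : F} (a : D.obj X) (b : D.obj Y) :
    D.obj (X ⊗ Y) :=
  μ D X Y (show (D.obj X ⊗ D.obj Y : Type w) from (a, b))

/-- The distinguished element of `D 𝟙`. -/
def unitElt (D : F ⥤ Type w) [D.LaxMonoidal] : D.obj (𝟙_ F) :=
  ε D (show (𝟙_ (Type w) : Type w) from PUnit.unit)

theorem map_tensorElt (D : F ⥤ Type w) [D.LaxMonoidal] {X Y X' Y' : F} (f : X ⟶ X')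
    (g : Y ⟶ Y') (a : D.obj X) (b : D.obj Y) :
    D.map (f ⊗ₘ g) (tensorElt D a b) = tensorElt D (D.map f a) (D.map g b) :=
  (type_congr (μ_natural D f g) (show (D.obj X ⊗ D.obj Y : Type w) from (a, b))).symm

/-- Pairs `(X, a)` with `a ∈ D X` form a monoidal category: `(X, a) ⊗ (Y, b) = (X ⊗ Y, τ (a, b))`,
and the unit is `(𝟙, e)` with `e` the distinguished element of `D 𝟙`. The tensor products of
morphisms and the constraints are those of `F`. -/
instance elementsMonoidal (D : F ⥤ Type w) [D.LaxMonoidal] : MonoidalCategory D.Elements where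
  tensorObj p q := ⟨p.1 ⊗ q.1, tensorElt D p.2 q.2⟩
  tensorUnit := ⟨𝟙_ F, unitElt D⟩
  tensorHom {p p' q q'} f g := ⟨f.1 ⊗ₘ g.1, by
    have := map_tensorElt D f.1 g.1 p.2 q.2
    rwa [f.2, g.2] at this⟩
  whiskerLeft p q q' f := ⟨p.1 ◁ f.1, by
    have := map_tensorElt D (𝟙 p.1) f.1 p.2 q.2
    rwa [f.2, id_tensorHom, D.map_id] at this⟩
  whiskerRight {p p'} f q := ⟨f.1 ▷ q.1, by
    have := map_tensorElt D f.1 (𝟙 q.1) p.2 q.2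
    rwa [f.2, tensorHom_id, D.map_id] at this⟩
  associator p q r := CategoryOfElements.isoMk _ _ (α_ p.1 q.1 r.1)
    (type_congr (Functor.LaxMonoidal.associativity D p.1 q.1 r.1)
      (show ((D.obj p.1 ⊗ D.obj q.1) ⊗ D.obj r.1 : Type w) from ((p.2, q.2), r.2)))
  leftUnitor p := CategoryOfElements.isoMk _ _ (λ_ p.1)
    (type_congr (Functor.LaxMonoidal.left_unitality D p.1)
      (show (𝟙_ (Type w) ⊗ D.obj p.1 : Type w) from (PUnit.unit, p.2))).symm
  rightUnitor p := CategoryOfElements.isoMk _ _ (ρ_ p.1)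
    (type_congr (Functor.LaxMonoidal.right_unitality D p.1)
      (show (D.obj p.1 ⊗ 𝟙_ (Type w) : Type w) from (p.2, PUnit.unit))).symm
  tensorHom_def f g := Subtype.ext (MonoidalCategory.tensorHom_def f.1 g.1)
  id_tensorHom_id _ _ := Subtype.ext (MonoidalCategory.id_tensorHom_id _ _)
  tensorHom_comp_tensorHom _ _ _ _ := Subtype.ext
    (MonoidalCategory.tensorHom_comp_tensorHom _ _ _ _)
  whiskerLeft_id _ _ := Subtype.ext (MonoidalCategory.whiskerLeft_id _ _)
  id_whiskerRight _ _ := Subtype.ext (MonoidalCategory.id_whiskerRight _ _)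
  associator_naturality _ _ _ := Subtype.ext (MonoidalCategory.associator_naturality _ _ _)
  leftUnitor_naturality _ := Subtype.ext (MonoidalCategory.leftUnitor_naturality _)
  rightUnitor_naturality _ := Subtype.ext (MonoidalCategory.rightUnitor_naturality _)
  pentagon _ _ _ _ := Subtype.ext (MonoidalCategory.pentagon _ _ _ _)
  triangle _ _ := Subtype.ext (MonoidalCategory.triangle _ _)

/-- The commutativity constraint of `F` makes the category of elements of a lax symmetric monoidal
functor symmetric monoidal. -/
instance elementsSymmetric [SymmetricCategory F] (D : F ⥤ Type w) [D.LaxBraided] :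
    SymmetricCategory D.Elements where
  braiding p q := CategoryOfElements.isoMk _ _ (β_ p.1 q.1)
    (type_congr (Functor.LaxBraided.braided (F := D) p.1 q.1)
      (show (D.obj p.1 ⊗ D.obj q.1 : Type w) from (p.2, q.2)))
  braiding_naturality_right _ _ _ _ := Subtype.ext (BraidedCategory.braiding_naturality_right _ _)
  braiding_naturality_left _ _ := Subtype.ext (BraidedCategory.braiding_naturality_left _ _)
  hexagon_forward _ _ _ := Subtype.ext (BraidedCategory.hexagon_forward _ _ _)
  hexagon_reverse _ _ _ := Subtype.ext (BraidedCategory.hexagon_reverse _ _ _)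
  symmetry _ _ := Subtype.ext (SymmetricCategory.symmetry _ _)

/-- The forgetful functor `(X, a) ↦ X` is strict symmetric monoidal. -/
instance elementsForget [SymmetricCategory F] (D : F ⥤ Type w) [D.LaxBraided] :
    (CategoryOfElements.π D).Braided where
  ε := 𝟙 _
  μ _ _ := 𝟙 _
  η := 𝟙 _
  δ _ _ := 𝟙 _
  μ_natural_left _ _ := (Category.comp_id _).trans (Category.id_comp _).symm
  μ_natural_right _ _ := (Category.comp_id _).trans (Category.id_comp _).symm
  δ_natural_left _ _ := (Category.id_comp _).trans (Category.comp_id _).symm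
  δ_natural_right _ _ := (Category.id_comp _).trans (Category.comp_id _).symm
  associativity p q r := by
    change 𝟙 _ ▷ r.1 ≫ 𝟙 _ ≫ (α_ p.1 q.1 r.1).hom = (α_ p.1 q.1 r.1).hom ≫ p.1 ◁ 𝟙 _ ≫ 𝟙 _
    simp
  left_unitality p := by
    change (λ_ p.1).hom = 𝟙 _ ▷ p.1 ≫ 𝟙 _ ≫ (λ_ p.1).hom
    simp
  right_unitality p := by
    change (ρ_ p.1).hom = p.1 ◁ 𝟙 _ ≫ 𝟙 _ ≫ (ρ_ p.1).hom
    simp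
  oplax_associativity p q r := by
    change 𝟙 _ ≫ 𝟙 _ ▷ r.1 ≫ (α_ p.1 q.1 r.1).hom = (α_ p.1 q.1 r.1).hom ≫ 𝟙 _ ≫ p.1 ◁ 𝟙 _
    simp
  oplax_left_unitality p := by
    change (λ_ p.1).inv = (λ_ p.1).inv ≫ 𝟙 _ ≫ 𝟙 _ ▷ p.1
    simp
  oplax_right_unitality p := by
    change (ρ_ p.1).inv = (ρ_ p.1).inv ≫ 𝟙 _ ≫ p.1 ◁ 𝟙 _
    simp
  ε_η := Category.id_comp _
  η_ε := Category.id_comp _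
  μ_δ _ _ := Category.id_comp _
  δ_μ _ _ := Category.id_comp _
  braided _ _ := (Category.id_comp _).trans (Category.comp_id _).symm

/-- A monoidal natural transformation `σ : D ⟶ E` induces the strong symmetric monoidal functor
`(X, a) ↦ (X, σ_X a)`; its structure isomorphisms are identities of `F`. -/
instance elementsMap [SymmetricCategory F] {D E : F ⥤ Type w} [D.LaxBraided] [E.LaxBraided]
    (σ : D ⟶ E) [NatTrans.IsMonoidal σ] : (NatTrans.mapElements σ).Braided :=
  letI core : (NatTrans.mapElements σ).CoreMonoidal :=
    { εIso := CategoryOfElements.isoMk _ _ (Iso.refl (𝟙_ F))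
        ((type_congr (E.map_id _) _).trans
          (type_congr (NatTrans.IsMonoidal.unit (τ := σ))
            (show (𝟙_ (Type w) : Type w) from PUnit.unit)).symm)
      μIso := fun p q => CategoryOfElements.isoMk _ _ (Iso.refl (p.1 ⊗ q.1))
        ((type_congr (E.map_id _) _).trans
          (type_congr (NatTrans.IsMonoidal.tensor (τ := σ) p.1 q.1)
            (show (D.obj p.1 ⊗ D.obj q.1 : Type w) from (p.2, q.2))).symm)
      μIso_hom_natural_left := fun _ _ => Subtype.ext
        ((Category.comp_id _).trans (Category.id_comp _).symm)
      μIso_hom_natural_right := fun _ _ => Subtype.ext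
        ((Category.comp_id _).trans (Category.id_comp _).symm)
      associativity := fun p q r => Subtype.ext (by
        change 𝟙 _ ▷ r.1 ≫ 𝟙 _ ≫ (α_ p.1 q.1 r.1).hom = (α_ p.1 q.1 r.1).hom ≫ p.1 ◁ 𝟙 _ ≫ 𝟙 _
        simp)
      left_unitality := fun p => Subtype.ext (by
        change (λ_ p.1).hom = 𝟙 _ ▷ p.1 ≫ 𝟙 _ ≫ (λ_ p.1).hom
        simp)
      right_unitality := fun p => Subtype.ext (by
        change (ρ_ p.1).hom = p.1 ◁ 𝟙 _ ≫ 𝟙 _ ≫ (ρ_ p.1).hom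
        simp) }
  { core.toMonoidal with
    braided := fun _ _ => Subtype.ext ((Category.id_comp _).trans (Category.comp_id _).symm) }

end Elements

/-! ### Feynman categories -/

/-- The symmetric monoidal functor `T : G^⊗ ⥤ M` induced by a functor `j : G ⥤ M` from a groupoid
(that is, the extension of `j` along the inclusion `G ⥤ G^⊗`, which is unique up to isomorphism)
induces an equivalence of `G^⊗` with the groupoid `Iso(M)` of isomorphisms of `M`. -/
def InducesEquivalence {G : Type u₁} [Groupoid.{v₁} G] {M : Type u₂} [Category.{v} M]
    [MonoidalCategory M] [SymmetricCategory M] (j : G ⥤ M) : Prop :=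
  ∃ (T : FreeSymm G ⥤ M) (_ : T.Braided),
    Nonempty (FreeSymm.of G ⋙ T ≅ j) ∧ (Core.functorToCore T).IsEquivalence

/-- A triple `(V, F, ι)` of a groupoid, a symmetric monoidal category and a functor `ι : V ⥤ F`. -/
structure FeynmanTriple where
  /-- the groupoid of vertices -/
  V : Type u₁
  [groupoid : Groupoid.{w} V]
  /-- the symmetric monoidal category -/
  F : Type u₂
  [category : Category.{w} F]
  [monoidal : MonoidalCategory F]
  [symmetric : SymmetricCategory F]
  /-- the functor from vertices to `F` -/
  ι : V ⥤ F

namespace FeynmanTriple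

attribute [instance] groupoid category monoidal symmetric

/-- The functor `(F ↓ V) ⥤ (F ↓ F)`, `(X, ∗, φ : X ⟶ ι ∗) ↦ (X, ι ∗, φ)`. -/
def commaInclusion (𝔉 : FeynmanTriple.{w, u₁, u₂}) :
    Comma (𝟭 𝔉.F) 𝔉.ι ⥤ Comma (𝟭 𝔉.F) (𝟭 𝔉.F) where
  obj A := ⟨A.left, 𝔉.ι.obj A.right, A.hom⟩
  map f := ⟨f.left, 𝔉.ι.map f.right, f.w⟩

/-- The axioms of a Feynman category. -/
structure IsFeynmanCategory (𝔉 : FeynmanTriple.{w, u₁, u₂}) : Prop where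
  /-- isomorphism condition: `V^⊗ ≃ Iso(F)` -/
  iso_condition : InducesEquivalence 𝔉.ι
  /-- hereditary condition: `Iso(F ↓ V)^⊗ ≃ Iso(F ↓ F)` -/
  hereditary : InducesEquivalence (Core.inclusion (Comma (𝟭 𝔉.F) 𝔉.ι) ⋙ 𝔉.commaInclusion)
  /-- size condition: every `(F ↓ ∗)` is essentially small -/
  size : ∀ x : 𝔉.V, EssentiallySmall.{w} (CostructuredArrow (𝟭 𝔉.F) (𝔉.ι.obj x))

/-- A morphism of Feynman categories: a pair `(v, f)` of a functor and a strong symmetric monoidal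
functor, compatible with the inclusions of vertices (up to a specified isomorphism, which is an
identity if `f ∘ ι = ι' ∘ v`). -/
structure Hom (𝔄 : FeynmanTriple.{w, u₁, u₂}) (𝔅 : FeynmanTriple.{w, u₃, u₄}) where
  /-- the functor on vertices -/
  v : 𝔄.V ⥤ 𝔅.V
  /-- the strong symmetric monoidal functor -/
  f : 𝔄.F ⥤ 𝔅.F
  [braided : f.Braided]
  /-- the compatibility `f ∘ ι ≅ ι' ∘ v` -/
  iso : 𝔄.ι ⋙ f ≅ v ⋙ 𝔅.ι

attribute [instance] Hom.braided

/-- Composition of morphisms of Feynman categories. -/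
def Hom.comp {𝔄 : FeynmanTriple.{w, u₁, u₂}} {𝔅 : FeynmanTriple.{w, u₃, u₄}}
    {ℭ : FeynmanTriple.{w, u, v}} (Φ : Hom 𝔄 𝔅) (Ψ : Hom 𝔅 ℭ) : Hom 𝔄 ℭ where
  v := Φ.v ⋙ Ψ.v
  f := Φ.f ⋙ Ψ.f
  iso := NatIso.ofComponents
    (fun x => Ψ.f.mapIso (Φ.iso.app x) ≪≫ Ψ.iso.app (Φ.v.obj x)) (fun {x y} g => by
      have h1 := Φ.iso.hom.naturality g
      have h2 := Ψ.iso.hom.naturality (Φ.v.map g)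
      dsimp at h1 h2 ⊢
      rw [← Category.assoc, ← Ψ.f.map_comp, h1, Ψ.f.map_comp, Category.assoc, h2, Category.assoc])

variable (𝔉 : FeynmanTriple.{w, u₁, u₂})

/-- The decoration of `(V, F, ι)` by a symmetric monoidal functor `D : F ⥤ Set`: the objects of
`F_dec` are the pairs `(X, a)` with `a ∈ D X`, those of `V_dec` the pairs `(∗, a)` with
`a ∈ D (ι ∗)`; the morphisms are those of `F`, respectively of `V`, that map one decoration to the
other; `ι_dec (∗, a) = (ι ∗, a)`. -/
def dec (D : 𝔉.F ⥤ Type w) [D.Braided] : FeynmanTriple.{w, max u₁ w, max u₂ w} where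
  V := (𝔉.ι ⋙ D).Elements
  F := D.Elements
  ι :=
    { obj := fun p => ⟨𝔉.ι.obj p.1, p.2⟩
      map := fun g => ⟨𝔉.ι.map g.1, g.2⟩
      map_id := fun _ => Subtype.ext (𝔉.ι.map_id _)
      map_comp := fun _ _ => Subtype.ext (𝔉.ι.map_comp _ _) }

/-- The forgetful morphism, which forgets the decorations. -/
def forget (D : 𝔉.F ⥤ Type w) [D.Braided] : Hom (𝔉.dec D) 𝔉 where
  v := CategoryOfElements.π (𝔉.ι ⋙ D)
  f := CategoryOfElements.π D
  braided := elementsForget D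
  iso := NatIso.ofComponents (fun p => Iso.refl (𝔉.ι.obj p.1))
    (fun _ => (Category.comp_id _).trans (Category.id_comp _).symm)

/-- The morphism `(X, a) ↦ (X, σ_X a)` of decorated Feynman categories induced by a monoidal
natural transformation `σ : D ⟶ E`. -/
def decMap {D E : 𝔉.F ⥤ Type w} [D.Braided] [E.Braided] (σ : D ⟶ E) [NatTrans.IsMonoidal σ] :
    Hom (𝔉.dec D) (𝔉.dec E) where
  v := NatTrans.mapElements (Functor.whiskerLeft 𝔉.ι σ)
  f := NatTrans.mapElements σ
  braided := elementsMap σ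
  iso := NatIso.ofComponents
    (fun p => CategoryOfElements.isoMk _ _ (Iso.refl (𝔉.ι.obj p.1)) (type_congr (E.map_id _) _))
    (fun _ => Subtype.ext ((Category.comp_id _).trans (Category.id_comp _).symm))

/-! ### `F-Ops` and the push-forward -/

/-- An `F-Op` in `C`: a strong symmetric monoidal functor `F ⥤ C`. -/
structure Ops (C : Type u) [Category.{v} C] [MonoidalCategory C] [SymmetricCategory C] where
  /-- the functor -/
  functor : 𝔉.F ⥤ C
  [braided : functor.Braided]

attribute [instance] Ops.braided

variable {C : Type u} [Category.{v} C] [MonoidalCategory C] [SymmetricCategory C]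

/-- A morphism of `F-Ops`: a monoidal natural transformation. -/
structure Ops.Hom (O P : 𝔉.Ops C) where
  /-- the natural transformation -/
  hom : O.functor ⟶ P.functor
  [isMonoidal : NatTrans.IsMonoidal hom]

attribute [instance] Ops.Hom.isMonoidal

/-- The underlying functor of the push-forward of `O` along `(v, f)`:
`f_* O (X') = colim_{(f ↓ X')} O ∘ P`, with `P (X, φ : f X ⟶ X') = X`. -/
noncomputable abbrev pushFunctor {𝔉 : FeynmanTriple.{w, u₁, u₂}} {𝔉' : FeynmanTriple.{w, u₃, u₄}}
    (Φ : Hom 𝔉 𝔉') [∀ X' : 𝔉'.F, HasColimitsOfShape (CostructuredArrow Φ.f X') C]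
    (O : 𝔉.Ops C) : 𝔉'.F ⥤ C :=
  Φ.f.pointwiseLeftKanExtension O.functor

/-- The colimit map `O X ⟶ f_* O (X')` belonging to `φ : f X ⟶ X'`. -/
noncomputable def colimMap {𝔉 : FeynmanTriple.{w, u₁, u₂}} {𝔉' : FeynmanTriple.{w, u₃, u₄}}
    (Φ : Hom 𝔉 𝔉') [∀ X' : 𝔉'.F, HasColimitsOfShape (CostructuredArrow Φ.f X') C]
    (O : 𝔉.Ops C) {X : 𝔉.F} {X' : 𝔉'.F} (φ : Φ.f.obj X ⟶ X') :
    O.functor.obj X ⟶ (pushFunctor Φ O).obj X' :=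
  colimit.ι (CostructuredArrow.proj Φ.f X' ⋙ O.functor) (CostructuredArrow.mk φ)

/-- A structure of an `F'-Op` on `f_* O` for which the colimit maps `μ_X : O X ⟶ f_* O (f X)`, that
belong to the identities of the `f X` and form the unit of the Kan extension, are monoidal. -/
structure PushStructure {𝔉 : FeynmanTriple.{w, u₁, u₂}} {𝔉' : FeynmanTriple.{w, u₃, u₄}}
    (Φ : Hom 𝔉 𝔉') [∀ X' : 𝔉'.F, HasColimitsOfShape (CostructuredArrow Φ.f X') C]
    (O : 𝔉.Ops C) where
  /-- the strong symmetric monoidal structure -/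
  braided : (pushFunctor Φ O).Braided
  /-- the unit is a monoidal natural transformation -/
  isMonoidal_unit : NatTrans.IsMonoidal (Φ.f.pointwiseLeftKanExtensionUnit O.functor)

/-- `f_* O` as an `F'-Op`. -/
noncomputable abbrev PushStructure.op {𝔉 : FeynmanTriple.{w, u₁, u₂}}
    {𝔉' : FeynmanTriple.{w, u₃, u₄}} {Φ : Hom 𝔉 𝔉'}
    [∀ X' : 𝔉'.F, HasColimitsOfShape (CostructuredArrow Φ.f X') C] {O : 𝔉.Ops C}
    (B : PushStructure Φ O) : 𝔉'.Ops C :=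
  { functor := pushFunctor Φ O
    braided := B.braided }

/-- The decoration `F_{dec O}` by an `F-Op` in `C`, where the elements of the objects of `C` are
given by a symmetric monoidal functor `U : C ⥤ Set`. -/
abbrev decOp (U : C ⥤ Type w) [U.Braided] (O : 𝔉.Ops C) :
    FeynmanTriple.{w, max u₁ w, max u₂ w} :=
  𝔉.dec (O.functor ⋙ U)

/-- The forgetful morphism `F_{dec O} ⟶ F`. -/
abbrev forgetOp (U : C ⥤ Type w) [U.Braided] (O : 𝔉.Ops C) : Hom (𝔉.decOp U O) 𝔉 :=
  𝔉.forget (O.functor ⋙ U)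

/-- The morphism `σ_dec : F_{dec O} ⟶ F_{dec P}`, `(X, a) ↦ (X, σ_X a)`. -/
abbrev decOpMap (U : C ⥤ Type w) [U.Braided] {O P : 𝔉.Ops C} (σ : Ops.Hom 𝔉 O P) :
    Hom (𝔉.decOp U O) (𝔉.decOp U P) :=
  𝔉.decMap (Functor.whiskerRight σ.hom U)

end FeynmanTriple

/-- The elements `Hom(𝟙, X)` of the objects `X` of a Cartesian monoidal category form a strong
symmetric monoidal functor to sets. -/
noncomputable instance pointsBraided (C : Type u) [Category.{v} C] [CartesianMonoidalCategory C]
    [BraidedCategory C] : (coyoneda.obj (op (𝟙_ C))).Braided :=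
  Functor.Braided.ofChosenFiniteProducts _

universe v₂ v₃ u₅ u₆

namespace FreeSymm

section Basic

variable {V : Type u}

instance (X : FreeSymm V) : Finite X.idx := X.fin

/-- The subfamily of the members with a property. -/
def restrict (X : FreeSymm V) (p : X.idx → Prop) : FreeSymm V :=
  ⟨{i // p i}, inferInstance, fun i => X.obj i.1⟩

/-- The family without its member `i`. -/
abbrev erase (X : FreeSymm V) (i : X.idx) : FreeSymm V := restrict X (· ≠ i)

theorem card_erase {X : FreeSymm V} {n : ℕ} (h : Nat.card X.idx = n + 1) (i : X.idx) :
    Nat.card (erase X i).idx = n := by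
  classical
  have := Fintype.ofFinite X.idx
  change Nat.card {k // k ≠ i} = n
  rw [Nat.card_eq_fintype_card] at h ⊢
  rw [Fintype.card_subtype_compl, h]
  simp

variable [Category.{v} V]

theorem map_eq_of_hom_eq {X Y : FreeSymm V} {f g : X ⟶ Y} (h : f = g) (i : X.idx) :
    Hom.map f i = Hom.map g i := by rw [h]

/-- A morphism of families is invertible if its index map has an inverse and its components are
isomorphisms. -/
theorem isIso_of_isIso_map {X Y : FreeSymm V} (f : X ⟶ Y)
    (h : ∀ i, IsIso (Hom.map f i).2) : IsIso f := by
  let e := Equiv.ofBijective _ f.bij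
  have key : ∀ j : Y.idx, ∃ p : Σ i : X.idx, Y.obj j ⟶ X.obj i,
      (⟨(Hom.map f p.1).1, p.2 ≫ (Hom.map f p.1).2⟩ : Σ k : Y.idx, Y.obj j ⟶ Y.obj k) = ⟨j, 𝟙 _⟩ ∧
      p.1 = e.symm j := by
    intro j
    obtain ⟨i, rfl⟩ := e.surjective j
    have := h i
    exact ⟨⟨i, @inv _ _ _ _ (Hom.map f i).2 (h i)⟩, Sigma.ext rfl
      (heq_of_eq (@IsIso.inv_hom_id _ _ _ _ _ (h i))), by simp⟩
  choose p hp hp' using key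
  have hb : Function.Bijective fun j => (p j).1 := by
    have : (fun j => (p j).1) = e.symm := funext hp'
    rw [this]; exact e.symm.bijective
  let g : Y ⟶ X := ⟨p, hb⟩
  have hg : g ≫ f = 𝟙 Y := hom_ext hp
  refine ⟨g, hom_ext fun i => ?_, hg⟩
  have h' : Hom.map ((f ≫ g) ≫ f) i = Hom.map f i := by
    rw [Category.assoc, hg, Category.comp_id]
  generalize f ≫ g = r at h' ⊢
  have h1 : (Hom.map r i).1 = i := f.bij.1 (congrArg Sigma.fst h')
  rw [comp_map] at h'
  rcases hr : Hom.map r i with ⟨k, a⟩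
  rw [hr] at h1 h'
  obtain rfl : k = i := h1
  have h2 : a ≫ (Hom.map f k).2 = (Hom.map f k).2 := eq_of_heq (Sigma.ext_iff.1 h').2
  have := h k
  have : a = 𝟙 _ := by
    rw [← cancel_mono (Hom.map f k).2, h2, Category.id_comp]
  rw [this, id_map]

/-- A family is the tensor product of a subfamily and its complement. -/
def glue (X : FreeSymm V) (p : X.idx → Prop) :
    restrict X p ⊗ restrict X (fun i => ¬ p i) ⟶ X :=
  ⟨fun i => match i with
    | .inl i => ⟨i.1, 𝟙 (X.obj i.1)⟩
    | .inr i => ⟨i.1, 𝟙 (X.obj i.1)⟩, by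
    classical
    refine bijective_of_eq (Equiv.sumCompl p) ?_
    rintro (i | i) <;> rfl⟩

instance (X : FreeSymm V) (p : X.idx → Prop) : IsIso (glue X p) :=
  isIso_of_isIso_map _ (by
    rintro (i | i)
    · exact inferInstanceAs (IsIso (𝟙 (X.obj i.1)))
    · exact inferInstanceAs (IsIso (𝟙 (X.obj i.1))))

/-- A family is the tensor product of one of its members and the others. -/
def split (X : FreeSymm V) (i : X.idx) : (of V).obj (X.obj i) ⊗ erase X i ⟶ X :=
  ⟨fun k => match k with
    | .inl () => ⟨i, 𝟙 (X.obj i)⟩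
    | .inr k => ⟨k.1, 𝟙 (X.obj k.1)⟩, by
    constructor
    · rintro (⟨⟨⟩⟩ | k) (⟨⟨⟩⟩ | l) h
      · rfl
      · exact (l.2 h.symm).elim
      · exact (k.2 h).elim
      · exact congrArg _ (Subtype.ext h)
    · intro k
      by_cases h : k = i
      · exact ⟨.inl (), h.symm⟩
      · exact ⟨.inr ⟨k, h⟩, rfl⟩⟩

instance split_isIso (X : FreeSymm V) (i : X.idx) : IsIso (split X i) :=
  isIso_of_isIso_map _ (by
    rintro (⟨⟨⟩⟩ | k)
    · exact inferInstanceAs (IsIso (𝟙 (X.obj i)))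
    · exact inferInstanceAs (IsIso (𝟙 (X.obj k.1))))

/-- The isomorphism of the unit with an empty family. -/
def unitTo (X : FreeSymm V) [IsEmpty X.idx] : 𝟙_ (FreeSymm V) ⟶ X :=
  ⟨fun i => i.elim, ⟨fun i => i.elim, fun i => isEmptyElim i⟩⟩

instance (X : FreeSymm V) [IsEmpty X.idx] : IsIso (unitTo X) :=
  isIso_of_isIso_map _ (fun i => i.elim)

theorem unit_hom_ext {X : FreeSymm V} (f g : 𝟙_ (FreeSymm V) ⟶ X) : f = g :=
  hom_ext fun i => i.elim

theorem to_unit_hom_ext {X : FreeSymm V} (f g : X ⟶ 𝟙_ (FreeSymm V)) : f = g :=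
  hom_ext fun i => (Hom.map f i).1.elim

/-- Induction on the number of members of a family. -/
theorem induction {P : FreeSymm V → Prop} (h0 : P (𝟙_ _))
    (h1 : ∀ x X, P X → P ((of V).obj x ⊗ X))
    (hi : ∀ {X Y : FreeSymm V} (f : X ⟶ Y) [IsIso f], P X → P Y) (X : FreeSymm V) : P X := by
  obtain ⟨n, hn⟩ : ∃ n, Nat.card X.idx = n := ⟨_, rfl⟩
  induction n generalizing X with
  | zero =>
    have : IsEmpty X.idx := (Nat.card_eq_zero.1 hn).resolve_right (by
      simpa using X.fin)
    exact hi (unitTo X) h0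
  | succ n ih =>
    have : Nonempty X.idx := (Nat.card_pos_iff.1 (by omega)).1
    let i : X.idx := Classical.arbitrary _
    exact hi (split X i) (h1 _ _ (ih _ (card_erase hn i)))

theorem tensorHom_map_inl {X Y X' Y' : FreeSymm V} (f : X ⟶ Y) (g : X' ⟶ Y') (i : X.idx) :
    Hom.map (f ⊗ₘ g) (.inl i) = ⟨.inl (Hom.map f i).1, (Hom.map f i).2⟩ := rfl

theorem tensorHom_map_inr {X Y X' Y' : FreeSymm V} (f : X ⟶ Y) (g : X' ⟶ Y') (i : X'.idx) :
    Hom.map (f ⊗ₘ g) (.inr i) = ⟨.inr (Hom.map g i).1, (Hom.map g i).2⟩ := rfl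

theorem tensorHom_injective {X Y X' Y' : FreeSymm V} {f f' : X ⟶ Y} {g g' : X' ⟶ Y'}
    (h : f ⊗ₘ g = f' ⊗ₘ g') : f = f' ∧ g = g' := by
  constructor
  · refine hom_ext fun i => ?_
    have := map_eq_of_hom_eq h (.inl i)
    rw [tensorHom_map_inl, tensorHom_map_inl] at this
    obtain ⟨h1, h2⟩ := Sigma.ext_iff.1 this
    exact Sigma.ext (Sum.inl.inj h1) h2
  · refine hom_ext fun i => ?_
    have := map_eq_of_hom_eq h (.inr i)
    rw [tensorHom_map_inr, tensorHom_map_inr] at this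
    obtain ⟨h1, h2⟩ := Sigma.ext_iff.1 this
    exact Sigma.ext (Sum.inr.inj h1) h2

/-- The restriction of a morphism of families to subfamilies that correspond to each other. -/
def restrictMap {X Y : FreeSymm V} (f : X ⟶ Y) (p : X.idx → Prop) (q : Y.idx → Prop)
    (h : ∀ i, p i ↔ q (Hom.map f i).1) : restrict X p ⟶ restrict Y q :=
  ⟨fun i => ⟨⟨(Hom.map f i.1).1, (h i.1).1 i.2⟩, (Hom.map f i.1).2⟩, by
    constructor
    · intro i k hik
      exact Subtype.ext (f.bij.1 (congrArg Subtype.val hik))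
    · rintro ⟨k, hk⟩
      obtain ⟨i, rfl⟩ := f.bij.2 k
      exact ⟨⟨i, (h i).2 hk⟩, rfl⟩⟩

theorem split_naturality {X Y : FreeSymm V} (f : X ⟶ Y) (i : X.idx) :
    split X i ≫ f = ((of V).map (Hom.map f i).2 ⊗ₘ restrictMap f (· ≠ i) (· ≠ (Hom.map f i).1)
      (fun _ => f.bij.1.ne_iff.symm)) ≫ split Y (Hom.map f i).1 := by
  refine hom_ext ?_
  rintro (⟨⟨⟩⟩ | k)
  · exact Sigma.ext rfl (heq_of_eq (sigma_comp_id _).symm)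
  · exact Sigma.ext rfl (heq_of_eq (sigma_comp_id _).symm)

end Basic

end FreeSymm

namespace FreeSymm

section Extend

open Functor.LaxMonoidal Functor.OplaxMonoidal Functor.Monoidal

variable {V : Type u} [Category.{v} V] {M : Type u₂} [Category.{v₁} M]

section Step

variable {S S' : FreeSymm V ⥤ M} (e : of V ⋙ S ⟶ of V ⋙ S')

/-- The component of `e` at `x`. -/
def ofApp (x : V) : S.obj ((of V).obj x) ⟶ S'.obj ((of V).obj x) := e.app x

theorem ofApp_naturality {x y : V} (a : x ⟶ y) :
    S.map ((of V).map a) ≫ ofApp e y = ofApp e x ≫ S'.map ((of V).map a) := e.naturality a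

variable [MonoidalCategory M] [S.Monoidal] [S'.Monoidal]

/-- The morphism `S X ⟶ S' X` determined by a morphism `S Y ⟶ S' Y` if `X` is the tensor product of
`x` and `Y`. -/
noncomputable def step {x : V} {X Y : FreeSymm V} (g : (of V).obj x ⊗ Y ⟶ X) [IsIso g]
    (t : S.obj Y ⟶ S'.obj Y) : S.obj X ⟶ S'.obj X :=
  S.map (inv g) ≫ δ S _ _ ≫ (ofApp e x ⊗ₘ t) ≫ μ S' _ _ ≫ S'.map g

theorem map_step {x : V} {X Y : FreeSymm V} (g : (of V).obj x ⊗ Y ⟶ X) [IsIso g]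
    (t : S.obj Y ⟶ S'.obj Y) :
    S.map g ≫ step e g t = δ S _ _ ≫ (ofApp e x ⊗ₘ t) ≫ μ S' _ _ ≫ S'.map g := by
  rw [step, ← Category.assoc, ← S.map_comp, IsIso.hom_inv_id, S.map_id, Category.id_comp]

theorem step_naturality {x x' : V} {X X' Y Y' : FreeSymm V} (g : (of V).obj x ⊗ Y ⟶ X) [IsIso g]
    (g' : (of V).obj x' ⊗ Y' ⟶ X') [IsIso g'] (f : X ⟶ X') (a : x ⟶ x') (b : Y ⟶ Y')
    (h : g ≫ f = ((of V).map a ⊗ₘ b) ≫ g') (t : S.obj Y ⟶ S'.obj Y) (t' : S.obj Y' ⟶ S'.obj Y')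
    (ht : S.map b ≫ t' = t ≫ S'.map b) :
    S.map f ≫ step e g' t' = step e g t ≫ S'.map f := by
  rw [← cancel_epi (S.map g), ← Category.assoc, ← S.map_comp, h, S.map_comp, Category.assoc,
    map_step, reassoc_of% (map_step e g t), ← S'.map_comp, h, S'.map_comp,
    ← Functor.OplaxMonoidal.δ_natural_assoc, tensorHom_comp_tensorHom_assoc, ofApp_naturality, ht,
    ← tensorHom_comp_tensorHom_assoc, Functor.LaxMonoidal.μ_natural_assoc]

end Step

variable [MonoidalCategory M] [SymmetricCategory M]
variable {S S' : FreeSymm V ⥤ M} [S.Braided] [S'.Braided] (e : of V ⋙ S ⟶ of V ⋙ S')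

theorem step_step {x y : V} {X Y Z : FreeSymm V} (g : (of V).obj x ⊗ Y ⟶ X) [IsIso g]
    (h : (of V).obj y ⊗ Z ⟶ Y) [IsIso h] (t : S.obj Z ⟶ S'.obj Z) :
    S.map ((α_ _ _ _).hom ≫ (_ ◁ h) ≫ g) ≫ step e g (step e h t) =
      δ S _ _ ≫ ((δ S _ _ ≫ (ofApp e x ⊗ₘ ofApp e y) ≫ μ S' _ _) ⊗ₘ t) ≫ μ S' _ _ ≫
        S'.map ((α_ _ _ _).hom ≫ (_ ◁ h) ≫ g) := by
  have h1 : S.map (_ ◁ h) ≫ δ S _ _ ≫ (ofApp e x ⊗ₘ step e h t) ≫ μ S' _ _ =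
      δ S _ _ ≫ (_ ◁ δ S _ _) ≫ (ofApp e x ⊗ₘ (ofApp e y ⊗ₘ t)) ≫ (S'.obj _ ◁ μ S' _ _) ≫ μ S' _ _ ≫
        S'.map (_ ◁ h) := by
    rw [← Functor.OplaxMonoidal.δ_natural_right_assoc, ← Functor.LaxMonoidal.μ_natural_right]
    simp only [← id_tensorHom, tensorHom_comp_tensorHom_assoc, Category.id_comp, Category.comp_id,
      map_step]
  simp only [S.map_comp, S'.map_comp, Category.assoc]
  rw [map_step, reassoc_of% h1, ← Functor.OplaxMonoidal.associativity_assoc,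
    ← associator_naturality_assoc, ← Functor.LaxMonoidal.associativity_assoc]
  simp only [← tensorHom_id, tensorHom_comp_tensorHom_assoc, Category.id_comp, Category.comp_id]

theorem step_comm {x y : V} {X Y Z Y' Z' : FreeSymm V} (g : (of V).obj x ⊗ Y ⟶ X) [IsIso g]
    (h : (of V).obj y ⊗ Z ⟶ Y) [IsIso h] (t : S.obj Z ⟶ S'.obj Z)
    (g' : (of V).obj y ⊗ Y' ⟶ X) [IsIso g'] (h' : (of V).obj x ⊗ Z' ⟶ Y') [IsIso h']
    (t' : S.obj Z' ⟶ S'.obj Z') (c : Z ⟶ Z') (hc : S.map c ≫ t' = t ≫ S'.map c)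
    (H : (α_ _ _ _).hom ≫ (_ ◁ h) ≫ g =
      ((β_ _ _).hom ⊗ₘ c) ≫ (α_ _ _ _).hom ≫ (_ ◁ h') ≫ g') :
    step e g (step e h t) = step e g' (step e h' t') := by
  have hb : S.map (β_ ((of V).obj x) ((of V).obj y)).hom ≫
      (δ S _ _ ≫ (ofApp e y ⊗ₘ ofApp e x) ≫ μ S' _ _) =
      (δ S _ _ ≫ (ofApp e x ⊗ₘ ofApp e y) ≫ μ S' _ _) ≫ S'.map (β_ _ _).hom := by
    simp [Functor.map_braiding]
  rw [← cancel_epi (S.map ((α_ _ _ _).hom ≫ (_ ◁ h) ≫ g)), step_step]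
  conv_rhs => rw [H, S.map_comp, Category.assoc, step_step]
  rw [← Functor.OplaxMonoidal.δ_natural_assoc, tensorHom_comp_tensorHom_assoc, hb, hc,
    ← tensorHom_comp_tensorHom_assoc, Functor.LaxMonoidal.μ_natural_assoc, H]
  simp only [S'.map_comp]

theorem isEmpty_of_card {V : Type u} {X : FreeSymm V} (h : Nat.card X.idx = 0) : IsEmpty X.idx :=
  (Nat.card_eq_zero.1 h).resolve_right (not_infinite_iff_finite.2 X.fin)

theorem nonempty_of_card {V : Type u} {X : FreeSymm V} {n : ℕ} (h : Nat.card X.idx = n + 1) :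
    Nonempty X.idx :=
  (Nat.card_pos_iff.1 (by omega)).1

/-- The extension of `e` to families with `n` members. -/
noncomputable def extendAux : ∀ (n : ℕ) (X : FreeSymm V), Nat.card X.idx = n →
    (S.obj X ⟶ S'.obj X)
  | 0, X, h =>
    haveI := isEmpty_of_card h
    S.map (inv (unitTo X)) ≫ η S ≫ ε S' ≫ S'.map (unitTo X)
  | n + 1, X, h =>
    haveI := nonempty_of_card h
    step e (split X (Classical.arbitrary _)) (extendAux n (erase X _) (card_erase h _))

/-- The exchange of the order in which two members are removed from a family. -/
def eraseComm (X : FreeSymm V) {i k : X.idx} (hk : k ≠ i) :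
    erase (erase X i) ⟨k, hk⟩ ⟶ erase (erase X k) ⟨i, hk.symm⟩ :=
  ⟨fun m => ⟨⟨⟨m.1.1, fun h => m.2 (Subtype.ext h)⟩, fun h => m.1.2 (congrArg Subtype.val h)⟩,
    𝟙 (X.obj m.1.1)⟩, by
    constructor
    · intro a b h
      exact Subtype.ext (Subtype.ext (congrArg (fun x => x.1.1) h))
    · intro m
      exact ⟨⟨⟨m.1.1, fun h => m.2 (Subtype.ext h)⟩, fun h => m.1.2 (congrArg Subtype.val h)⟩, rfl⟩⟩

theorem split_split (X : FreeSymm V) {i k : X.idx} (hk : k ≠ i) :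
    (α_ _ _ _).hom ≫ (_ ◁ split (erase X i) ⟨k, hk⟩) ≫ split X i =
      ((β_ _ _).hom ⊗ₘ eraseComm X hk) ≫ (α_ _ _ _).hom ≫
        (_ ◁ split (erase X k) ⟨i, hk.symm⟩) ≫ split X k := by
  refine hom_ext ?_
  rintro ((⟨⟨⟩⟩ | ⟨⟨⟩⟩) | m)
  · exact Sigma.ext rfl (heq_of_eq
      (show 𝟙 (X.obj i) ≫ 𝟙 _ ≫ 𝟙 _ = 𝟙 _ ≫ 𝟙 _ ≫ 𝟙 _ ≫ 𝟙 _ by simp))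
  · exact Sigma.ext rfl (heq_of_eq
      (show 𝟙 (X.obj k) ≫ 𝟙 _ ≫ 𝟙 _ = 𝟙 _ ≫ 𝟙 _ ≫ 𝟙 _ ≫ 𝟙 _ by simp))
  · exact Sigma.ext rfl (heq_of_eq
      (show 𝟙 (X.obj m.1.1) ≫ 𝟙 _ ≫ 𝟙 _ = 𝟙 _ ≫ 𝟙 _ ≫ 𝟙 _ ≫ 𝟙 _ by simp))

theorem extendAux_spec (n : ℕ) :
    (∀ (X Y : FreeSymm V) (hX : Nat.card X.idx = n) (hY : Nat.card Y.idx = n) (f : X ⟶ Y),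
      S.map f ≫ extendAux e n Y hY = extendAux e n X hX ≫ S'.map f) ∧
    ∀ (X : FreeSymm V) (h : Nat.card X.idx = n + 1) (i : X.idx),
      extendAux e (n + 1) X h =
        step e (split X i) (extendAux e n (erase X i) (card_erase h i)) := by
  induction n with
  | zero =>
    constructor
    · intro X Y hX hY f
      have := isEmpty_of_card hX
      have := isEmpty_of_card hY
      have h : unitTo X ≫ f = unitTo Y := unit_hom_ext _ _
      have h' : f ≫ inv (unitTo Y) = inv (unitTo X) := to_unit_hom_ext _ _
      simp only [extendAux]
      rw [← Category.assoc, ← S.map_comp, h', ← h, S'.map_comp]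
      simp only [Category.assoc]
    · intro X h i
      have : Subsingleton X.idx := (Nat.card_eq_one_iff_unique.1 h).1
      rw [Subsingleton.elim i (@Classical.arbitrary X.idx (nonempty_of_card h))]
      rfl
  | succ n ih =>
    constructor
    · intro X Y hX hY f
      let i : X.idx := @Classical.arbitrary X.idx (nonempty_of_card hX)
      rw [ih.2 X hX i, ih.2 Y hY (Hom.map f i).1]
      exact step_naturality e _ _ f _ _ (split_naturality f i) _ _ (ih.1 _ _ _ _ _)
    · intro X h i
      have key : ∀ i k : X.idx,
          step e (split X i) (extendAux e (n + 1) (erase X i) (card_erase h i)) =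
          step e (split X k) (extendAux e (n + 1) (erase X k) (card_erase h k)) := by
        intro i k
        by_cases hk : k = i
        · subst hk; rfl
        · rw [ih.2 (erase X i) (card_erase h i) ⟨k, hk⟩,
            ih.2 (erase X k) (card_erase h k) ⟨i, Ne.symm hk⟩]
          exact @step_comm _ _ _ _ _ _ _ _ _ _ e _ _ _ _ _ _ _ (split X i) (split_isIso _ _)
            (split (erase X i) ⟨k, hk⟩) (split_isIso _ _) _ (split X k) (split_isIso _ _)
            (split (erase X k) ⟨i, Ne.symm hk⟩) (split_isIso _ _) _ (eraseComm X hk)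
            (ih.1 _ _ _ _ _) (split_split X hk)
      exact key (@Classical.arbitrary X.idx (nonempty_of_card h)) i

theorem extendAux_card {n : ℕ} (X : FreeSymm V) (h : Nat.card X.idx = n) :
    extendAux e _ X rfl = extendAux e n X h := by
  subst h; rfl

/-- The extension of `e` to a natural transformation. -/
noncomputable def extend : S ⟶ S' where
  app X := extendAux e _ X rfl
  naturality X Y f := by
    have h : Nat.card X.idx = Nat.card Y.idx := Nat.card_congr (Equiv.ofBijective _ f.bij)
    rw [extendAux_card e X h]
    exact (extendAux_spec e _).1 X Y _ _ f

theorem extend_app {n : ℕ} (X : FreeSymm V) (h : Nat.card X.idx = n) :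
    (extend e).app X = extendAux e n X h := extendAux_card e X h

theorem extend_unit : ε S ≫ (extend e).app (𝟙_ _) = ε S' := by
  have h : Nat.card (𝟙_ (FreeSymm V)).idx = 0 := Nat.card_of_isEmpty (α := Empty)
  have := isEmpty_of_card h
  have h' : unitTo (𝟙_ (FreeSymm V)) = 𝟙 _ := unit_hom_ext _ _
  rw [extend_app e _ h]
  simp [extendAux, h']

theorem extend_split (X : FreeSymm V) (i : X.idx) :
    (extend e).app X = step e (split X i) ((extend e).app (erase X i)) := by
  obtain ⟨n, hn⟩ : ∃ n, Nat.card X.idx = n + 1 :=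
    ⟨Nat.card X.idx - 1, by have : 0 < Nat.card X.idx := Nat.card_pos_iff.2 ⟨⟨i⟩, X.fin⟩; omega⟩
  rw [extend_app e X hn, (extendAux_spec e n).2 X hn i, extend_app e _ (card_erase hn i)]

theorem extend_of_tensor (x : V) (Y : FreeSymm V) :
    μ S _ _ ≫ (extend e).app ((of V).obj x ⊗ Y) =
      (ofApp e x ⊗ₘ (extend e).app Y) ≫ μ S' _ _ := by
  let X : FreeSymm V := (of V).obj x ⊗ Y
  let i : X.idx := .inl ()
  let b : Y ⟶ erase X i := ⟨fun k => ⟨⟨.inr k, fun h => nomatch h⟩, 𝟙 (Y.obj k)⟩, by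
    constructor
    · intro k l h
      exact Sum.inr.inj (congrArg Subtype.val h)
    · rintro ⟨⟨⟨⟩⟩ | k, hk⟩
      · exact (hk rfl).elim
      · exact ⟨k, rfl⟩⟩
  have h : 𝟙 X ≫ 𝟙 X = ((of V).map (𝟙 x) ⊗ₘ b) ≫ split X i := by
    refine hom_ext ?_
    rintro (⟨⟨⟩⟩ | k) <;> rfl
  have := step_naturality e (𝟙 X) (split X i) (𝟙 X) (𝟙 x) b h _ _ ((extend e).naturality b)
  rw [← extend_split, S.map_id, S'.map_id, Category.id_comp, Category.comp_id] at this
  rw [this, ← Category.id_comp (step e (𝟙 X) _), ← S.map_id, map_step]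
  simp [X]

theorem extend_of (x : V) : (extend e).app ((of V).obj x) = ofApp e x := by
  have h1 := (extend e).naturality (ρ_ ((of V).obj x)).hom
  have h2 := extend_of_tensor e x (𝟙_ _)
  have h3 := extend_unit e
  rw [← cancel_epi (S.map (ρ_ ((of V).obj x)).hom), h1, ← cancel_epi (μ S _ _),
    reassoc_of% h2, ← cancel_epi (_ ◁ ε S), ← Functor.LaxMonoidal.right_unitality_assoc,
    ← rightUnitor_naturality, Functor.LaxMonoidal.right_unitality S']
  simp only [← tensorHom_id, ← id_tensorHom, tensorHom_comp_tensorHom_assoc, Category.id_comp,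
    Category.comp_id, h3]

instance extend_isMonoidal : NatTrans.IsMonoidal (extend e) where
  unit := extend_unit e
  tensor X Y := by
    induction X using FreeSymm.induction with
    | h0 =>
      have h1 := (extend e).naturality (λ_ Y).hom
      have h3 := extend_unit e
      rw [← cancel_epi (ε S ▷ _), ← cancel_mono (S'.map (λ_ Y).hom), Category.assoc, Category.assoc,
        ← h1, ← Functor.LaxMonoidal.left_unitality_assoc, Category.assoc]
      rw [← tensorHom_id, Category.assoc, tensorHom_comp_tensorHom_assoc, h3, Category.id_comp,
        ← leftUnitor_naturality, Functor.LaxMonoidal.left_unitality S', ← id_tensorHom,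
        ← tensorHom_id, tensorHom_comp_tensorHom_assoc, Category.id_comp, Category.comp_id]
    | h1 x X ih =>
      have h1 := (extend e).naturality (α_ ((of V).obj x) X Y).hom
      have h2 := extend_of_tensor e x (X ⊗ Y)
      have h3 := extend_of_tensor e x X
      rw [← cancel_epi (μ S _ _ ▷ _), ← cancel_mono (S'.map (α_ ((of V).obj x) X Y).hom)]
      simp only [Category.assoc]
      rw [← h1, Functor.LaxMonoidal.associativity_assoc, h2, ← id_tensorHom, ← tensorHom_id,
        tensorHom_comp_tensorHom_assoc, ih, tensorHom_comp_tensorHom_assoc, h3, Category.id_comp,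
        Category.id_comp]
      have h4 := Functor.LaxMonoidal.associativity S' ((of V).obj x) X Y
      have h5 : ((ofApp e x ⊗ₘ (extend e).app X) ≫ μ S' _ _) ⊗ₘ (extend e).app Y =
        ((ofApp e x ⊗ₘ (extend e).app X) ⊗ₘ (extend e).app Y) ≫ μ S' _ _ ▷ _ := by
        rw [← tensorHom_id, tensorHom_comp_tensorHom, Category.comp_id]
      have h6 : (ofApp e x ⊗ₘ ((extend e).app X ⊗ₘ (extend e).app Y) ≫ μ S' _ _) =
        (ofApp e x ⊗ₘ ((extend e).app X ⊗ₘ (extend e).app Y)) ≫ _ ◁ μ S' _ _ := by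
        rw [← id_tensorHom, tensorHom_comp_tensorHom, Category.comp_id]
      rw [h5, h6, Category.assoc, Category.assoc, h4, associator_naturality_assoc]
    | @hi X X' f _ ih =>
      have h1 := (extend e).naturality (f ▷ Y)
      have h2 := (extend e).naturality f
      rw [← cancel_epi (S.map f ▷ _), Functor.LaxMonoidal.μ_natural_left_assoc, h1,
        reassoc_of% ih, ← Functor.LaxMonoidal.μ_natural_left, ← tensorHom_id, ← tensorHom_id,
        tensorHom_comp_tensorHom_assoc, tensorHom_comp_tensorHom_assoc, h2, Category.id_comp,
        Category.comp_id]

theorem extend_isIso [IsIso e] : IsIso (extend e) := by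
  have : ∀ X, IsIso ((extend e).app X) := by
    intro X
    induction X using FreeSymm.induction with
    | h0 =>
      have := extend_unit e
      rw [← IsIso.eq_inv_comp] at this
      rw [this]; infer_instance
    | h1 x X ih =>
      have := extend_of_tensor e x X
      rw [← IsIso.eq_inv_comp] at this
      have h : IsIso (ofApp e x) := inferInstanceAs (IsIso (e.app x))
      rw [this]; infer_instance
    | hi f ih =>
      have := (extend e).naturality f
      rw [← IsIso.eq_inv_comp] at this
      rw [this]; infer_instance
  exact NatIso.isIso_of_isIso_app _

/-- Two symmetric monoidal functors on `FreeSymm V` that agree on `V` are isomorphic. -/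
noncomputable def extendIso (e : of V ⋙ S ≅ of V ⋙ S') : S ≅ S' :=
  @asIso _ _ _ _ (extend e.hom) (extend_isIso e.hom)

instance (e : of V ⋙ S ≅ of V ⋙ S') : NatTrans.IsMonoidal (extendIso e).hom :=
  extend_isMonoidal e.hom

end Extend

/-! ### Functoriality -/

section Map

open Functor.LaxMonoidal Functor.OplaxMonoidal Functor.Monoidal

variable {V : Type u} [Category.{v} V] {W : Type u₂} [Category.{v₁} W]

/-- The functor on families induced by a functor on their members. -/
def mapFunctor (κ : V ⥤ W) : FreeSymm V ⥤ FreeSymm W where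
  obj X := ⟨X.idx, X.fin, fun i => κ.obj (X.obj i)⟩
  map f := ⟨fun i => ⟨(Hom.map f i).1, κ.map (Hom.map f i).2⟩, f.bij⟩
  map_id _ := hom_ext fun _ => Sigma.ext rfl (heq_of_eq (κ.map_id _))
  map_comp _ _ := hom_ext fun _ => Sigma.ext rfl (heq_of_eq (κ.map_comp _ _))

/-- `mapFunctor κ` preserves tensor products. -/
def mapTensor (κ : V ⥤ W) (X Y : FreeSymm V) :
    (mapFunctor κ).obj X ⊗ (mapFunctor κ).obj Y ≅ (mapFunctor κ).obj (X ⊗ Y) where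
  hom := ⟨fun i => match i with
    | .inl i => ⟨.inl i, 𝟙 (κ.obj (X.obj i))⟩
    | .inr i => ⟨.inr i, 𝟙 (κ.obj (Y.obj i))⟩, by
      refine bijective_of_eq (Equiv.refl (X.idx ⊕ Y.idx)) ?_
      rintro (i | i) <;> rfl⟩
  inv := ⟨fun i => match i with
    | .inl i => ⟨.inl i, 𝟙 (κ.obj (X.obj i))⟩
    | .inr i => ⟨.inr i, 𝟙 (κ.obj (Y.obj i))⟩, by
      refine bijective_of_eq (Equiv.refl (X.idx ⊕ Y.idx)) ?_
      rintro (i | i) <;> rfl⟩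
  hom_inv_id := hom_ext (by
    rintro (i | i) <;> exact Sigma.ext rfl (heq_of_eq (Category.id_comp (𝟙 _))))
  inv_hom_id := hom_ext (by
    rintro (i | i) <;> exact Sigma.ext rfl (heq_of_eq (Category.id_comp (𝟙 _))))

/-- `mapFunctor κ` preserves the unit. -/
def mapUnit (κ : V ⥤ W) : 𝟙_ (FreeSymm W) ≅ (mapFunctor κ).obj (𝟙_ (FreeSymm V)) where
  hom := ⟨fun i => i.elim, ⟨fun i => i.elim, fun i => i.elim⟩⟩
  inv := ⟨fun i => i.elim, ⟨fun i => i.elim, fun i => i.elim⟩⟩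
  hom_inv_id := hom_ext fun i => i.elim
  inv_hom_id := hom_ext fun i => i.elim

/-- `mapFunctor κ` is monoidal. -/
def mapCoreMonoidal (κ : V ⥤ W) : (mapFunctor κ).CoreMonoidal where
  εIso := mapUnit κ
  μIso := mapTensor κ
  μIso_hom_natural_left f X := hom_ext (by
    rintro (i | i)
    · exact Sigma.ext rfl (heq_of_eq (sigma_comp_id _))
    · exact Sigma.ext rfl (heq_of_eq (congrArg (𝟙 _ ≫ ·) (κ.map_id _).symm)))
  μIso_hom_natural_right X f := hom_ext (by
    rintro (i | i)
    · exact Sigma.ext rfl (heq_of_eq (congrArg (𝟙 _ ≫ ·) (κ.map_id _).symm))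
    · exact Sigma.ext rfl (heq_of_eq (sigma_comp_id _)))
  associativity X Y Z := hom_ext (by
    rintro ((i | i) | i)
    · exact Sigma.ext rfl (heq_of_eq (show 𝟙 (κ.obj (X.obj i)) ≫ 𝟙 _ ≫ κ.map (𝟙 _) =
        𝟙 _ ≫ 𝟙 _ ≫ 𝟙 _ by simp))
    · exact Sigma.ext rfl (heq_of_eq (show 𝟙 (κ.obj (Y.obj i)) ≫ 𝟙 _ ≫ κ.map (𝟙 _) =
        𝟙 _ ≫ 𝟙 _ ≫ 𝟙 _ by simp))
    · exact Sigma.ext rfl (heq_of_eq (show 𝟙 (κ.obj (Z.obj i)) ≫ 𝟙 _ ≫ κ.map (𝟙 _) =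
        𝟙 _ ≫ 𝟙 _ ≫ 𝟙 _ by simp)))
  left_unitality X := hom_ext (by
    rintro (i | i)
    · exact i.elim
    · exact Sigma.ext rfl (heq_of_eq (show 𝟙 (κ.obj (X.obj i)) = 𝟙 _ ≫ 𝟙 _ ≫ κ.map (𝟙 _) by
        simp)))
  right_unitality X := hom_ext (by
    rintro (i | i)
    · exact Sigma.ext rfl (heq_of_eq (show 𝟙 (κ.obj (X.obj i)) = 𝟙 _ ≫ 𝟙 _ ≫ κ.map (𝟙 _) by
        simp))
    · exact i.elim)

instance (κ : V ⥤ W) : (mapFunctor κ).Braided :=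
  { (mapCoreMonoidal κ).toMonoidal with
    braided := fun X Y => hom_ext (by
      rintro (i | i)
      · exact Sigma.ext rfl (heq_of_eq (congrArg (𝟙 _ ≫ ·) (κ.map_id _)))
      · exact Sigma.ext rfl (heq_of_eq (congrArg (𝟙 _ ≫ ·) (κ.map_id _)))) }

/-- `mapFunctor κ` extends `κ`. -/
def ofCompMapFunctor (κ : V ⥤ W) : of V ⋙ mapFunctor κ ≅ κ ⋙ of W :=
  NatIso.ofComponents (fun _ => Iso.refl _) (fun _ => by
    rw [Iso.refl_hom, Iso.refl_hom]
    exact (Category.comp_id _).trans (Category.id_comp _).symm)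

end Map

end FreeSymm

section CoreEquivalence

/-- A functor from a groupoid `G` that induces an equivalence of `G` with the groupoid of
isomorphisms of `M`. -/
structure IsCoreEquivalence {G : Type u₁} [Category.{v₁} G] {M : Type u₂} [Category.{v₂} M]
    (T : G ⥤ M) : Prop where
  /-- distinct morphisms have distinct images -/
  faithful : T.Faithful
  /-- isomorphisms have preimages -/
  exists_map {X Y : G} (e : T.obj X ≅ T.obj Y) : ∃ f : X ⟶ Y, T.map f = e.hom
  /-- every object is isomorphic to an image -/
  essSurj : T.EssSurj

theorem isEquivalence_functorToCore_iff {G : Type u₁} [Groupoid.{v₁} G] {M : Type u₂}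
    [Category.{v₂} M] (T : G ⥤ M) :
    (Core.functorToCore T).IsEquivalence ↔ IsCoreEquivalence T := by
  constructor
  · intro h
    refine ⟨⟨fun {X Y f g} hfg => ?_⟩, fun {X Y} e => ?_, ⟨fun Y => ?_⟩⟩
    · exact (Core.functorToCore T).map_injective (Core.hom_ext hfg)
    · obtain ⟨f, hf⟩ := (Core.functorToCore T).map_surjective
        (X := X) (Y := Y) (CoreHom.mk e)
      exact ⟨f, congrArg (fun x => x.iso.hom) hf⟩
    · exact ⟨(Core.functorToCore T).objPreimage ⟨Y⟩,
        ⟨(Core.inclusion M).mapIso ((Core.functorToCore T).objObjPreimageIso ⟨Y⟩)⟩⟩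
  · intro h
    refine { faithful := ⟨fun {X Y f g} hfg => ?_⟩, full := ⟨fun {X Y} e => ?_⟩,
             essSurj := ⟨fun Y => ?_⟩ }
    · have := h.faithful
      exact T.map_injective (congrArg (fun x => x.iso.hom) hfg)
    · obtain ⟨f, hf⟩ := h.exists_map e.iso
      exact ⟨f, Core.hom_ext hf⟩
    · have := h.essSurj
      exact ⟨T.objPreimage Y.of, ⟨Core.isoMk (T.objObjPreimageIso Y.of)⟩⟩

theorem IsCoreEquivalence.comp {G : Type u₁} [Category.{v₁} G] {H : Type u₃} [Category.{v₃} H]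
    {M : Type u₂} [Category.{v₂} M] {T : G ⥤ M} (h : IsCoreEquivalence T) (R : H ⥤ G)
    [R.IsEquivalence] : IsCoreEquivalence (R ⋙ T) := by
  have := h.faithful
  have := h.essSurj
  refine ⟨inferInstance, fun {X Y} e => ?_, inferInstance⟩
  obtain ⟨f, hf⟩ := h.exists_map (X := R.obj X) (Y := R.obj Y) e
  obtain ⟨g, rfl⟩ := R.map_surjective f
  exact ⟨g, hf⟩

theorem IsCoreEquivalence.comp' {G : Type u₁} [Category.{v₁} G] {N : Type u₃} [Category.{v₃} N]
    {M : Type u₂} [Category.{v₂} M] {T : G ⥤ M} (h : IsCoreEquivalence T) (Q : M ⥤ N)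
    [Q.IsEquivalence] : IsCoreEquivalence (T ⋙ Q) := by
  have := h.faithful
  have := h.essSurj
  refine ⟨inferInstance, fun {X Y} e => ?_, inferInstance⟩
  obtain ⟨f, hf⟩ := h.exists_map (X := X) (Y := Y) (Q.preimageIso e)
  exact ⟨f, by simp [hf]⟩

end CoreEquivalence

namespace FreeSymm

variable {V : Type u} [Category.{v} V] {W : Type u₂} [Category.{v₁} W]

instance (κ : V ⥤ W) [κ.Faithful] : (mapFunctor κ).Faithful where
  map_injective {X Y f g} h := by
    refine hom_ext fun i => ?_
    have hi := map_eq_of_hom_eq h i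
    change (⟨(Hom.map f i).1, κ.map (Hom.map f i).2⟩ : Σ k, κ.obj (X.obj i) ⟶ κ.obj (Y.obj k)) =
      ⟨(Hom.map g i).1, κ.map (Hom.map g i).2⟩ at hi
    generalize Hom.map f i = p at hi
    generalize Hom.map g i = q at hi
    obtain ⟨k, a⟩ := p
    obtain ⟨l, b⟩ := q
    obtain ⟨h1, h2⟩ := Sigma.ext_iff.1 hi
    obtain rfl : k = l := h1
    exact Sigma.ext rfl (heq_of_eq (κ.map_injective (eq_of_heq h2)))

instance (κ : V ⥤ W) [κ.Full] : (mapFunctor κ).Full where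
  map_surjective f :=
    ⟨⟨fun i => ⟨(Hom.map f i).1, κ.preimage (Hom.map f i).2⟩, f.bij⟩,
      hom_ext fun _ => Sigma.ext rfl (heq_of_eq (κ.map_preimage _))⟩

instance (κ : V ⥤ W) [κ.EssSurj] : (mapFunctor κ).EssSurj where
  mem_essImage Y := by
    let X : FreeSymm V := ⟨Y.idx, Y.fin, fun i => κ.objPreimage (Y.obj i)⟩
    let f : (mapFunctor κ).obj X ⟶ Y :=
      ⟨fun i => ⟨i, (κ.objObjPreimageIso (Y.obj i)).hom⟩, Function.bijective_id⟩
    have : IsIso f := isIso_of_isIso_map f fun i =>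
      inferInstanceAs (IsIso (κ.objObjPreimageIso (Y.obj i)).hom)
    exact ⟨X, ⟨asIso f⟩⟩

instance (κ : V ⥤ W) [κ.IsEquivalence] : (mapFunctor κ).IsEquivalence where

end FreeSymm

theorem InducesEquivalence.transport {G : Type u₁} [Groupoid.{v₁} G] {M : Type u₂} [Category.{v} M]
    [MonoidalCategory M] [SymmetricCategory M] {j : G ⥤ M} (h : InducesEquivalence j)
    {H : Type u₃} [Groupoid.{v₃} H] {N : Type u₄} [Category.{v₂} N]
    [MonoidalCategory N] [SymmetricCategory N] (R : H ⥤ G) [R.IsEquivalence]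
    (Q : M ⥤ N) [Q.Braided] [Q.IsEquivalence] {j' : H ⥤ N} (i : R ⋙ j ⋙ Q ≅ j') :
    InducesEquivalence j' := by
  obtain ⟨T, _, ⟨e⟩, hT⟩ := h
  rw [isEquivalence_functorToCore_iff] at hT
  refine ⟨FreeSymm.mapFunctor R ⋙ T ⋙ Q, inferInstance,
    ⟨(Functor.isoWhiskerRight (FreeSymm.ofCompMapFunctor R) (T ⋙ Q)) ≪≫
      Functor.isoWhiskerLeft R (Functor.isoWhiskerRight e Q) ≪≫ i⟩, ?_⟩
  rw [isEquivalence_functorToCore_iff]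
  exact (hT.comp' Q).comp _

section Lift

variable {A : Type u₁} [Category.{v₁} A] {M : Type u₂} [Category.{v₂} M]

/-- The lift of a functor `N : A ⥤ M` to the category of elements of `E` given by a compatible
family of elements of the `E (N Z)`. -/
def liftElements (N : A ⥤ M) (E : M ⥤ Type w) (s : ∀ Z, E.obj (N.obj Z))
    (hs : ∀ {Z Z' : A} (f : Z ⟶ Z'), E.map (N.map f) (s Z) = s Z') : A ⥤ E.Elements where
  obj Z := ⟨N.obj Z, s Z⟩
  map f := ⟨N.map f, hs f⟩
  map_id Z := Subtype.ext (N.map_id Z)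
  map_comp f g := Subtype.ext (N.map_comp f g)

variable [MonoidalCategory A] [MonoidalCategory M]

open Functor.LaxMonoidal Functor.OplaxMonoidal Functor.Monoidal

/-- The lift of a monoidal functor by a monoidal family of elements is monoidal. -/
def liftElementsCore (N : A ⥤ M) [N.Monoidal] (E : M ⥤ Type w) [E.LaxMonoidal]
    (s : ∀ Z, E.obj (N.obj Z)) (hs : ∀ {Z Z' : A} (f : Z ⟶ Z'), E.map (N.map f) (s Z) = s Z')
    (h1 : E.map (ε N) (unitElt E) = s (𝟙_ A))
    (h2 : ∀ Z Z', E.map (μ N Z Z') (tensorElt E (s Z) (s Z')) = s (Z ⊗ Z')) :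
    (liftElements N E s hs).CoreMonoidal where
  εIso := CategoryOfElements.isoMk _ _ (εIso N) h1
  μIso Z Z' := CategoryOfElements.isoMk _ _ (μIso N Z Z') (h2 Z Z')
  μIso_hom_natural_left f X := Subtype.ext (μ_natural_left N f X)
  μIso_hom_natural_right X f := Subtype.ext (μ_natural_right N X f)
  associativity X Y Z := Subtype.ext (Functor.LaxMonoidal.associativity N X Y Z)
  left_unitality X := Subtype.ext (Functor.LaxMonoidal.left_unitality N X)
  right_unitality X := Subtype.ext (Functor.LaxMonoidal.right_unitality N X)

/-- The lift of a braided functor by a monoidal family of elements is braided. -/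
@[reducible]
def liftElementsBraided [SymmetricCategory A] [SymmetricCategory M]
    (N : A ⥤ M) [N.Braided] (E : M ⥤ Type w) [E.LaxBraided]
    (s : ∀ Z, E.obj (N.obj Z)) (hs : ∀ {Z Z' : A} (f : Z ⟶ Z'), E.map (N.map f) (s Z) = s Z')
    (h1 : E.map (ε N) (unitElt E) = s (𝟙_ A))
    (h2 : ∀ Z Z', E.map (μ N Z Z') (tensorElt E (s Z) (s Z')) = s (Z ⊗ Z')) :
    (liftElements N E s hs).Braided :=
  { (liftElementsCore N E s hs h1 h2).toMonoidal with
    braided := fun X Y => Subtype.ext (Functor.LaxBraided.braided (F := N) X Y) }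

end Lift

section TypeValued

open Functor.LaxMonoidal Functor.OplaxMonoidal Functor.Monoidal

variable {M : Type u₂} [Category.{v₂} M] [MonoidalCategory M]

theorem tensorElt_bijective (E : M ⥤ Type w) [E.Monoidal] (X Y : M) :
    Function.Bijective fun p : E.obj X × E.obj Y => tensorElt E p.1 p.2 :=
  (isIso_iff_bijective (μ E X Y)).1 inferInstance

theorem eq_unitElt (E : M ⥤ Type w) [E.Monoidal] (t : E.obj (𝟙_ M)) : t = unitElt E := by
  obtain ⟨x, hx⟩ := ((isIso_iff_bijective (ε E)).1 inferInstance).2 t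
  rw [← hx]; rfl

theorem map_injective_of_isIso {A : Type u₁} [Category.{v₁} A] (E : A ⥤ Type w) {X Y : A}
    (f : X ⟶ Y) [IsIso f] : Function.Injective (E.map f) :=
  ((isIso_iff_bijective (E.map f)).1 inferInstance).1

/-- The constant functor with value a point is symmetric monoidal. -/
instance constPointBraided [SymmetricCategory M] :
    ((Functor.const M).obj (𝟙_ (Type w))).Braided :=
  letI core : ((Functor.const M).obj (𝟙_ (Type w))).CoreMonoidal :=
    { εIso := Iso.refl _
      μIso := fun _ _ => λ_ _
      μIso_hom_natural_left := fun _ _ => by ext; rfl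
      μIso_hom_natural_right := fun _ _ => by ext; rfl
      associativity := fun _ _ _ => by ext; rfl
      left_unitality := fun _ => by ext; rfl
      right_unitality := fun _ => by ext; rfl }
  { core.toMonoidal with
    braided := fun _ _ => by ext; rfl }

end TypeValued

section Decoration

open Functor.LaxMonoidal Functor.OplaxMonoidal Functor.Monoidal FreeSymm

/-- The functor `(x, a) ↦ (j x, a)`. -/
def elementsLift {G : Type u₁} [Category.{v₁} G] {M : Type u₂} [Category.{v₂} M] (j : G ⥤ M)
    (E : M ⥤ Type w) : (j ⋙ E).Elements ⥤ E.Elements where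
  obj p := ⟨j.obj p.1, p.2⟩
  map g := ⟨j.map g.1, g.2⟩
  map_id _ := Subtype.ext (j.map_id _)
  map_comp _ _ := Subtype.ext (j.map_comp _ _)

variable {G : Type u₁} [Groupoid.{v₁} G] {M : Type u₂} [Category.{v₂} M] {j : G ⥤ M}

/-- Decorations of the members of a family can be pulled back. -/
def pullDecoration (E : M ⥤ Type w) {X Y : FreeSymm G} (f : X ⟶ Y)
    (a : ∀ i, E.obj (j.obj (Y.obj i))) (i : X.idx) : E.obj (j.obj (X.obj i)) :=
  E.map (j.map (Groupoid.inv (Hom.map f i).2)) (a (Hom.map f i).1)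

theorem map_pullDecoration (E : M ⥤ Type w) {X Y : FreeSymm G} (f : X ⟶ Y)
    (a : ∀ i, E.obj (j.obj (Y.obj i))) (i : X.idx) :
    E.map (j.map (Hom.map f i).2) (pullDecoration E f a i) = a (Hom.map f i).1 := by
  rw [pullDecoration, ← types_comp_apply (E.map _) (E.map _), ← E.map_comp, ← j.map_comp,
    Groupoid.inv_comp, j.map_id, E.map_id]
  rfl

variable [MonoidalCategory M] [SymmetricCategory M] (E : M ⥤ Type w) [E.Braided]
  {T : FreeSymm G ⥤ M} [T.Braided]
  (e : of G ⋙ T ≅ j)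

/-- The decoration of one-member families by their elements. -/
def ofDecoration : of (j ⋙ E).Elements ⋙ (Functor.const _).obj (𝟙_ (Type w)) ⟶
    of (j ⋙ E).Elements ⋙ (mapFunctor (CategoryOfElements.π (j ⋙ E)) ⋙ T) ⋙ E where
  app p := ↾fun _ => E.map (e.inv.app p.1) p.2
  naturality p q f := by
    ext x
    have h := type_congr (congrArg E.map (e.inv.naturality f.1)) p.2
    rw [E.map_comp, E.map_comp] at h
    change E.map (e.inv.app q.1) q.2 = E.map (T.map ((of G).map f.1)) (E.map (e.inv.app p.1) p.2)
    exact (congrArg (E.map (e.inv.app q.1)) f.2.symm).trans h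

/-- The decoration of a family determined by decorations of its members. -/
noncomputable def decoration (Z : FreeSymm (j ⋙ E).Elements) :
    E.obj (T.obj ((mapFunctor (CategoryOfElements.π (j ⋙ E))).obj Z)) :=
  (extend (ofDecoration E e)).app Z PUnit.unit

theorem map_decoration {Z Z' : FreeSymm (j ⋙ E).Elements} (f : Z ⟶ Z') :
    E.map (T.map ((mapFunctor (CategoryOfElements.π (j ⋙ E))).map f)) (decoration E e Z) =
      decoration E e Z' :=
  (type_congr ((extend (ofDecoration E e)).naturality f) PUnit.unit).symm

theorem decoration_of (p : (j ⋙ E).Elements) :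
    decoration E e ((of _).obj p) = E.map (e.inv.app p.1) p.2 :=
  type_congr (extend_of (ofDecoration E e) p) PUnit.unit

theorem decoration_unit :
    E.map (ε (mapFunctor (CategoryOfElements.π (j ⋙ E)) ⋙ T)) (unitElt E) =
      decoration E e (𝟙_ _) := by
  have := type_congr (extend_unit (ofDecoration E e)) PUnit.unit
  exact this.symm

theorem decoration_tensor (Z Z' : FreeSymm (j ⋙ E).Elements) :
    E.map (μ (mapFunctor (CategoryOfElements.π (j ⋙ E)) ⋙ T) Z Z')
      (tensorElt E (decoration E e Z) (decoration E e Z')) = decoration E e (Z ⊗ Z') :=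
  (type_congr (NatTrans.IsMonoidal.tensor (τ := extend (ofDecoration E e)) Z Z')
    (show (𝟙_ (Type w) ⊗ 𝟙_ (Type w) : Type w) from (PUnit.unit, PUnit.unit))).symm

/-- A family of elements of the members of a family, as a family of decorated objects. -/
abbrev decorate (E : M ⥤ Type w) (X : FreeSymm G) (a : ∀ i, E.obj (j.obj (X.obj i))) :
    FreeSymm (j ⋙ E).Elements :=
  ⟨X.idx, X.fin, fun i => ⟨X.obj i, a i⟩⟩

theorem decoration_pull {X Y : FreeSymm G} (f : X ⟶ Y) (a : ∀ i, E.obj (j.obj (Y.obj i))) :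
    E.map (T.map f) (decoration E e (decorate E X (pullDecoration E f a))) =
      decoration E e (decorate E Y a) :=
  map_decoration E e (Z := decorate E X (pullDecoration E f a)) (Z' := decorate E Y a)
    ⟨fun i => ⟨(Hom.map f i).1, ⟨(Hom.map f i).2, map_pullDecoration E f a i⟩⟩, f.bij⟩

theorem decoration_of_tensor (x : G) (X : FreeSymm G)
    (a : ∀ i, E.obj (j.obj (((of G).obj x ⊗ X).obj i))) :
    decoration E e (decorate E ((of G).obj x ⊗ X) a) =
      E.map (μ T _ _) (tensorElt E (E.map (e.inv.app x) (a (.inl ())))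
        (decoration E e (decorate E X fun i => a (.inr i)))) := by
  let p : (j ⋙ E).Elements := ⟨x, a (.inl ())⟩
  let q : X.idx → (j ⋙ E).Elements := fun i => ⟨X.obj i, a (.inr i)⟩
  let Z : FreeSymm (j ⋙ E).Elements := (of _).obj p ⊗ decorate E X fun i => a (.inr i)
  let f : Z ⟶ decorate E ((of G).obj x ⊗ X) a :=
    ⟨fun i => match i with
      | .inl () => ⟨.inl (), 𝟙 p⟩
      | .inr i => ⟨.inr i, 𝟙 (q i)⟩, by
      refine bijective_of_eq (Equiv.refl (Unit ⊕ X.idx)) ?_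
      rintro (⟨⟨⟩⟩ | i) <;> rfl⟩
  rw [← map_decoration E e f, ← decoration_tensor, decoration_of E e p,
    ← types_comp_apply (E.map _) (E.map _), ← E.map_comp]
  refine type_congr (congrArg E.map ?_) _
  have hid : μ (mapFunctor (CategoryOfElements.π (j ⋙ E))) ((of _).obj p)
      (decorate E X fun i => a (.inr i)) ≫ (mapFunctor (CategoryOfElements.π (j ⋙ E))).map f =
      𝟙 ((of G).obj x ⊗ X) := by
    refine hom_ext ?_
    rintro (⟨⟨⟩⟩ | i) <;> exact Sigma.ext rfl (heq_of_eq (Category.id_comp (𝟙 _)))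
  exact (Category.assoc _ _ _).trans ((congrArg (μ T _ _ ≫ ·) ((T.map_comp _ _).symm.trans
    ((congrArg T.map hid).trans (T.map_id _)))).trans (Category.comp_id _))

/-- The decoration of a family determined by elements of its members. -/
noncomputable def decorationOfMembers (X : FreeSymm G) (a : ∀ i, E.obj (j.obj (X.obj i))) :
    E.obj (T.obj X) :=
  decoration E e (decorate E X a)

/-- The decorations of a family are determined by unique decorations of its members. -/
theorem decoration_bijective (X : FreeSymm G) :
    Function.Bijective (decorationOfMembers E e X) := by
  induction X using FreeSymm.induction with
  | h0 =>
    refine ⟨fun a b _ => funext fun i => i.elim, fun t => ⟨fun i => i.elim, ?_⟩⟩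
    exact (eq_unitElt (T ⋙ E) _).trans (eq_unitElt (T ⋙ E) t).symm
  | h1 x X ih =>
    have h1 : Function.Bijective fun a : E.obj (j.obj x) => E.map (e.inv.app x) a :=
      (isIso_iff_bijective (E.map (e.inv.app x))).1 inferInstance
    have h2 := tensorElt_bijective E (T.obj ((of G).obj x)) (T.obj X)
    have h3 : Function.Bijective (E.map (μ T ((of G).obj x) X)) :=
      (isIso_iff_bijective (E.map (μ T ((of G).obj x) X))).1 inferInstance
    constructor
    · intro a b hab
      have hab' := (decoration_of_tensor E e x X a).symm.trans
        (hab.trans (decoration_of_tensor E e x X b))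
      have := Prod.ext_iff.1 (h2.1
        (a₁ := (E.map (e.inv.app x) (a (.inl ())), decorationOfMembers E e X fun i => a (.inr i)))
        (a₂ := (E.map (e.inv.app x) (b (.inl ())), decorationOfMembers E e X fun i => b (.inr i)))
        (h3.1 hab'))
      have ha := h1.1 this.1
      have hb := ih.1 this.2
      funext i
      rcases i with ⟨⟨⟩⟩ | i
      · exact ha
      · exact congrFun hb i
    · intro t
      obtain ⟨t, rfl⟩ := h3.2 t
      obtain ⟨⟨t1, t2⟩, rfl⟩ := h2.2 t
      obtain ⟨a1, rfl⟩ := h1.2 t1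
      obtain ⟨a2, rfl⟩ := ih.2 t2
      refine ⟨fun i => match i with
        | .inl () => a1
        | .inr i => a2 i, ?_⟩
      exact decoration_of_tensor E e x X _
  | @hi X Y f _ ih =>
    constructor
    · intro b b' h
      have h' : pullDecoration E f b = pullDecoration E f b' := by
        refine ih.1 (map_injective_of_isIso (T ⋙ E) f ?_)
        exact (decoration_pull E e f b).trans (h.trans (decoration_pull E e f b').symm)
      funext k
      obtain ⟨i, rfl⟩ := f.bij.2 k
      exact (map_pullDecoration E f b i).symm.trans
        ((congrArg _ (congrFun h' i)).trans (map_pullDecoration E f b' i))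
    · intro t
      obtain ⟨a, ha⟩ := ih.2 ((T ⋙ E).map (inv f) t)
      refine ⟨pullDecoration E (inv f) a, map_injective_of_isIso (T ⋙ E) (inv f) ?_⟩
      rw [← ha]
      exact decoration_pull E e (inv f) a

/-- If `G^⊗` is equivalent to `Iso(M)`, then the free symmetric monoidal category on the decorated
objects of `G` is equivalent to the isomorphisms of decorated objects of `M`. -/
theorem InducesEquivalence.elements (h : InducesEquivalence j) :
    InducesEquivalence (elementsLift j E) := by
  obtain ⟨T, _, ⟨e⟩, hT⟩ := h
  rw [isEquivalence_functorToCore_iff] at hT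
  have hT1 := hT.faithful
  have hT2 := hT.essSurj
  let N := mapFunctor (CategoryOfElements.π (j ⋙ E)) ⋙ T
  let S := liftElements N E (decoration E e) (map_decoration E e)
  refine ⟨S, liftElementsBraided N E _ _ (decoration_unit E e) (decoration_tensor E e),
    ⟨NatIso.ofComponents (fun p => CategoryOfElements.isoMk _ _ (e.app p.1) ?_)
      (fun f => Subtype.ext (e.hom.naturality f.1))⟩, ?_⟩
  · change E.map (e.hom.app p.1) (decoration E e ((of _).obj p)) = p.2
    rw [decoration_of, ← types_comp_apply (E.map _) (E.map _), ← E.map_comp, Iso.inv_hom_id_app,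
      E.map_id]
    rfl
  · rw [isEquivalence_functorToCore_iff]
    refine ⟨⟨fun {X Y f g} hfg => ?_⟩, fun {X Y} i => ?_, ⟨fun Y => ?_⟩⟩
    · exact N.map_injective (congrArg Subtype.val hfg)
    · obtain ⟨f, hf⟩ := hT.exists_map
        (X := (mapFunctor (CategoryOfElements.π (j ⋙ E))).obj X)
        (Y := (mapFunctor (CategoryOfElements.π (j ⋙ E))).obj Y)
        ((CategoryOfElements.π E).mapIso i)
      have hf' : T.map f = i.hom.1 := hf
      have h1 := i.hom.2
      rw [← hf'] at h1
      have h2 := decoration_pull E e f (fun i => (Y.obj i).2)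
      have h3 := map_injective_of_isIso (T ⋙ E) f (h1.trans h2.symm)
      have h4 := (decoration_bijective E e
        ((mapFunctor (CategoryOfElements.π (j ⋙ E))).obj X)).1 (a₁ := fun i => (X.obj i).2)
        (a₂ := pullDecoration E f fun i => (Y.obj i).2) h3
      refine ⟨⟨fun i => ⟨(Hom.map f i).1, (Hom.map f i).2, ?_⟩, f.bij⟩, Subtype.ext hf⟩
      have h5 := map_pullDecoration E f (fun i => (Y.obj i).2) i
      rw [← congrFun h4 i] at h5
      exact h5
    · let X := T.objPreimage Y.1
      let i : T.obj X ≅ Y.1 := T.objObjPreimageIso Y.1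
      obtain ⟨a, ha⟩ := (decoration_bijective E e X).2 (E.map i.inv Y.2)
      refine ⟨decorate E X a, ⟨CategoryOfElements.isoMk _ _ i ?_⟩⟩
      have ha' : decoration E e (decorate E X a) = E.map i.inv Y.2 := ha
      change E.map i.hom (decoration E e (decorate E X a)) = Y.2
      rw [ha', ← types_comp_apply (E.map _) (E.map _), ← E.map_comp, Iso.inv_hom_id, E.map_id]
      rfl

end Decoration

section CommaBraided

open Functor.LaxMonoidal Functor.OplaxMonoidal Functor.Monoidal

variable {F : Type u} [Category.{v} F] [MonoidalCategory F] [SymmetricCategory F]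

/-- The source functor is strict symmetric monoidal. -/
instance commaFstBraided : (Comma.fst (𝟭 F) (𝟭 F)).Braided :=
  letI core : (Comma.fst (𝟭 F) (𝟭 F)).CoreMonoidal :=
    { εIso := Iso.refl (𝟙_ F)
      μIso := fun A B => Iso.refl (A.left ⊗ B.left)
      μIso_hom_natural_left := fun _ _ => (Category.comp_id _).trans (Category.id_comp _).symm
      μIso_hom_natural_right := fun _ _ => (Category.comp_id _).trans (Category.id_comp _).symm
      associativity := fun A B C => by
        change 𝟙 _ ▷ C.left ≫ 𝟙 _ ≫ (α_ A.left B.left C.left).hom =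
          (α_ A.left B.left C.left).hom ≫ A.left ◁ 𝟙 _ ≫ 𝟙 _
        simp
      left_unitality := fun A => by
        change (λ_ A.left).hom = 𝟙 _ ▷ A.left ≫ 𝟙 _ ≫ (λ_ A.left).hom
        simp
      right_unitality := fun A => by
        change (ρ_ A.left).hom = A.left ◁ 𝟙 _ ≫ 𝟙 _ ≫ (ρ_ A.left).hom
        simp }
  { core.toMonoidal with
    braided := fun _ _ => (Category.id_comp _).trans (Category.comp_id _).symm }

/-- The target functor is strict symmetric monoidal. -/
instance commaSndBraided : (Comma.snd (𝟭 F) (𝟭 F)).Braided :=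
  letI core : (Comma.snd (𝟭 F) (𝟭 F)).CoreMonoidal :=
    { εIso := Iso.refl (𝟙_ F)
      μIso := fun A B => Iso.refl (A.right ⊗ B.right)
      μIso_hom_natural_left := fun _ _ => (Category.comp_id _).trans (Category.id_comp _).symm
      μIso_hom_natural_right := fun _ _ => (Category.comp_id _).trans (Category.id_comp _).symm
      associativity := fun A B C => by
        change 𝟙 _ ▷ C.right ≫ 𝟙 _ ≫ (α_ A.right B.right C.right).hom =
          (α_ A.right B.right C.right).hom ≫ A.right ◁ 𝟙 _ ≫ 𝟙 _
        simp
      left_unitality := fun A => by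
        change (λ_ A.right).hom = 𝟙 _ ▷ A.right ≫ 𝟙 _ ≫ (λ_ A.right).hom
        simp
      right_unitality := fun A => by
        change (ρ_ A.right).hom = A.right ◁ 𝟙 _ ≫ 𝟙 _ ≫ (ρ_ A.right).hom
        simp }
  { core.toMonoidal with
    braided := fun _ _ => (Category.id_comp _).trans (Category.comp_id _).symm }

theorem tensorElt_fst (D : F ⥤ Type w) [D.Braided] (A B : Comma (𝟭 F) (𝟭 F))
    (a : D.obj A.left) (b : D.obj B.left) :
    tensorElt (Comma.fst (𝟭 F) (𝟭 F) ⋙ D) (X := A) (Y := B) a b =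
      (tensorElt D a b : D.obj (A.left ⊗ B.left)) := by
  change D.map (𝟙 (A.left ⊗ B.left)) (tensorElt D a b) = _
  rw [D.map_id]; rfl

theorem unitElt_fst (D : F ⥤ Type w) [D.Braided] :
    unitElt (Comma.fst (𝟭 F) (𝟭 F) ⋙ D) = (unitElt D : D.obj (𝟙_ F)) := by
  change D.map (𝟙 (𝟙_ F)) (unitElt D) = _
  rw [D.map_id]; rfl

theorem map_square {A : Type u} [Category.{v} A] (D : A ⥤ Type w) {X Y Y' Z : A} {f : X ⟶ Y}
    {g : Y ⟶ Z} {f' : X ⟶ Y'} {g' : Y' ⟶ Z} (h : f ≫ g = f' ≫ g') (a : D.obj X) :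
    D.map g (D.map f a) = D.map g' (D.map f' a) := by
  have := type_congr (congrArg D.map h) a
  rwa [D.map_comp, D.map_comp] at this

/-- A morphism with a decoration of its source is a morphism of decorated objects. -/
def elementsToComma (D : F ⥤ Type w) : (Comma.fst (𝟭 F) (𝟭 F) ⋙ D).Elements ⥤
    Comma (𝟭 D.Elements) (𝟭 D.Elements) where
  obj p := ⟨⟨p.1.left, p.2⟩, ⟨p.1.right, D.map p.1.hom p.2⟩, ⟨p.1.hom, rfl⟩⟩
  map {p q} f := ⟨⟨f.1.left, f.2⟩, ⟨f.1.right, by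
    have h : D.map f.1.left p.2 = q.2 := f.2
    have h' : f.1.left ≫ q.1.hom = p.1.hom ≫ f.1.right := f.1.w
    change D.map f.1.right (D.map p.1.hom p.2) = D.map q.1.hom q.2
    rw [map_square D h'.symm, h]⟩, Subtype.ext f.1.w⟩

instance (D : F ⥤ Type w) : (elementsToComma D).Faithful where
  map_injective h := Subtype.ext (Comma.hom_ext _ _
    (congrArg (fun x => x.left.1) h) (congrArg (fun x => x.right.1) h))

instance (D : F ⥤ Type w) : (elementsToComma D).Full where
  map_surjective f := ⟨⟨⟨f.left.1, f.right.1, congrArg Subtype.val f.w⟩, f.left.2⟩, rfl⟩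

instance (D : F ⥤ Type w) : (elementsToComma D).EssSurj where
  mem_essImage A := ⟨⟨⟨A.left.1, A.right.1, A.hom.1⟩, A.left.2⟩,
    ⟨Comma.isoMk (Iso.refl _) (CategoryOfElements.isoMk _ _ (Iso.refl A.right.1) (by
      have h : D.map A.hom.1 A.left.2 = A.right.2 := A.hom.2
      change D.map (𝟙 _) (D.map A.hom.1 A.left.2) = A.right.2
      rw [D.map_id, h]; rfl)) (Subtype.ext
        ((Category.id_comp _).trans (Category.comp_id _).symm))⟩⟩

instance (D : F ⥤ Type w) : (elementsToComma D).IsEquivalence where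

instance (D : F ⥤ Type w) [D.Braided] : (elementsToComma D).Braided :=
  letI core : (elementsToComma D).CoreMonoidal :=
    { εIso := Comma.isoMk
        (CategoryOfElements.isoMk _ _ (Iso.refl (𝟙_ F)) (by
          change D.map (𝟙 _) (unitElt D) = unitElt (Comma.fst (𝟭 F) (𝟭 F) ⋙ D)
          rw [unitElt_fst, D.map_id]; rfl))
        (CategoryOfElements.isoMk _ _ (Iso.refl (𝟙_ F)) (by
          change D.map (𝟙 _) (unitElt D) = D.map (𝟙 _) (unitElt (Comma.fst (𝟭 F) (𝟭 F) ⋙ D))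
          rw [unitElt_fst]; rfl))
        (Subtype.ext rfl)
      μIso := fun p q => Comma.isoMk
        (CategoryOfElements.isoMk _ _ (Iso.refl (p.1.left ⊗ q.1.left)) (by
          change D.map (𝟙 _) (tensorElt D p.2 q.2) =
            tensorElt (Comma.fst (𝟭 F) (𝟭 F) ⋙ D) p.2 q.2
          rw [tensorElt_fst, D.map_id]; rfl))
        (CategoryOfElements.isoMk _ _ (Iso.refl (p.1.right ⊗ q.1.right)) (by
          change D.map (𝟙 _) (tensorElt D (D.map p.1.hom p.2) (D.map q.1.hom q.2)) =
            D.map (p.1.hom ⊗ₘ q.1.hom) (tensorElt (Comma.fst (𝟭 F) (𝟭 F) ⋙ D) p.2 q.2)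
          rw [tensorElt_fst, D.map_id, map_tensorElt]; rfl))
        (Subtype.ext ((Category.id_comp _).trans (Category.comp_id _).symm))
      μIso_hom_natural_left := fun _ _ => Comma.hom_ext _ _
        (Subtype.ext ((Category.comp_id _).trans (Category.id_comp _).symm))
        (Subtype.ext ((Category.comp_id _).trans (Category.id_comp _).symm))
      μIso_hom_natural_right := fun _ _ => Comma.hom_ext _ _
        (Subtype.ext ((Category.comp_id _).trans (Category.id_comp _).symm))
        (Subtype.ext ((Category.comp_id _).trans (Category.id_comp _).symm))
      associativity := fun A B C => Comma.hom_ext _ _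
        (Subtype.ext (by
          change 𝟙 _ ▷ C.1.left ≫ 𝟙 _ ≫ (α_ A.1.left B.1.left C.1.left).hom =
            (α_ A.1.left B.1.left C.1.left).hom ≫ A.1.left ◁ 𝟙 _ ≫ 𝟙 _
          simp))
        (Subtype.ext (by
          change 𝟙 _ ▷ C.1.right ≫ 𝟙 _ ≫ (α_ A.1.right B.1.right C.1.right).hom =
            (α_ A.1.right B.1.right C.1.right).hom ≫ A.1.right ◁ 𝟙 _ ≫ 𝟙 _
          simp))
      left_unitality := fun A => Comma.hom_ext _ _
        (Subtype.ext (by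
          change (λ_ A.1.left).hom = 𝟙 _ ▷ A.1.left ≫ 𝟙 _ ≫ (λ_ A.1.left).hom
          simp))
        (Subtype.ext (by
          change (λ_ A.1.right).hom = 𝟙 _ ▷ A.1.right ≫ 𝟙 _ ≫ (λ_ A.1.right).hom
          simp))
      right_unitality := fun A => Comma.hom_ext _ _
        (Subtype.ext (by
          change (ρ_ A.1.left).hom = A.1.left ◁ 𝟙 _ ≫ 𝟙 _ ≫ (ρ_ A.1.left).hom
          simp))
        (Subtype.ext (by
          change (ρ_ A.1.right).hom = A.1.right ◁ 𝟙 _ ≫ 𝟙 _ ≫ (ρ_ A.1.right).hom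
          simp)) }
  { core.toMonoidal with
    braided := fun _ _ => Comma.hom_ext _ _
      (Subtype.ext ((Category.id_comp _).trans (Category.comp_id _).symm))
      (Subtype.ext ((Category.id_comp _).trans (Category.comp_id _).symm)) }

end CommaBraided

namespace FeynmanTriple

variable (𝔉 : FeynmanTriple.{w, u₁, u₂}) (D : 𝔉.F ⥤ Type w) [D.Braided]

/-- The functor that forgets the decorations in `(F_dec ↓ V_dec)`. -/
def undecorate : Comma (𝟭 (𝔉.dec D).F) (𝔉.dec D).ι ⥤ Comma (𝟭 𝔉.F) 𝔉.ι where
  obj A := ⟨A.left.1, A.right.1, A.hom.1⟩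
  map f := ⟨f.left.1, f.right.1, congrArg Subtype.val f.w⟩

/-- The inclusion of vertex morphisms in the category of morphisms. -/
abbrev basicMorphisms : Core (Comma (𝟭 𝔉.F) 𝔉.ι) ⥤ Comma (𝟭 𝔉.F) (𝟭 𝔉.F) :=
  Core.inclusion (Comma (𝟭 𝔉.F) 𝔉.ι) ⋙ 𝔉.commaInclusion

/-- A decorated morphism is a morphism with a decoration of its source. -/
def coreDecorated : Core (Comma (𝟭 (𝔉.dec D).F) (𝔉.dec D).ι) ⥤
    (𝔉.basicMorphisms ⋙ Comma.fst (𝟭 𝔉.F) (𝟭 𝔉.F) ⋙ D).Elements where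
  obj A := ⟨⟨(𝔉.undecorate D).obj A.of⟩, A.of.left.2⟩
  map f := ⟨⟨(𝔉.undecorate D).mapIso f.iso⟩, f.iso.hom.left.2⟩

instance : (𝔉.coreDecorated D).Faithful where
  map_injective h := Core.hom_ext (Comma.hom_ext _ _
    (Subtype.ext (congrArg (fun x => x.1.iso.hom.left) h))
    (Subtype.ext (congrArg (fun x => x.1.iso.hom.right) h)))

instance : (𝔉.coreDecorated D).Full where
  map_surjective {A B} f := by
    let i : (𝔉.undecorate D).obj A.of ≅ (𝔉.undecorate D).obj B.of := f.1.iso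
    have h : D.map i.hom.left A.of.left.2 = B.of.left.2 := f.2
    have hA : D.map A.of.hom.1 A.of.left.2 = A.of.right.2 := A.of.hom.2
    have hB : D.map B.of.hom.1 B.of.left.2 = B.of.right.2 := B.of.hom.2
    have hw : i.hom.left ≫ B.of.hom.1 = A.of.hom.1 ≫ 𝔉.ι.map i.hom.right := i.hom.w
    refine ⟨⟨Comma.isoMk
      (CategoryOfElements.isoMk _ _ ((Comma.fst _ _).mapIso i) h)
      (CategoryOfElements.isoMk _ _ ((Comma.snd _ _).mapIso i) ?_) (Subtype.ext hw)⟩, rfl⟩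
    change D.map (𝔉.ι.map i.hom.right) A.of.right.2 = B.of.right.2
    rw [← hA, ← hB, ← h]
    exact map_square D hw.symm _

instance : (𝔉.coreDecorated D).EssSurj where
  mem_essImage p := ⟨⟨⟨⟨p.1.of.left, p.2⟩, ⟨p.1.of.right, D.map p.1.of.hom p.2⟩,
    ⟨p.1.of.hom, rfl⟩⟩⟩, ⟨Iso.refl _⟩⟩

instance : (𝔉.coreDecorated D).IsEquivalence where

theorem IsFeynmanCategory.dec {𝔉 : FeynmanTriple.{w, u₁, u₂}} (D : 𝔉.F ⥤ Type w) [D.Braided]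
    (h : 𝔉.IsFeynmanCategory) :
    (𝔉.dec D).IsFeynmanCategory where
  iso_condition := h.iso_condition.elements D
  hereditary := by
    refine (h.hereditary.elements (Comma.fst (𝟭 𝔉.F) (𝟭 𝔉.F) ⋙ D)).transport
      (𝔉.coreDecorated D) (elementsToComma D) ?_
    refine NatIso.ofComponents (fun A => Comma.isoMk (Iso.refl _)
      (CategoryOfElements.isoMk _ _ (Iso.refl (𝔉.ι.obj A.of.right.1)) ?_)
      (Subtype.ext ((Category.id_comp _).trans (Category.comp_id _).symm)))
      (fun f => Comma.hom_ext _ _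
        (Subtype.ext ((Category.comp_id _).trans (Category.id_comp _).symm))
        (Subtype.ext ((Category.comp_id _).trans (Category.id_comp _).symm)))
    have hA : D.map A.of.hom.1 A.of.left.2 = A.of.right.2 := A.of.hom.2
    change D.map (𝟙 _) (D.map A.of.hom.1 A.of.left.2) = A.of.right.2
    rw [hA, D.map_id]; rfl
  size x := by
    have hx := h.size x.1
    rw [essentiallySmall_iff]
    refine ⟨?_, inferInstance⟩
    let A := CostructuredArrow (𝟭 𝔉.F) (𝔉.ι.obj x.1)
    let e : A ≌ SmallModel.{w} A := equivSmallModel A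
    let S := { q : Σ s : SmallModel.{w} A, D.obj (e.inverse.obj s).left //
      D.map (e.inverse.obj q.1).hom q.2 = x.2 }
    let p : S → (𝔉.dec D).F := fun q => D.elementsMk (e.inverse.obj q.1.1).left q.1.2
    let f : S → CostructuredArrow (𝟭 (𝔉.dec D).F) ((𝔉.dec D).ι.obj x) := fun q =>
      CostructuredArrow.mk (Y := p q) ⟨(e.inverse.obj q.1.1).hom, q.2⟩
    refine small_of_surjective (f := fun q : S => toSkeleton (f q)) ?_
    intro y
    let B := (fromSkeleton _).obj y
    let B' : A := CostructuredArrow.mk (Y := B.left.1) B.hom.1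
    let i : B' ≅ e.inverse.obj (e.functor.obj B') := e.unitIso.app B'
    have hi : i.hom.left ≫ (e.inverse.obj (e.functor.obj B')).hom = B.hom.1 :=
      CostructuredArrow.w i.hom
    have hB : D.map B.hom.1 B.left.2 = x.2 := B.hom.2
    refine ⟨⟨⟨e.functor.obj B', D.map i.hom.left B.left.2⟩, ?_⟩, ?_⟩
    · exact ((type_congr (congrArg D.map hi.symm) _).trans
        (type_congr (D.map_comp _ _) _)).symm.trans hB
    · refine toSkeleton_eq_iff.2 ⟨?_⟩
      exact (CostructuredArrow.isoMk (CategoryOfElements.isoMk _ _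
        ((CostructuredArrow.proj _ _).mapIso i) rfl) (Subtype.ext hi)).symm

end FeynmanTriple

namespace FreeSymm

open Functor.LaxMonoidal Functor.OplaxMonoidal Functor.Monoidal

variable {V : Type u} [Category.{v} V] {W : Type u₂} [Category.{v₁} W]

theorem exists_split (κ : V ⥤ W) {X : FreeSymm V} {Y₁ Y₂ : FreeSymm W}
    (f : (mapFunctor κ).obj X ⟶ Y₁ ⊗ Y₂) :
    ∃ (X₁ X₂ : FreeSymm V) (d : X₁ ⊗ X₂ ⟶ X) (_ : IsIso d) (f₁ : (mapFunctor κ).obj X₁ ⟶ Y₁)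
      (f₂ : (mapFunctor κ).obj X₂ ⟶ Y₂),
      μ (mapFunctor κ) X₁ X₂ ≫ (mapFunctor κ).map d ≫ f = f₁ ⊗ₘ f₂ := by
  let p : X.idx → Prop := fun i => ∃ k, (Hom.map f i).1 = .inl k
  have h₁ : ∀ i, p i → ∃ q : Σ k : Y₁.idx, κ.obj (X.obj i) ⟶ Y₁.obj k,
      Hom.map f i = ⟨.inl q.1, q.2⟩ := by
    rintro i ⟨k, hk⟩
    rcases hf : Hom.map f i with ⟨l, a⟩
    rw [hf] at hk
    obtain rfl : l = .inl k := hk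
    exact ⟨⟨k, a⟩, rfl⟩
  have h₂ : ∀ i, ¬ p i → ∃ q : Σ k : Y₂.idx, κ.obj (X.obj i) ⟶ Y₂.obj k,
      Hom.map f i = ⟨.inr q.1, q.2⟩ := by
    intro i hi
    rcases hf : Hom.map f i with ⟨l | l, a⟩
    · exact (hi ⟨l, by rw [hf]⟩).elim
    · exact ⟨⟨l, a⟩, rfl⟩
  choose q₁ hq₁ using h₁
  choose q₂ hq₂ using h₂
  let f₁ : (mapFunctor κ).obj (restrict X p) ⟶ Y₁ := ⟨fun i => q₁ i.1 i.2, by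
    constructor
    · intro i k h
      refine Subtype.ext (f.bij.1 ?_)
      change (Hom.map f i.1).1 = (Hom.map f k.1).1
      rw [hq₁ i.1 i.2, hq₁ k.1 k.2]
      exact congrArg Sum.inl h
    · intro k
      obtain ⟨i, hi⟩ := f.bij.2 (.inl k)
      have hp : p i := ⟨k, hi⟩
      refine ⟨⟨i, hp⟩, Sum.inl.inj (Eq.trans ?_ hi)⟩
      exact (congrArg Sigma.fst (hq₁ i hp)).symm⟩
  let f₂ : (mapFunctor κ).obj (restrict X fun i => ¬ p i) ⟶ Y₂ := ⟨fun i => q₂ i.1 i.2, by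
    constructor
    · intro i k h
      refine Subtype.ext (f.bij.1 ?_)
      change (Hom.map f i.1).1 = (Hom.map f k.1).1
      rw [hq₂ i.1 i.2, hq₂ k.1 k.2]
      exact congrArg Sum.inr h
    · intro k
      obtain ⟨i, hi⟩ := f.bij.2 (.inr k)
      have hp : ¬ p i := by
        rintro ⟨l, hl⟩
        exact nomatch hl.symm.trans hi
      refine ⟨⟨i, hp⟩, Sum.inr.inj (Eq.trans ?_ hi)⟩
      exact (congrArg Sigma.fst (hq₂ i hp)).symm⟩
  refine ⟨restrict X p, restrict X (fun i => ¬ p i), glue X p, inferInstance, f₁, f₂, hom_ext ?_⟩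
  have key : ∀ i : X.idx, (⟨(Hom.map f i).1, 𝟙 (κ.obj (X.obj i)) ≫ κ.map (𝟙 (X.obj i)) ≫
      (Hom.map f i).2⟩ : Σ k : (Y₁ ⊗ Y₂).idx, κ.obj (X.obj i) ⟶ (Y₁ ⊗ Y₂).obj k) =
      Hom.map f i := fun i => by
    have h : ∀ {A : V} {B : W} (b : κ.obj A ⟶ B), 𝟙 _ ≫ κ.map (𝟙 A) ≫ b = b := by simp
    exact Sigma.ext rfl (heq_of_eq (h _))
  rintro (i | i)
  · exact (key i.1).trans (hq₁ i.1 i.2)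
  · exact (key i.1).trans (hq₂ i.1 i.2)

theorem exists_eq_tensorHom {X₁ X₂ Y₁ Y₂ : FreeSymm V} (f : X₁ ⊗ X₂ ⟶ Y₁ ⊗ Y₂)
    (h₁ : ∀ i : X₁.idx, ∃ k, (Hom.map f (.inl i)).1 = .inl k)
    (h₂ : ∀ i : X₂.idx, ∃ k, (Hom.map f (.inr i)).1 = .inr k) :
    ∃ (f₁ : X₁ ⟶ Y₁) (f₂ : X₂ ⟶ Y₂), f = f₁ ⊗ₘ f₂ := by
  have h₁' : ∀ i, ∃ q : Σ k : Y₁.idx, X₁.obj i ⟶ Y₁.obj k,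
      Hom.map f (.inl i) = ⟨.inl q.1, q.2⟩ := by
    intro i
    obtain ⟨k, hk⟩ := h₁ i
    rcases hf : Hom.map f (.inl i) with ⟨l, a⟩
    rw [hf] at hk
    obtain rfl : l = .inl k := hk
    exact ⟨⟨k, a⟩, rfl⟩
  have h₂' : ∀ i, ∃ q : Σ k : Y₂.idx, X₂.obj i ⟶ Y₂.obj k,
      Hom.map f (.inr i) = ⟨.inr q.1, q.2⟩ := by
    intro i
    obtain ⟨k, hk⟩ := h₂ i
    rcases hf : Hom.map f (.inr i) with ⟨l, a⟩
    rw [hf] at hk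
    obtain rfl : l = .inr k := hk
    exact ⟨⟨k, a⟩, rfl⟩
  choose q₁ hq₁ using h₁'
  choose q₂ hq₂ using h₂'
  let f₁ : X₁ ⟶ Y₁ := ⟨q₁, by
    constructor
    · intro i k h
      refine Sum.inl.inj (f.bij.1 (a₁ := .inl i) (a₂ := .inl k) ?_)
      change (Hom.map f (.inl i)).1 = (Hom.map f (.inl k)).1
      rw [hq₁ i, hq₁ k]
      exact congrArg Sum.inl h
    · intro k
      obtain ⟨i | i, hi⟩ := f.bij.2 (.inl k)
      · exact ⟨i, Sum.inl.inj ((congrArg Sigma.fst (hq₁ i)).symm.trans hi)⟩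
      · exact nomatch (congrArg Sigma.fst (hq₂ i)).symm.trans hi⟩
  let f₂ : X₂ ⟶ Y₂ := ⟨q₂, by
    constructor
    · intro i k h
      refine Sum.inr.inj (f.bij.1 (a₁ := .inr i) (a₂ := .inr k) ?_)
      change (Hom.map f (.inr i)).1 = (Hom.map f (.inr k)).1
      rw [hq₂ i, hq₂ k]
      exact congrArg Sum.inr h
    · intro k
      obtain ⟨i | i, hi⟩ := f.bij.2 (.inr k)
      · exact nomatch (congrArg Sigma.fst (hq₁ i)).symm.trans hi
      · exact ⟨i, Sum.inr.inj ((congrArg Sigma.fst (hq₂ i)).symm.trans hi)⟩⟩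
  refine ⟨f₁, f₂, hom_ext ?_⟩
  rintro (i | i)
  · exact hq₁ i
  · exact hq₂ i

theorem exists_eq_tensorHom_of_map (κ : V ⥤ W) {X₁ X₂ Y₁ Y₂ : FreeSymm V}
    (f : X₁ ⊗ X₂ ⟶ Y₁ ⊗ Y₂) (g₁ : (mapFunctor κ).obj X₁ ⟶ (mapFunctor κ).obj Y₁)
    (g₂ : (mapFunctor κ).obj X₂ ⟶ (mapFunctor κ).obj Y₂)
    (h : μ (mapFunctor κ) X₁ X₂ ≫ (mapFunctor κ).map f = (g₁ ⊗ₘ g₂) ≫ μ (mapFunctor κ) Y₁ Y₂) :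
    ∃ (f₁ : X₁ ⟶ Y₁) (f₂ : X₂ ⟶ Y₂), f = f₁ ⊗ₘ f₂ ∧ (mapFunctor κ).map f₁ = g₁ ∧
      (mapFunctor κ).map f₂ = g₂ := by
  obtain ⟨f₁, f₂, rfl⟩ := exists_eq_tensorHom f
    (fun i => ⟨_, congrArg Sigma.fst (map_eq_of_hom_eq h (.inl i))⟩)
    (fun i => ⟨_, congrArg Sigma.fst (map_eq_of_hom_eq h (.inr i))⟩)
  rw [← Functor.LaxMonoidal.μ_natural, cancel_mono] at h
  exact ⟨f₁, f₂, rfl, tensorHom_injective h⟩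

end FreeSymm

section Decompose

open Functor.LaxMonoidal Functor.OplaxMonoidal Functor.Monoidal FreeSymm

theorem IsCoreEquivalence.exists_lift {G : Type u₁} [Category.{v₁} G] {M : Type u₂}
    [Category.{v₂} M] {T : G ⥤ M} (h : IsCoreEquivalence T) {x y : G} (s : T.obj x ⟶ T.obj y)
    [IsIso s] : ∃ f : x ⟶ y, T.map f = s :=
  h.exists_map (asIso s)

theorem IsCoreEquivalence.exists_iso {G : Type u₁} [Category.{v₁} G] {M : Type u₂}
    [Category.{v₂} M] {T : G ⥤ M} (h : IsCoreEquivalence T) (m : M) :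
    ∃ x, Nonempty (T.obj x ≅ m) :=
  h.essSurj.mem_essImage m

/-- Isomorphisms to the unit are unique if the isomorphisms form a free symmetric monoidal
category. -/
theorem InducesEquivalence.to_unit_unique {G : Type u₁} [Groupoid.{v₁} G] {M : Type u₂}
    [Category.{v₂} M] [MonoidalCategory M] [SymmetricCategory M] {j : G ⥤ M}
    (h : InducesEquivalence j) {A : M} (s t : A ⟶ 𝟙_ M) [IsIso s] [IsIso t] : s = t := by
  obtain ⟨T, _, -, hT⟩ := h
  rw [isEquivalence_functorToCore_iff] at hT
  obtain ⟨x, ⟨a⟩⟩ := hT.exists_iso A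
  obtain ⟨σ, hσ⟩ := hT.exists_lift (a.hom ≫ s ≫ ε T)
  obtain ⟨τ, hτ⟩ := hT.exists_lift (a.hom ≫ t ≫ ε T)
  obtain rfl : σ = τ := to_unit_hom_ext _ _
  rw [← cancel_mono (ε T)]
  simpa using hσ.symm.trans hτ

/-- A symmetric monoidal functor `R` along which decompositions into tensor products lift
uniquely. -/
structure LiftsDecompositions {M : Type u₁} [Category.{v₁} M] [MonoidalCategory M]
    {N : Type u₂} [Category.{v₂} N] [MonoidalCategory N] (R : M ⥤ N) [R.Monoidal] : Prop where
  /-- decompositions of objects lift -/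
  exists_decomposition (m : M) {Y₁ Y₂ : N} (e : R.obj m ⟶ Y₁ ⊗ Y₂) [IsIso e] :
    ∃ (m₁ m₂ : M) (d : m₁ ⊗ m₂ ⟶ m) (_ : IsIso d) (r₁ : R.obj m₁ ⟶ Y₁) (_ : IsIso r₁)
      (r₂ : R.obj m₂ ⟶ Y₂) (_ : IsIso r₂), μ R m₁ m₂ ≫ R.map d ≫ e = r₁ ⊗ₘ r₂
  /-- decompositions of isomorphisms lift -/
  exists_decomposition_iso {m₁ m₂ n₁ n₂ : M} (g : m₁ ⊗ m₂ ⟶ n₁ ⊗ n₂) [IsIso g]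
    (p₁ : R.obj m₁ ⟶ R.obj n₁) [IsIso p₁] (p₂ : R.obj m₂ ⟶ R.obj n₂) [IsIso p₂]
    (h : μ R m₁ m₂ ≫ R.map g = (p₁ ⊗ₘ p₂) ≫ μ R n₁ n₂) :
    ∃ (g₁ : m₁ ⟶ n₁) (g₂ : m₂ ⟶ n₂), IsIso g₁ ∧ IsIso g₂ ∧ g = g₁ ⊗ₘ g₂ ∧
      R.map g₁ = p₁ ∧ R.map g₂ = p₂
  /-- the unit lifts -/
  exists_iso_unit (m : M) (e : R.obj m ⟶ 𝟙_ N) [IsIso e] : Nonempty (m ≅ 𝟙_ M)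

theorem InducesEquivalence.liftsDecompositions {G : Type u₁} [Groupoid.{v₁} G] {M : Type u₂}
    [Category.{v₂} M] [MonoidalCategory M] [SymmetricCategory M] {j : G ⥤ M}
    (h : InducesEquivalence j) {H : Type u₃} [Groupoid.{v₃} H] {N : Type u₄}
    [Category.{v} N] [MonoidalCategory N] [SymmetricCategory N] {j' : H ⥤ N}
    (h' : InducesEquivalence j') (κ : G ⥤ H) (R : M ⥤ N) [R.Braided] (i : j ⋙ R ≅ κ ⋙ j') :
    LiftsDecompositions R := by
  obtain ⟨T, _, ⟨e⟩, hT⟩ := h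
  obtain ⟨T', _, ⟨e'⟩, hT'⟩ := h'
  rw [isEquivalence_functorToCore_iff] at hT hT'
  let K := mapFunctor κ ⋙ T'
  let ω : T ⋙ R ≅ K := extendIso ((Functor.isoWhiskerRight e R) ≪≫ i ≪≫
    Functor.isoWhiskerLeft κ e'.symm ≪≫ Functor.isoWhiskerRight (ofCompMapFunctor κ).symm T')
  have hω : NatTrans.IsMonoidal ω.hom :=
    inferInstanceAs (NatTrans.IsMonoidal (extendIso _).hom)
  have hμ : ∀ x y, μ R _ _ ≫ R.map (μ T x y) ≫ ω.hom.app (x ⊗ y) =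
      (ω.hom.app x ⊗ₘ ω.hom.app y) ≫ μ T' _ _ ≫ T'.map (μ (mapFunctor κ) x y) := by
    intro x y
    have := NatTrans.IsMonoidal.tensor (τ := ω.hom) x y
    rw [Functor.LaxMonoidal.comp_μ, Functor.LaxMonoidal.comp_μ, Category.assoc] at this
    exact this
  have hn : ∀ {x y : FreeSymm G} (f : x ⟶ y), R.map (T.map f) ≫ ω.hom.app y =
      ω.hom.app x ≫ T'.map ((mapFunctor κ).map f) := fun f => ω.hom.naturality f
  have hf := hT.faithful
  have hf' := hT'.faithful
  refine ⟨fun m Y₁ Y₂ s _ => ?_, fun {m₁ m₂ n₁ n₂} g _ p₁ _ p₂ _ hg => ?_, fun m s _ => ?_⟩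
  · obtain ⟨x, ⟨a⟩⟩ := hT.exists_iso m
    obtain ⟨y₁, ⟨b₁⟩⟩ := hT'.exists_iso Y₁
    obtain ⟨y₂, ⟨b₂⟩⟩ := hT'.exists_iso Y₂
    obtain ⟨γ, hγ⟩ := hT'.exists_lift (x := (mapFunctor κ).obj x) (y := y₁ ⊗ y₂)
      (ω.inv.app x ≫ R.map a.hom ≫ s ≫ (b₁.inv ⊗ₘ b₂.inv) ≫ μ T' _ _)
    obtain ⟨x₁, x₂, d, _, γ₁, γ₂, hd⟩ := exists_split κ γ
    refine ⟨T.obj x₁, T.obj x₂, μ T _ _ ≫ T.map d ≫ a.hom, inferInstance,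
      ω.hom.app x₁ ≫ T'.map γ₁ ≫ b₁.hom, inferInstance,
      ω.hom.app x₂ ≫ T'.map γ₂ ≫ b₂.hom, inferInstance, ?_⟩
    have h1 : R.map a.hom ≫ s = ω.hom.app x ≫ T'.map γ ≫ δ T' _ _ ≫ (b₁.hom ⊗ₘ b₂.hom) := by
      rw [hγ]
      simp [tensorHom_comp_tensorHom]
    rw [R.map_comp, R.map_comp, Category.assoc, Category.assoc, h1, reassoc_of% (hn d),
      reassoc_of% (hμ x₁ x₂), ← T'.map_comp_assoc, ← T'.map_comp_assoc, Category.assoc, hd,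
      ← Functor.LaxMonoidal.μ_natural_assoc, μ_δ_assoc, tensorHom_comp_tensorHom,
      tensorHom_comp_tensorHom]
  · obtain ⟨x₁, ⟨a₁⟩⟩ := hT.exists_iso m₁
    obtain ⟨x₂, ⟨a₂⟩⟩ := hT.exists_iso m₂
    obtain ⟨y₁, ⟨b₁⟩⟩ := hT.exists_iso n₁
    obtain ⟨y₂, ⟨b₂⟩⟩ := hT.exists_iso n₂
    obtain ⟨Γ, hΓ⟩ := hT.exists_lift (x := x₁ ⊗ x₂) (y := y₁ ⊗ y₂)
      (δ T _ _ ≫ (a₁.hom ⊗ₘ a₂.hom) ≫ g ≫ (b₁.inv ⊗ₘ b₂.inv) ≫ μ T _ _)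
    obtain ⟨π₁, hπ₁⟩ := hT'.exists_lift (x := (mapFunctor κ).obj x₁) (y := (mapFunctor κ).obj y₁)
      (ω.inv.app x₁ ≫ R.map a₁.hom ≫ p₁ ≫ R.map b₁.inv ≫ ω.hom.app y₁)
    obtain ⟨π₂, hπ₂⟩ := hT'.exists_lift (x := (mapFunctor κ).obj x₂) (y := (mapFunctor κ).obj y₂)
      (ω.inv.app x₂ ≫ R.map a₂.hom ≫ p₂ ≫ R.map b₂.inv ≫ ω.hom.app y₂)
    have hπ₁' : ω.hom.app x₁ ≫ T'.map π₁ =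
        R.map a₁.hom ≫ p₁ ≫ R.map b₁.inv ≫ ω.hom.app y₁ := by rw [hπ₁]; simp
    have hπ₂' : ω.hom.app x₂ ≫ T'.map π₂ =
        R.map a₂.hom ≫ p₂ ≫ R.map b₂.inv ≫ ω.hom.app y₂ := by rw [hπ₂]; simp
    have hΓ' : μ T _ _ ≫ T.map Γ =
        (a₁.hom ⊗ₘ a₂.hom) ≫ g ≫ (b₁.inv ⊗ₘ b₂.inv) ≫ μ T _ _ := by rw [hΓ]; simp
    have key : μ (mapFunctor κ) x₁ x₂ ≫ (mapFunctor κ).map Γ =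
        (π₁ ⊗ₘ π₂) ≫ μ (mapFunctor κ) y₁ y₂ := by
      apply T'.map_injective
      rw [← cancel_epi (μ T' _ _), ← cancel_epi (ω.hom.app x₁ ⊗ₘ ω.hom.app x₂), T'.map_comp,
        T'.map_comp, ← reassoc_of% (hμ x₁ x₂), ← hn, ← R.map_comp_assoc, hΓ',
        ← Functor.LaxMonoidal.μ_natural_assoc, tensorHom_comp_tensorHom_assoc, hπ₁', hπ₂']
      simp only [R.map_comp, Category.assoc]
      rw [← Functor.LaxMonoidal.μ_natural_assoc, reassoc_of% hg,
        ← Functor.LaxMonoidal.μ_natural_assoc, hμ]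
      simp only [tensorHom_comp_tensorHom_assoc]
    obtain ⟨Γ₁, Γ₂, rfl, h1, h2⟩ := exists_eq_tensorHom_of_map κ Γ π₁ π₂ key
    refine ⟨a₁.inv ≫ T.map Γ₁ ≫ b₁.hom, a₂.inv ≫ T.map Γ₂ ≫ b₂.hom, inferInstance,
      inferInstance, ?_, ?_, ?_⟩
    · rw [← Functor.LaxMonoidal.μ_natural] at hΓ'
      rw [← tensorHom_comp_tensorHom, ← tensorHom_comp_tensorHom]
      rw [← cancel_mono ((b₁.inv ⊗ₘ b₂.inv) ≫ μ T _ _), ← cancel_epi (a₁.hom ⊗ₘ a₂.hom), ← hΓ']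
      simp [tensorHom_comp_tensorHom_assoc]
    · have := hn Γ₁
      rw [h1, hπ₁'] at this
      have h3 : R.map (T.map Γ₁) = R.map a₁.hom ≫ p₁ ≫ R.map b₁.inv := by
        rw [← cancel_mono (ω.hom.app y₁), this]
        simp only [Category.assoc]
      rw [R.map_comp, R.map_comp, h3]
      simp
    · have := hn Γ₂
      rw [h2, hπ₂'] at this
      have h3 : R.map (T.map Γ₂) = R.map a₂.hom ≫ p₂ ≫ R.map b₂.inv := by
        rw [← cancel_mono (ω.hom.app y₂), this]
        simp only [Category.assoc]
      rw [R.map_comp, R.map_comp, h3]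
      simp
  · obtain ⟨x, ⟨a⟩⟩ := hT.exists_iso m
    obtain ⟨γ, -⟩ := hT'.exists_lift (x := (mapFunctor κ).obj x) (y := 𝟙_ _)
      (ω.inv.app x ≫ R.map a.hom ≫ s ≫ ε T')
    have : IsEmpty x.idx := ⟨fun i => (Hom.map γ i).1.elim⟩
    exact ⟨a.symm ≪≫ T.mapIso (asIso (unitTo x)).symm ≪≫ (εIso T).symm⟩

end Decompose

section TensorArrows

open Functor.LaxMonoidal Functor.OplaxMonoidal Functor.Monoidal

theorem comma_isIso {F : Type u₁} [Category.{v₁} F] {A B : Comma (𝟭 F) (𝟭 F)} (g : A ⟶ B)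
    [IsIso g.left] [IsIso g.right] : IsIso g :=
  (Comma.isoMk (asIso g.left) (asIso g.right) g.w).isIso_hom

variable {F : Type u₁} [Category.{v₁} F] [MonoidalCategory F] [SymmetricCategory F]
  {F' : Type u₂} [Category.{v₂} F'] [MonoidalCategory F'] [SymmetricCategory F']

/-- A full and essentially surjective functor is final. -/
theorem final_of_full_of_essSurj {A : Type u₁} [Category.{v₁} A] {B : Type u₂} [Category.{v₂} B]
    (S : A ⥤ B) [S.Full] [S.EssSurj] : S.Final where
  out b := by
    let a₀ : StructuredArrow b S := StructuredArrow.mk (S.objObjPreimageIso b).inv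
    have : Nonempty (StructuredArrow b S) := ⟨a₀⟩
    have h : ∀ a : StructuredArrow b S, Nonempty (a₀ ⟶ a) := fun a =>
      ⟨StructuredArrow.homMk (S.preimage ((S.objObjPreimageIso b).hom ≫ a.hom)) (by simp [a₀])⟩
    exact zigzag_isConnected fun a c => ((Zigzag.of_hom (h a).some).symm).trans
      (Zigzag.of_hom (h c).some)

/-- The tensor product `(f ↓ X) × (f ↓ Y) ⥤ (f ↓ X ⊗ Y)`. -/
def tensorArrows (f : F ⥤ F') [f.Monoidal] (X Y : F') :
    CostructuredArrow f X × CostructuredArrow f Y ⥤ CostructuredArrow f (X ⊗ Y) where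
  obj p := CostructuredArrow.mk (Y := p.1.left ⊗ p.2.left) (δ f _ _ ≫ (p.1.hom ⊗ₘ p.2.hom))
  map {p q} g := CostructuredArrow.homMk (g.1.left ⊗ₘ g.2.left) (by
    simp [← Functor.OplaxMonoidal.δ_natural_assoc, tensorHom_comp_tensorHom])

/-- Hereditary decomposition: a morphism to a tensor product is a tensor product of morphisms. -/
theorem exists_eq_comp_tensorHom (hF : LiftsDecompositions (Comma.snd (𝟭 F) (𝟭 F)))
    {X Y₁ Y₂ : F} (φ : X ⟶ Y₁ ⊗ Y₂) :
    ∃ (X₁ X₂ : F) (g : X ⟶ X₁ ⊗ X₂) (_ : IsIso g) (φ₁ : X₁ ⟶ Y₁) (φ₂ : X₂ ⟶ Y₂),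
      φ = g ≫ (φ₁ ⊗ₘ φ₂) := by
  let m : Comma (𝟭 F) (𝟭 F) := ⟨X, Y₁ ⊗ Y₂, φ⟩
  let e : (Comma.snd (𝟭 F) (𝟭 F)).obj m ⟶ Y₁ ⊗ Y₂ := 𝟙 (Y₁ ⊗ Y₂)
  have : IsIso e := inferInstanceAs (IsIso (𝟙 (Y₁ ⊗ Y₂)))
  obtain ⟨m₁, m₂, d, _, r₁, _, r₂, _, h⟩ := hF.exists_decomposition m e
  have hr : d.right = r₁ ⊗ₘ r₂ := by
    rw [← h]
    exact ((Category.id_comp _).trans (Category.comp_id _)).symm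
  have hw : d.left ≫ φ = (m₁.hom ⊗ₘ m₂.hom) ≫ d.right := d.w
  refine ⟨m₁.left, m₂.left, inv d.left, inferInstance, m₁.hom ≫ r₁, m₂.hom ≫ r₂, ?_⟩
  rw [IsIso.eq_inv_comp, hw, hr]
  exact tensorHom_comp_tensorHom _ _ _ _

theorem exists_eq_tensorHom_of_comp_tensorHom
    (hF : LiftsDecompositions (Comma.snd (𝟭 F) (𝟭 F)))
    {X₁ X₂ Z₁ Z₂ Y₁ Y₂ : F} (g : X₁ ⊗ X₂ ⟶ Z₁ ⊗ Z₂)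
    [IsIso g] (φ₁ : X₁ ⟶ Y₁) (φ₂ : X₂ ⟶ Y₂) (ψ₁ : Z₁ ⟶ Y₁) (ψ₂ : Z₂ ⟶ Y₂)
    (h : g ≫ (ψ₁ ⊗ₘ ψ₂) = φ₁ ⊗ₘ φ₂) :
    ∃ (g₁ : X₁ ⟶ Z₁) (g₂ : X₂ ⟶ Z₂), IsIso g₁ ∧ IsIso g₂ ∧ g = g₁ ⊗ₘ g₂ ∧ g₁ ≫ ψ₁ = φ₁ ∧
      g₂ ≫ ψ₂ = φ₂ := by
  let a₁ : Comma (𝟭 F) (𝟭 F) := ⟨X₁, Y₁, φ₁⟩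
  let a₂ : Comma (𝟭 F) (𝟭 F) := ⟨X₂, Y₂, φ₂⟩
  let b₁ : Comma (𝟭 F) (𝟭 F) := ⟨Z₁, Y₁, ψ₁⟩
  let b₂ : Comma (𝟭 F) (𝟭 F) := ⟨Z₂, Y₂, ψ₂⟩
  let G : a₁ ⊗ a₂ ⟶ b₁ ⊗ b₂ := ⟨g, 𝟙 (Y₁ ⊗ Y₂), h.trans (Category.comp_id _).symm⟩
  have : IsIso G.left := inferInstanceAs (IsIso g)
  have : IsIso G.right := inferInstanceAs (IsIso (𝟙 (Y₁ ⊗ Y₂)))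
  have := comma_isIso G
  let e₁ : (Comma.snd (𝟭 F) (𝟭 F)).obj a₁ ⟶ (Comma.snd (𝟭 F) (𝟭 F)).obj b₁ := 𝟙 Y₁
  let e₂ : (Comma.snd (𝟭 F) (𝟭 F)).obj a₂ ⟶ (Comma.snd (𝟭 F) (𝟭 F)).obj b₂ := 𝟙 Y₂
  have : IsIso e₁ := inferInstanceAs (IsIso (𝟙 Y₁))
  have : IsIso e₂ := inferInstanceAs (IsIso (𝟙 Y₂))
  obtain ⟨G₁, G₂, _, _, hG, h₁, h₂⟩ := hF.exists_decomposition_iso G e₁ e₂ (by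
      change 𝟙 (Y₁ ⊗ Y₂) ≫ 𝟙 (Y₁ ⊗ Y₂) = (𝟙 Y₁ ⊗ₘ 𝟙 Y₂) ≫ 𝟙 (Y₁ ⊗ Y₂)
      simp)
  have h₁' : G₁.right = 𝟙 Y₁ := h₁
  have h₂' : G₂.right = 𝟙 Y₂ := h₂
  have w₁ : G₁.left ≫ ψ₁ = φ₁ ≫ G₁.right := G₁.w
  have w₂ : G₂.left ≫ ψ₂ = φ₂ ≫ G₂.right := G₂.w
  refine ⟨G₁.left, G₂.left, inferInstance, inferInstance, congrArg (fun x => x.left) hG, ?_, ?_⟩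
  · rw [w₁, h₁', Category.comp_id]
  · rw [w₂, h₂', Category.comp_id]

theorem isIso_to_unit (hF : LiftsDecompositions (Comma.snd (𝟭 F) (𝟭 F)))
    {X : F} (φ : X ⟶ 𝟙_ F) : IsIso φ := by
  let m : Comma (𝟭 F) (𝟭 F) := ⟨X, 𝟙_ F, φ⟩
  let e : (Comma.snd (𝟭 F) (𝟭 F)).obj m ⟶ 𝟙_ F := 𝟙 (𝟙_ F)
  have : IsIso e := inferInstanceAs (IsIso (𝟙 (𝟙_ F)))
  obtain ⟨i⟩ := hF.exists_iso_unit m e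
  have h : i.hom.left = φ ≫ i.hom.right :=
    (Category.comp_id (i.hom.left : X ⟶ 𝟙_ F)).symm.trans i.hom.w
  rw [← IsIso.comp_inv_eq] at h
  rw [← h]
  infer_instance

theorem tensorArrows_essSurj {F : Type u₁} [Category.{v₁} F] [MonoidalCategory F]
    {f : F ⥤ F'} [f.Monoidal]
    (hF' : LiftsDecompositions (Comma.snd (𝟭 F') (𝟭 F'))) (hf : LiftsDecompositions f)
    (X Y : F') : (tensorArrows f X Y).EssSurj where
  mem_essImage A := by
    obtain ⟨Z₁, Z₂, g, _, φ₁, φ₂, h⟩ := exists_eq_comp_tensorHom hF' A.hom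
    obtain ⟨x₁, x₂, c, _, l₁, _, l₂, _, hc⟩ := hf.exists_decomposition A.left g
    let i : x₁ ⊗ x₂ ≅ A.left := asIso c
    refine ⟨(CostructuredArrow.mk (l₁ ≫ φ₁), CostructuredArrow.mk (l₂ ≫ φ₂)),
      ⟨CostructuredArrow.isoMk i ?_⟩⟩
    change f.map c ≫ A.hom = δ f _ _ ≫ ((l₁ ≫ φ₁) ⊗ₘ (l₂ ≫ φ₂))
    rw [h, ← tensorHom_comp_tensorHom, ← hc]
    simp

variable {f : F ⥤ F'} [f.Monoidal]

theorem tensorArrows_full (hF : LiftsDecompositions (Comma.snd (𝟭 F) (𝟭 F)))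
    (hF' : LiftsDecompositions (Comma.snd (𝟭 F') (𝟭 F')))
    (hf : LiftsDecompositions f) (X Y : F') : (tensorArrows f X Y).Full where
  map_surjective {A B} k := by
    let l : A.1.left ⊗ A.2.left ⟶ B.1.left ⊗ B.2.left := k.left
    have hw : f.map l ≫ δ f _ _ ≫ (B.1.hom ⊗ₘ B.2.hom) =
      δ f _ _ ≫ (A.1.hom ⊗ₘ A.2.hom) := CostructuredArrow.w k
    obtain ⟨Z₁, Z₂, g, _, φ₁, φ₂, h⟩ := exists_eq_comp_tensorHom hF l
    obtain ⟨p₁, p₂, _, _, hp, h₁, h₂⟩ := exists_eq_tensorHom_of_comp_tensorHom hF'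
      (μ f _ _ ≫ f.map g ≫ δ f _ _) A.1.hom A.2.hom (f.map φ₁ ≫ B.1.hom) (f.map φ₂ ≫ B.2.hom) (by
        rw [h] at hw
        rw [← tensorHom_comp_tensorHom, ← cancel_epi (δ f _ _), ← hw, f.map_comp]
        simp [← Functor.OplaxMonoidal.δ_natural_assoc])
    obtain ⟨g₁, g₂, _, _, hg, hg₁, hg₂⟩ := hf.exists_decomposition_iso g p₁ p₂ (by
      rw [← hp]; simp)
    refine ⟨(CostructuredArrow.homMk (g₁ ≫ φ₁) ?_, CostructuredArrow.homMk (g₂ ≫ φ₂) ?_), ?_⟩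
    · rw [f.map_comp, hg₁, Category.assoc]; exact h₁
    · rw [f.map_comp, hg₂, Category.assoc]; exact h₂
    · ext
      change (g₁ ≫ φ₁) ⊗ₘ (g₂ ≫ φ₂) = l
      rw [h, hg, tensorHom_comp_tensorHom]

theorem tensorArrows_final (hF : LiftsDecompositions (Comma.snd (𝟭 F) (𝟭 F)))
    (hF' : LiftsDecompositions (Comma.snd (𝟭 F') (𝟭 F')))
    (hf : LiftsDecompositions f) (X Y : F') : (tensorArrows f X Y).Final := by
  have := tensorArrows_essSurj hF' hf X Y
  have := tensorArrows_full hF hF' hf X Y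
  exact final_of_full_of_essSurj _

/-- The unit is a terminal object of `(f ↓ 𝟙)`. -/
theorem nonempty_isTerminal_unit (hF : LiftsDecompositions (Comma.snd (𝟭 F) (𝟭 F)))
    (hF' : LiftsDecompositions (Comma.snd (𝟭 F') (𝟭 F'))) (hf : LiftsDecompositions f)
    (h1 : ∀ {A : F} (s t : A ⟶ 𝟙_ F) [IsIso s] [IsIso t], s = t)
    (h1' : ∀ {A : F'} (s t : A ⟶ 𝟙_ F') [IsIso s] [IsIso t], s = t) :
    Nonempty (IsTerminal (CostructuredArrow.mk (η f))) := by
  have key : ∀ A : CostructuredArrow f (𝟙_ F'),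
      Nonempty (Unique (A ⟶ CostructuredArrow.mk (η f))) := by
    intro A
    have := isIso_to_unit hF' A.hom
    obtain ⟨i⟩ := hf.exists_iso_unit A.left A.hom
    have : IsIso (f.map i.hom ≫ (CostructuredArrow.mk (η f)).hom) :=
      inferInstanceAs (IsIso (f.map i.hom ≫ η f))
    refine ⟨⟨⟨CostructuredArrow.homMk i.hom (h1' _ _)⟩, fun g => ?_⟩⟩
    ext
    exact @h1 A.left g.left i.hom (isIso_to_unit hF _) inferInstance
  let _ : ∀ A : CostructuredArrow f (𝟙_ F'), Unique (A ⟶ CostructuredArrow.mk (η f)) :=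
    fun A => (key A).some
  exact ⟨IsTerminal.ofUnique _⟩

end TensorArrows

section KanExtension

open Functor.LaxMonoidal Functor.OplaxMonoidal Functor.Monoidal

variable {F : Type u₁} [Category.{v₁} F] {F' : Type u₂} [Category.{v₂} F'] {C : Type u}
  [Category.{v} C] (f : F ⥤ F') (O : F ⥤ C)
  [∀ X' : F', HasColimitsOfShape (CostructuredArrow f X') C]

/-- The colimit map `O X ⟶ colim_{(f ↓ X')} O` belonging to `φ : f X ⟶ X'`. -/
noncomputable def kanMap {X : F} {X' : F'} (φ : f.obj X ⟶ X') :
    O.obj X ⟶ (f.pointwiseLeftKanExtension O).obj X' :=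
  colimit.ι (CostructuredArrow.proj f X' ⋙ O) (CostructuredArrow.mk φ)

variable {f O}

theorem kanMap_map {X : F} {X' Y' : F'} (φ : f.obj X ⟶ X') (g : X' ⟶ Y') :
    kanMap f O φ ≫ (f.pointwiseLeftKanExtension O).map g = kanMap f O (φ ≫ g) :=
  colimit.ι_desc _ _

theorem map_kanMap {X Y : F} {X' : F'} (h : X ⟶ Y) (φ : f.obj Y ⟶ X') :
    O.map h ≫ kanMap f O φ = kanMap f O (f.map h ≫ φ) :=
  colimit.w (CostructuredArrow.proj f X' ⋙ O)
    (CostructuredArrow.homMk h : CostructuredArrow.mk (f.map h ≫ φ) ⟶ CostructuredArrow.mk φ)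

theorem kanMap_eq_unit {X : F} {X' : F'} (φ : f.obj X ⟶ X') :
    kanMap f O φ = (f.pointwiseLeftKanExtensionUnit O).app X ≫
      (f.pointwiseLeftKanExtension O).map φ :=
  ((kanMap_map (𝟙 _) φ).trans (by rw [Category.id_comp])).symm

theorem kan_hom_ext {X' : F'} {Z : C} {a b : (f.pointwiseLeftKanExtension O).obj X' ⟶ Z}
    (h : ∀ (X : F) (φ : f.obj X ⟶ X'), kanMap f O φ ≫ a = kanMap f O φ ≫ b) : a = b :=
  colimit.hom_ext fun A => h A.left A.hom

variable {P : F ⥤ C} (σ : O ⟶ P)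

/-- The transformation of the colimits over `(f ↓ X')` induced by a natural transformation. -/
noncomputable def kanDescApp (X' : F') :
    (f.pointwiseLeftKanExtension O).obj X' ⟶ (f.pointwiseLeftKanExtension P).obj X' :=
  colimMap (Functor.whiskerLeft (CostructuredArrow.proj f X') σ)

theorem kanMap_kanDescApp {X : F} {X' : F'} (φ : f.obj X ⟶ X') :
    kanMap f O φ ≫ kanDescApp σ X' = σ.app X ≫ kanMap f P φ :=
  ι_colimMap (Functor.whiskerLeft (CostructuredArrow.proj f X') σ) (CostructuredArrow.mk φ)

/-- A natural transformation induces a natural transformation of left Kan extensions. -/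
noncomputable def kanDesc : f.pointwiseLeftKanExtension O ⟶ f.pointwiseLeftKanExtension P where
  app X' := kanDescApp σ X'
  naturality X' Y' g := kan_hom_ext fun X φ => by
    rw [← Category.assoc, kanMap_map, kanMap_kanDescApp, reassoc_of% (kanMap_kanDescApp σ φ),
      kanMap_map]

theorem kanMap_kanDesc {X : F} {X' : F'} (φ : f.obj X ⟶ X') :
    kanMap f O φ ≫ (kanDesc σ).app X' = σ.app X ≫ kanMap f P φ :=
  kanMap_kanDescApp σ φ

variable [MonoidalCategory C]
  [∀ (c : C) (X' : F'), PreservesColimitsOfShape (CostructuredArrow f X') (tensorLeft c)]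

theorem kan_hom_ext_left {X' : F'} {c Z : C} {a b : c ⊗ (f.pointwiseLeftKanExtension O).obj X' ⟶ Z}
    (h : ∀ (X : F) (φ : f.obj X ⟶ X'), c ◁ kanMap f O φ ≫ a = c ◁ kanMap f O φ ≫ b) : a = b :=
  (isColimitOfPreserves (tensorLeft c) (colimit.isColimit _)).hom_ext fun A => h A.left A.hom

variable [SymmetricCategory C]

theorem kan_hom_ext_right {X' : F'} {c Z : C}
    {a b : (f.pointwiseLeftKanExtension O).obj X' ⊗ c ⟶ Z}
    (h : ∀ (X : F) (φ : f.obj X ⟶ X'), kanMap f O φ ▷ c ≫ a = kanMap f O φ ▷ c ≫ b) : a = b := by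
  rw [← cancel_epi (β_ _ _).hom]
  refine kan_hom_ext_left fun X φ => ?_
  rw [BraidedCategory.braiding_naturality_right_assoc,
    BraidedCategory.braiding_naturality_right_assoc, h]

theorem kan_hom_ext₂ {X' Y' : F'} {Z : C}
    {a b : (f.pointwiseLeftKanExtension O).obj X' ⊗ (f.pointwiseLeftKanExtension O).obj Y' ⟶ Z}
    (h : ∀ (X Y : F) (φ : f.obj X ⟶ X') (ψ : f.obj Y ⟶ Y'),
      (kanMap f O φ ⊗ₘ kanMap f O ψ) ≫ a = (kanMap f O φ ⊗ₘ kanMap f O ψ) ≫ b) : a = b :=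
  kan_hom_ext_right fun X φ => kan_hom_ext_left fun Y ψ => by
    have := h X Y φ ψ
    rwa [MonoidalCategory.tensorHom_def', Category.assoc, Category.assoc] at this

theorem kan_hom_ext_middle {X' : F'} {c d Z : C}
    {a b : c ⊗ ((f.pointwiseLeftKanExtension O).obj X' ⊗ d) ⟶ Z}
    (h : ∀ (X : F) (φ : f.obj X ⟶ X'),
      c ◁ (kanMap f O φ ▷ d) ≫ a = c ◁ (kanMap f O φ ▷ d) ≫ b) : a = b := by
  rw [← cancel_epi (c ◁ (β_ d _).hom), ← cancel_epi (α_ c d _).hom]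
  refine kan_hom_ext_left fun X φ => ?_
  rw [MonoidalCategory.associator_naturality_right_assoc,
    MonoidalCategory.associator_naturality_right_assoc, ← MonoidalCategory.whiskerLeft_comp_assoc,
    ← MonoidalCategory.whiskerLeft_comp_assoc, BraidedCategory.braiding_naturality_right,
    MonoidalCategory.whiskerLeft_comp_assoc, MonoidalCategory.whiskerLeft_comp_assoc, h]

theorem kan_hom_ext₃ {X' Y' Z' : F'} {Z : C}
    {a b : ((f.pointwiseLeftKanExtension O).obj X' ⊗ (f.pointwiseLeftKanExtension O).obj Y') ⊗
      (f.pointwiseLeftKanExtension O).obj Z' ⟶ Z}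
    (h : ∀ (X Y W : F) (φ : f.obj X ⟶ X') (ψ : f.obj Y ⟶ Y') (χ : f.obj W ⟶ Z'),
      ((kanMap f O φ ⊗ₘ kanMap f O ψ) ⊗ₘ kanMap f O χ) ≫ a =
        ((kanMap f O φ ⊗ₘ kanMap f O ψ) ⊗ₘ kanMap f O χ) ≫ b) : a = b := by
  refine kan_hom_ext_left fun W χ => ?_
  rw [← cancel_epi (α_ _ _ _).inv]
  refine kan_hom_ext_right fun X φ => kan_hom_ext_middle fun Y ψ => ?_
  have key : O.obj X ◁ (kanMap f O ψ ▷ O.obj W) ≫ kanMap f O φ ▷ _ ≫ (α_ _ _ _).inv ≫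
      _ ◁ kanMap f O χ = (α_ _ _ _).inv ≫ ((kanMap f O φ ⊗ₘ kanMap f O ψ) ⊗ₘ kanMap f O χ) := by
    rw [← associator_inv_naturality]
    simp only [← id_tensorHom, ← tensorHom_id, ← id_tensorHom_id]
    rw [← associator_inv_naturality]
    simp only [tensorHom_comp_tensorHom, tensorHom_comp_tensorHom_assoc, Category.id_comp,
      Category.comp_id]
  rw [reassoc_of% key, reassoc_of% key, h]

variable [MonoidalCategory F] [SymmetricCategory F] [MonoidalCategory F'] [SymmetricCategory F']
  [f.Braided] [O.Braided]

variable (f O) in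
/-- The colimit of the tensor products is the tensor product of the colimits. -/
theorem exists_kanTensor (X' Y' : F') (h : (tensorArrows f X' Y').Final) :
    ∃ m : (f.pointwiseLeftKanExtension O).obj X' ⊗ (f.pointwiseLeftKanExtension O).obj Y' ≅
        (f.pointwiseLeftKanExtension O).obj (X' ⊗ Y'),
      ∀ (X Y : F) (φ : f.obj X ⟶ X') (ψ : f.obj Y ⟶ Y'),
        (kanMap f O φ ⊗ₘ kanMap f O ψ) ≫ m.hom =
          μ O X Y ≫ kanMap f O (δ f X Y ≫ (φ ⊗ₘ ψ)) := by
  let K₁ := CostructuredArrow.proj f X' ⋙ O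
  let K₂ := CostructuredArrow.proj f Y' ⋙ O
  have : ∀ c : C, PreservesColimit K₁ ((curriedTensor C).flip.obj c) := fun c =>
    preservesColimit_of_natIso K₁ (BraidedCategory.tensorLeftIsoTensorRight c)
  have : ∀ c : C, PreservesColimit K₂ ((curriedTensor C).obj c) := fun c =>
    inferInstanceAs (PreservesColimit K₂ (tensorLeft c))
  have h₁ := isColimitOfPreserves₂ (curriedTensor C) (colimit.isColimit K₁) (colimit.isColimit K₂)
  have h₂ := (Functor.Final.isColimitWhiskerEquiv (tensorArrows f X' Y') _).symm
    (colimit.isColimit (CostructuredArrow.proj f (X' ⊗ Y') ⋙ O))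
  let i : Functor.uncurry.obj (((Functor.whiskeringLeft₂ C).obj K₁).obj K₂ |>.obj (curriedTensor C)) ≅
      tensorArrows f X' Y' ⋙ CostructuredArrow.proj f (X' ⊗ Y') ⋙ O :=
    NatIso.ofComponents (fun p => μIso O p.1.left p.2.left) (fun g => by
      have := μ_natural O g.1.left g.2.left
      rw [MonoidalCategory.tensorHom_def] at this
      exact this)
  refine ⟨IsColimit.coconePointsIsoOfNatIso h₁ h₂ i, fun X Y φ ψ => ?_⟩
  have := IsColimit.comp_coconePointsIsoOfNatIso_hom h₁ h₂ i
    (CostructuredArrow.mk φ, CostructuredArrow.mk ψ)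
  rw [MonoidalCategory.tensorHom_def]
  exact this

end KanExtension

section KanMonoidal

open Functor.LaxMonoidal Functor.OplaxMonoidal Functor.Monoidal

/-- Strong symmetric monoidal structures with the same `ε` and `μ` are equal. -/
theorem braided_ext {A : Type u₁} [Category.{v₁} A] [MonoidalCategory A] [BraidedCategory A]
    {M : Type u₂} [Category.{v₂} M] [MonoidalCategory M] [BraidedCategory M] {S : A ⥤ M}
    (a b : S.Braided) (hε : a.ε = b.ε) (hμ : ∀ X Y, a.μ X Y = b.μ X Y) : a = b :=
  Functor.Braided.toMonoidal_injective S (Functor.Monoidal.toLaxMonoidal_injective S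
    (Functor.LaxMonoidal.ext hε (funext fun X => funext fun Y => hμ X Y)))

variable {F : Type u₁} [Category.{v₁} F] [MonoidalCategory F] [SymmetricCategory F]
  {F' : Type u₂} [Category.{v₂} F'] [MonoidalCategory F'] [SymmetricCategory F']
  {C : Type u} [Category.{v} C] [MonoidalCategory C] [SymmetricCategory C]
  (f : F ⥤ F') (O : F ⥤ C)
  [∀ X' : F', HasColimitsOfShape (CostructuredArrow f X') C]
  [f.Braided] [O.Braided]

section Unit

variable {f O} [(f.pointwiseLeftKanExtension O).Monoidal]
  [NatTrans.IsMonoidal (f.pointwiseLeftKanExtensionUnit O)]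

theorem ε_kan : ε (f.pointwiseLeftKanExtension O) = ε O ≫ kanMap f O (η f) := by
  have h : ε O ≫ (f.pointwiseLeftKanExtensionUnit O).app (𝟙_ F) =
      ε (f.pointwiseLeftKanExtension O) ≫ (f.pointwiseLeftKanExtension O).map (ε f) :=
    NatTrans.IsMonoidal.unit
  rw [kanMap_eq_unit, reassoc_of% h, ← Functor.map_comp, ε_η]
  exact ((congrArg _ (CategoryTheory.Functor.map_id _ _)).trans (Category.comp_id _)).symm

theorem kanMap_μ {X' Y' : F'} {X Y : F} (φ : f.obj X ⟶ X') (ψ : f.obj Y ⟶ Y') :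
    (kanMap f O φ ⊗ₘ kanMap f O ψ) ≫ μ (f.pointwiseLeftKanExtension O) X' Y' =
      μ O X Y ≫ kanMap f O (δ f X Y ≫ (φ ⊗ₘ ψ)) := by
  have h : μ O X Y ≫ (f.pointwiseLeftKanExtensionUnit O).app (X ⊗ Y) =
      ((f.pointwiseLeftKanExtensionUnit O).app X ⊗ₘ (f.pointwiseLeftKanExtensionUnit O).app Y) ≫
      μ (f.pointwiseLeftKanExtension O) _ _ ≫ (f.pointwiseLeftKanExtension O).map (μ f X Y) :=
    NatTrans.IsMonoidal.tensor X Y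
  rw [kanMap_eq_unit, kanMap_eq_unit, kanMap_eq_unit, reassoc_of% h, ← Functor.map_comp,
    μ_δ_assoc, ← tensorHom_comp_tensorHom_assoc, μ_natural]

end Unit

variable [∀ (c : C) (X' : F'), PreservesColimitsOfShape (CostructuredArrow f X') (tensorLeft c)]

/-- The strong monoidal structure on the left Kan extension of a strong monoidal functor. -/
noncomputable def kanCore
    (m : ∀ X' Y', (f.pointwiseLeftKanExtension O).obj X' ⊗ (f.pointwiseLeftKanExtension O).obj Y' ≅
        (f.pointwiseLeftKanExtension O).obj (X' ⊗ Y'))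
    (hm : ∀ (X' Y' : F') (X Y : F) (φ : f.obj X ⟶ X') (ψ : f.obj Y ⟶ Y'),
        (kanMap f O φ ⊗ₘ kanMap f O ψ) ≫ (m X' Y').hom =
          μ O X Y ≫ kanMap f O (δ f X Y ≫ (φ ⊗ₘ ψ)))
    (hu : IsIso (kanMap f O (η f))) : (f.pointwiseLeftKanExtension O).CoreMonoidal where
  εIso := εIso O ≪≫ asIso (kanMap f O (η f))
  μIso := m
  μIso_hom_natural_left g X' := by
    refine kan_hom_ext₂ fun X Y φ ψ => ?_
    rw [← tensorHom_id, tensorHom_comp_tensorHom_assoc, kanMap_map, Category.comp_id, hm,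
      reassoc_of% (hm _ _ X Y φ ψ), kanMap_map]
    simp [tensorHom_comp_whiskerRight]
  μIso_hom_natural_right X' g := by
    refine kan_hom_ext₂ fun X Y φ ψ => ?_
    rw [← id_tensorHom, tensorHom_comp_tensorHom_assoc, kanMap_map, Category.comp_id, hm,
      reassoc_of% (hm _ _ X Y φ ψ), kanMap_map]
    simp [tensorHom_comp_whiskerLeft]
  associativity X' Y' Z' := by
    refine kan_hom_ext₃ fun X Y W φ ψ χ => ?_
    have h₁ := congrArg (· ⊗ₘ kanMap f O χ) (hm X' Y' X Y φ ψ)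
    have h₂ := congrArg (kanMap f O φ ⊗ₘ ·) (hm Y' Z' Y W ψ χ)
    rw [← Category.comp_id (kanMap f O χ), ← tensorHom_comp_tensorHom, Category.comp_id,
      ← Category.id_comp (kanMap f O χ), ← tensorHom_comp_tensorHom, Category.id_comp,
      tensorHom_id, tensorHom_id] at h₁
    rw [← Category.comp_id (kanMap f O φ), ← tensorHom_comp_tensorHom, Category.comp_id,
      ← Category.id_comp (kanMap f O φ), ← tensorHom_comp_tensorHom, Category.id_comp,
      id_tensorHom, id_tensorHom] at h₂
    rw [reassoc_of% h₁, reassoc_of% (hm _ _ (X ⊗ Y) W), kanMap_map, associator_naturality_assoc,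
      reassoc_of% h₂, hm, ← Functor.LaxMonoidal.associativity_assoc, map_kanMap]
    congr 3
    have h₃ : (δ f X Y ≫ (φ ⊗ₘ ψ)) ⊗ₘ χ = δ f X Y ▷ f.obj W ≫ ((φ ⊗ₘ ψ) ⊗ₘ χ) := by
      rw [← tensorHom_id, tensorHom_comp_tensorHom, Category.id_comp]
    have h₄ : φ ⊗ₘ (δ f Y W ≫ (ψ ⊗ₘ χ)) = f.obj X ◁ δ f Y W ≫ (φ ⊗ₘ (ψ ⊗ₘ χ)) := by
      rw [← id_tensorHom, tensorHom_comp_tensorHom, Category.id_comp]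
    rw [h₃, h₄, Category.assoc, Category.assoc, associator_naturality,
      Functor.OplaxMonoidal.associativity_assoc]
  left_unitality X' := by
    refine kan_hom_ext_left fun X φ => ?_
    change _ = _ ≫ (ε O ≫ kanMap f O (η f)) ▷ _ ≫ _
    rw [leftUnitor_naturality, Functor.LaxMonoidal.left_unitality O X, comp_whiskerRight_assoc,
      whisker_exchange_assoc, ← MonoidalCategory.tensorHom_def'_assoc,
      reassoc_of% (hm _ _ (𝟙_ F) X), kanMap_map, Category.assoc, Category.assoc, map_kanMap,
      Functor.Monoidal.map_leftUnitor]
    simp [MonoidalCategory.tensorHom_def]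
  right_unitality X' := by
    refine kan_hom_ext_right fun X φ => ?_
    change _ = _ ≫ _ ◁ (ε O ≫ kanMap f O (η f)) ≫ _
    rw [rightUnitor_naturality, Functor.LaxMonoidal.right_unitality O X,
      MonoidalCategory.whiskerLeft_comp_assoc,
      ← whisker_exchange_assoc, ← MonoidalCategory.tensorHom_def_assoc,
      reassoc_of% (hm _ _ X (𝟙_ F)), kanMap_map, Category.assoc, Category.assoc, map_kanMap,
      Functor.Monoidal.map_rightUnitor]
    simp [MonoidalCategory.tensorHom_def']

/-- The strong symmetric monoidal structure on the left Kan extension of a strong symmetric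
monoidal functor. -/
@[reducible]
noncomputable def kanBraided
    (m : ∀ X' Y', (f.pointwiseLeftKanExtension O).obj X' ⊗ (f.pointwiseLeftKanExtension O).obj Y' ≅
        (f.pointwiseLeftKanExtension O).obj (X' ⊗ Y'))
    (hm : ∀ (X' Y' : F') (X Y : F) (φ : f.obj X ⟶ X') (ψ : f.obj Y ⟶ Y'),
        (kanMap f O φ ⊗ₘ kanMap f O ψ) ≫ (m X' Y').hom =
          μ O X Y ≫ kanMap f O (δ f X Y ≫ (φ ⊗ₘ ψ)))
    (hu : IsIso (kanMap f O (η f))) : (f.pointwiseLeftKanExtension O).Braided :=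
  { (kanCore f O m hm hu).toMonoidal with
    braided := fun X' Y' => by
      refine kan_hom_ext₂ fun X Y φ ψ => ?_
      change _ ≫ (m X' Y').hom ≫ _ = _ ≫ _ ≫ (m Y' X').hom
      rw [reassoc_of% (hm X' Y'), kanMap_map, BraidedCategory.braiding_naturality_assoc, hm,
        ← Functor.LaxBraided.braided_assoc, map_kanMap, Functor.map_braiding]
      simp }

/-- There is a strong symmetric monoidal structure on the left Kan extension for which its unit is
monoidal. -/
theorem exists_kanBraided (h : ∀ X' Y', (tensorArrows f X' Y').Final)
    (hu : Nonempty (IsTerminal (CostructuredArrow.mk (η f)))) :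
    ∃ B : (f.pointwiseLeftKanExtension O).Braided,
      letI := B; NatTrans.IsMonoidal (f.pointwiseLeftKanExtensionUnit O) := by
  choose m hm using fun X' Y' => exists_kanTensor f O X' Y' (h X' Y')
  have hi : IsIso (kanMap f O (η f)) :=
    isIso_ι_of_isTerminal hu.some (CostructuredArrow.proj f (𝟙_ F') ⋙ O)
  refine ⟨kanBraided f O m hm hi, letI := kanBraided f O m hm hi; ⟨?_, fun X Y => ?_⟩⟩
  · change ε O ≫ kanMap f O (𝟙 _) = (ε O ≫ kanMap f O (η f)) ≫
      (f.pointwiseLeftKanExtension O).map (ε f)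
    rw [Category.assoc, kanMap_map, η_ε]
  · change μ O X Y ≫ kanMap f O (𝟙 _) = (kanMap f O (𝟙 _) ⊗ₘ kanMap f O (𝟙 _)) ≫ (m _ _).hom ≫
      (f.pointwiseLeftKanExtension O).map (μ f X Y)
    rw [reassoc_of% (hm _ _ X Y), kanMap_map]
    simp

theorem kanBraided_unique (a b : (f.pointwiseLeftKanExtension O).Braided)
    (ha : letI := a; NatTrans.IsMonoidal (f.pointwiseLeftKanExtensionUnit O))
    (hb : letI := b; NatTrans.IsMonoidal (f.pointwiseLeftKanExtensionUnit O)) : a = b := by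
  refine braided_ext a b ?_ fun X' Y' => ?_
  · exact (letI := a; ε_kan).trans (letI := b; ε_kan).symm
  · refine kan_hom_ext₂ fun X Y φ ψ => ?_
    exact (letI := a; kanMap_μ φ ψ).trans (letI := b; kanMap_μ φ ψ).symm

theorem kanDesc_isMonoidal {P : F ⥤ C} [P.Braided] (σ : O ⟶ P) [NatTrans.IsMonoidal σ]
    [(f.pointwiseLeftKanExtension O).Monoidal] [(f.pointwiseLeftKanExtension P).Monoidal]
    [NatTrans.IsMonoidal (f.pointwiseLeftKanExtensionUnit O)]
    [NatTrans.IsMonoidal (f.pointwiseLeftKanExtensionUnit P)] :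
    NatTrans.IsMonoidal (kanDesc (f := f) σ) where
  unit := by
    rw [ε_kan, ε_kan, Category.assoc, kanMap_kanDesc, NatTrans.IsMonoidal.unit_assoc]
  tensor X' Y' := kan_hom_ext₂ fun X Y φ ψ => by
    rw [reassoc_of% (kanMap_μ (O := O) φ ψ), kanMap_kanDesc, NatTrans.IsMonoidal.tensor_assoc,
      tensorHom_comp_tensorHom_assoc, kanMap_kanDesc, kanMap_kanDesc,
      ← tensorHom_comp_tensorHom_assoc, kanMap_μ]

end KanMonoidal

namespace FeynmanTriple

open Functor.LaxMonoidal Functor.OplaxMonoidal Functor.Monoidal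

variable {𝔄 : FeynmanTriple.{w, u₁, u₂}} {𝔅 : FeynmanTriple.{w, u₃, u₄}}
  {ℭ : FeynmanTriple.{w, u, v}} {𝔇 : FeynmanTriple.{w, u₅, u₆}}

theorem Hom.mk_congr {v : 𝔄.V ⥤ 𝔅.V} {f : 𝔄.F ⥤ 𝔅.F} (b b' : f.Braided)
    (i i' : 𝔄.ι ⋙ f ≅ v ⋙ 𝔅.ι) (hε : b.ε = b'.ε) (hμ : ∀ X Y, b.μ X Y = b'.μ X Y)
    (hi : ∀ x, i.hom.app x = i'.hom.app x) :
    Hom.mk v f (braided := b) i = Hom.mk v f (braided := b') i' := by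
  obtain rfl := braided_ext b b' hε hμ
  obtain rfl : i = i' := Iso.ext (NatTrans.ext (funext hi))
  rfl

theorem Hom.comp_assoc (Φ : Hom 𝔄 𝔅) (Ψ : Hom 𝔅 ℭ) (Χ : Hom ℭ 𝔇) :
    (Φ.comp Ψ).comp Χ = Φ.comp (Ψ.comp Χ) := by
  refine Hom.mk_congr _ _ _ _ ?_ (fun X Y => ?_) fun x => ?_
  · change ε Χ.f ≫ Χ.f.map (ε Ψ.f ≫ Ψ.f.map (ε Φ.f)) =
      (ε Χ.f ≫ Χ.f.map (ε Ψ.f)) ≫ Χ.f.map (Ψ.f.map (ε Φ.f))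
    rw [Χ.f.map_comp, Category.assoc]
  · change μ Χ.f _ _ ≫ Χ.f.map (μ Ψ.f _ _ ≫ Ψ.f.map (μ Φ.f X Y)) =
      (μ Χ.f _ _ ≫ Χ.f.map (μ Ψ.f _ _)) ≫ Χ.f.map (Ψ.f.map (μ Φ.f X Y))
    rw [Χ.f.map_comp, Category.assoc]
  · change Χ.f.map (Ψ.f.map (Φ.iso.hom.app x) ≫ Ψ.iso.hom.app _) ≫ Χ.iso.hom.app _ =
      Χ.f.map (Ψ.f.map (Φ.iso.hom.app x)) ≫ Χ.f.map (Ψ.iso.hom.app _) ≫ Χ.iso.hom.app _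
    rw [Χ.f.map_comp, Category.assoc]

theorem decMap_comp_forget {D E : 𝔄.F ⥤ Type w} [D.Braided] [E.Braided] (σ : D ⟶ E)
    [NatTrans.IsMonoidal σ] : (𝔄.decMap σ).comp (𝔄.forget E) = 𝔄.forget D :=
  Hom.mk_congr _ _ _ _ (Category.comp_id _) (fun _ _ => Category.comp_id _)
    fun _ => Category.comp_id _

theorem exists_eq_liftElements {A : Type u₁} [Category.{v₁} A] {M : Type u₂} [Category.{v₂} M]
    {E : M ⥤ Type w} (S : A ⥤ E.Elements) :
    ∃ (N : A ⥤ M) (s : ∀ Z, E.obj (N.obj Z))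
      (hs : ∀ {Z Z' : A} (f : Z ⟶ Z'), E.map (N.map f) (s Z) = s Z'), S = liftElements N E s hs :=
  ⟨S ⋙ CategoryOfElements.π _, fun x => (S.obj x).2, fun g => (S.map g).2, rfl⟩

/-- A morphism to a decorated Feynman category is determined by the underlying morphism and the
decorations. -/
theorem Hom.dec_ext {E : 𝔅.F ⥤ Type w} [E.Braided] {Φ Ψ : Hom 𝔄 (𝔅.dec E)}
    (h : Φ.comp (𝔅.forget E) = Ψ.comp (𝔅.forget E))
    (hv : ∀ x, HEq (Φ.v.obj x).2 (Ψ.v.obj x).2) (hf : ∀ X, HEq (Φ.f.obj X).2 (Ψ.f.obj X).2) :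
    Φ = Ψ := by
  obtain ⟨v, f, i⟩ := Φ
  obtain ⟨v', f', i'⟩ := Ψ
  obtain ⟨N, s, hs, rfl⟩ := exists_eq_liftElements v
  obtain ⟨N', s', hs', rfl⟩ := exists_eq_liftElements v'
  obtain ⟨M, t, ht, rfl⟩ := exists_eq_liftElements f
  obtain ⟨M', t', ht', rfl⟩ := exists_eq_liftElements f'
  have h1 : N = N' := congrArg Hom.v h
  have h2 : M = M' := congrArg Hom.f h
  subst h1 h2
  obtain rfl : s = s' := funext fun x => eq_of_heq (hv x)
  obtain rfl : t = t' := funext fun x => eq_of_heq (hf x)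
  rename_i b b'
  injection h with _ _ h3 h4
  have hε := congrArg (fun c : Functor.Braided _ => c.ε) h3
  have hμ := fun X Y => congrArg (fun c : Functor.Braided _ => c.μ X Y) h3
  have hi := fun x => congrArg (fun c => c.hom.app x) h4
  refine Hom.mk_congr _ _ _ _ (Subtype.ext ?_) (fun X Y => Subtype.ext ?_)
    fun x => Subtype.ext ?_
  · exact (Category.id_comp _).symm.trans (hε.trans (Category.id_comp _))
  · exact (Category.id_comp _).symm.trans ((hμ X Y).trans (Category.id_comp _))
  · exact (Category.comp_id _).symm.trans ((hi x).trans (Category.comp_id _))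

/-- The decorated morphism `(X, a) ↦ (f X, τ_X a)`, `(∗, a) ↦ (v ∗, i_∗ τ_{ι ∗} a)` induced by a
morphism `(v, f, i)` and a monoidal natural transformation `τ : D ⟶ E ∘ f`. -/
def decHom (Φ : Hom 𝔄 𝔅) {D : 𝔄.F ⥤ Type w} {E : 𝔅.F ⥤ Type w} [D.Braided] [E.Braided]
    (τ : D ⟶ Φ.f ⋙ E) [NatTrans.IsMonoidal τ] : Hom (𝔄.dec D) (𝔅.dec E) where
  v := liftElements (CategoryOfElements.π (𝔄.ι ⋙ D) ⋙ Φ.v) (𝔅.ι ⋙ E)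
    (fun p => E.map (Φ.iso.hom.app p.1) (τ.app (𝔄.ι.obj p.1) p.2)) (fun {p q} g => by
      have h : D.map (𝔄.ι.map g.1) ≫ τ.app (𝔄.ι.obj q.1) ≫ E.map (Φ.iso.hom.app q.1) =
          (τ.app (𝔄.ι.obj p.1) ≫ E.map (Φ.iso.hom.app p.1)) ≫ E.map (𝔅.ι.map (Φ.v.map g.1)) := by
        rw [τ.naturality_assoc, Category.assoc]
        change _ ≫ E.map _ ≫ E.map _ = _
        rw [← E.map_comp, ← E.map_comp]
        exact congrArg (fun k => _ ≫ E.map k) (Φ.iso.hom.naturality g.1)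
      refine (type_congr h p.2).symm.trans ?_
      exact congrArg (fun a => E.map (Φ.iso.hom.app q.1) (τ.app (𝔄.ι.obj q.1) a)) g.2)
  f := liftElements (CategoryOfElements.π D ⋙ Φ.f) E (fun p => τ.app p.1 p.2) (fun {p q} g => by
      exact (type_congr (τ.naturality g.1) p.2).symm.trans (congrArg _ g.2))
  braided := liftElementsBraided (CategoryOfElements.π D ⋙ Φ.f) E _ _ (by
      have h : ε E ≫ E.map (ε (CategoryOfElements.π D ⋙ Φ.f)) = ε D ≫ τ.app (𝟙_ 𝔄.F) := by
        rw [NatTrans.IsMonoidal.unit]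
        change _ ≫ E.map (ε Φ.f ≫ Φ.f.map (𝟙 _)) = ε E ≫ E.map (ε Φ.f)
        rw [CategoryTheory.Functor.map_id, Category.comp_id]
      exact type_congr h (show (𝟙_ (Type w) : Type w) from PUnit.unit)) (fun p q => by
      have h : (τ.app p.1 ⊗ₘ τ.app q.1) ≫ μ E _ _ ≫
          E.map (μ (CategoryOfElements.π D ⋙ Φ.f) p q) = μ D p.1 q.1 ≫ τ.app (p.1 ⊗ q.1) := by
        rw [NatTrans.IsMonoidal.tensor]
        change _ ≫ _ ≫ E.map (μ Φ.f _ _ ≫ Φ.f.map (𝟙 _)) = _ ≫ μ E _ _ ≫ E.map (μ Φ.f _ _)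
        rw [CategoryTheory.Functor.map_id, Category.comp_id]
      exact type_congr h (show (D.obj p.1 ⊗ D.obj q.1 : Type w) from (p.2, q.2)))
  iso := NatIso.ofComponents
    (fun p => CategoryOfElements.isoMk _ _ (Φ.iso.app p.1) rfl)
    (fun g => Subtype.ext (Φ.iso.hom.naturality g.1))

theorem decHom_comp_forget (Φ : Hom 𝔄 𝔅) {D : 𝔄.F ⥤ Type w} {E : 𝔅.F ⥤ Type w} [D.Braided]
    [E.Braided] (τ : D ⟶ Φ.f ⋙ E) [NatTrans.IsMonoidal τ] :
    (decHom Φ τ).comp (𝔅.forget E) = (𝔄.forget D).comp Φ := by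
  refine Hom.mk_congr _ _ _ _ (Category.id_comp _) (fun _ _ => Category.id_comp _) fun x => ?_
  change Φ.iso.hom.app x.1 ≫ 𝟙 _ = Φ.f.map (𝟙 _) ≫ Φ.iso.hom.app x.1
  rw [Category.comp_id, CategoryTheory.Functor.map_id, Category.id_comp]

/-- Naturality of `decHom` in the decorations. -/
theorem decMap_comp_decHom (Φ : Hom 𝔄 𝔅) {D D' : 𝔄.F ⥤ Type w} {E E' : 𝔅.F ⥤ Type w} [D.Braided]
    [D'.Braided] [E.Braided] [E'.Braided] (τ : D ⟶ Φ.f ⋙ E) [NatTrans.IsMonoidal τ]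
    (τ' : D' ⟶ Φ.f ⋙ E') [NatTrans.IsMonoidal τ'] (σ : D ⟶ D') [NatTrans.IsMonoidal σ]
    (σ' : E ⟶ E') [NatTrans.IsMonoidal σ'] (h : σ ≫ τ' = τ ≫ Functor.whiskerLeft Φ.f σ') :
    (𝔄.decMap σ).comp (decHom Φ τ') = (decHom Φ τ).comp (𝔅.decMap σ') := by
  refine Hom.dec_ext ?_ (fun p => heq_of_eq ?_) (fun p => heq_of_eq ?_)
  · rw [Hom.comp_assoc, Hom.comp_assoc, decMap_comp_forget, decHom_comp_forget, decHom_comp_forget,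
      ← Hom.comp_assoc, decMap_comp_forget]
  · have h' : σ.app _ ≫ τ'.app _ ≫ E'.map (Φ.iso.hom.app p.1) =
        (τ.app _ ≫ E.map (Φ.iso.hom.app p.1)) ≫ σ'.app _ := by
      have := congrArg (fun c => c.app (𝔄.ι.obj p.1) ≫ E'.map (Φ.iso.hom.app p.1)) h
      dsimp at this
      rw [Category.assoc, Category.assoc] at this
      rw [this, Category.assoc, ← σ'.naturality]
      rfl
    exact type_congr h' p.2
  · exact type_congr (congrArg (fun c => c.app p.1) h) p.2

/-- A monoidal natural transformation `τ : O ⟶ O' ∘ f` of functors to `C`, as a transformation of the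
functors of elements. -/
def elementsTrans (Φ : Hom 𝔄 𝔅) {C : Type u₅} [Category.{u₆} C] [MonoidalCategory C]
    [SymmetricCategory C] (U : C ⥤ Type w) (O : 𝔄.Ops C) (O' : 𝔅.Ops C)
    (τ : O.functor ⟶ Φ.f ⋙ O'.functor) : O.functor ⋙ U ⟶ Φ.f ⋙ O'.functor ⋙ U :=
  Functor.whiskerRight τ U

instance elementsTrans_isMonoidal (Φ : Hom 𝔄 𝔅) {C : Type u₅} [Category.{u₆} C]
    [MonoidalCategory C] [SymmetricCategory C] (U : C ⥤ Type w) [U.Braided] (O : 𝔄.Ops C)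
    (O' : 𝔅.Ops C) (τ : O.functor ⟶ Φ.f ⋙ O'.functor) [NatTrans.IsMonoidal τ] :
    NatTrans.IsMonoidal (elementsTrans Φ U O O' τ) where
  unit := by
    have h : ε O.functor ≫ τ.app (𝟙_ 𝔄.F) = ε O'.functor ≫ O'.functor.map (ε Φ.f) :=
      NatTrans.IsMonoidal.unit
    change (ε U ≫ U.map (ε O.functor)) ≫ U.map (τ.app (𝟙_ 𝔄.F)) =
      (ε U ≫ U.map (ε O'.functor)) ≫ U.map (O'.functor.map (ε Φ.f))
    rw [Category.assoc, Category.assoc, ← U.map_comp, ← U.map_comp, h]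
  tensor X Y := by
    have h : μ O.functor X Y ≫ τ.app (X ⊗ Y) =
      (τ.app X ⊗ₘ τ.app Y) ≫ μ O'.functor _ _ ≫ O'.functor.map (μ Φ.f X Y) :=
      NatTrans.IsMonoidal.tensor X Y
    change (μ U _ _ ≫ U.map (μ O.functor X Y)) ≫ U.map (τ.app (X ⊗ Y)) =
      (U.map (τ.app X) ⊗ₘ U.map (τ.app Y)) ≫ (μ U _ _ ≫ U.map (μ O'.functor _ _)) ≫
        U.map (O'.functor.map (μ Φ.f X Y))
    rw [Category.assoc, Category.assoc, ← U.map_comp, ← U.map_comp, h, U.map_comp]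
    exact (μ_natural_assoc U (τ.app X) (τ.app Y) _).symm

end FeynmanTriple

theorem mainTheorem2
    {𝔉 : FeynmanTriple.{w, u₁, u₂}} {𝔉' : FeynmanTriple.{w, u₃, u₄}}
    (h𝔉 : 𝔉.IsFeynmanCategory) (h𝔉' : 𝔉'.IsFeynmanCategory)
    (Φ : FeynmanTriple.Hom 𝔉 𝔉')
    {C : Type u} [Category.{v} C] [MonoidalCategory C] [SymmetricCategory C]
    [∀ X' : 𝔉'.F, HasColimitsOfShape (CostructuredArrow Φ.f X') C]
    [∀ (c : C) (X' : 𝔉'.F),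
      PreservesColimitsOfShape (CostructuredArrow Φ.f X') (tensorLeft c)]
    (U : C ⥤ Type w) [U.Braided] :
    ∃ (push : ∀ O : 𝔉.Ops C, FeynmanTriple.PushStructure Φ O)
      (fdec : ∀ O : 𝔉.Ops C,
        FeynmanTriple.Hom (𝔉.decOp U O) (𝔉'.decOp U (push O).op)),
      (∀ (O : 𝔉.Ops C) (B : FeynmanTriple.PushStructure Φ O), B = push O) ∧
      (∀ O : 𝔉.Ops C, (𝔉.decOp U O).IsFeynmanCategory ∧
        (𝔉'.decOp U (push O).op).IsFeynmanCategory) ∧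
      (∀ (O : 𝔉.Ops C) (X : 𝔉.F) (a : U.obj (O.functor.obj X)),
        (fdec O).f.obj ⟨X, a⟩ =
          ⟨Φ.f.obj X, U.map (FeynmanTriple.colimMap Φ O (𝟙 (Φ.f.obj X))) a⟩) ∧
      (∀ O : 𝔉.Ops C,
        (fdec O).comp (𝔉'.forgetOp U (push O).op) = (𝔉.forgetOp U O).comp Φ) ∧
      (∀ (O P : 𝔉.Ops C) (σ : FeynmanTriple.Ops.Hom 𝔉 O P),
        ∃ σ' : FeynmanTriple.Ops.Hom 𝔉' (push O).op (push P).op,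
          (∀ (X : 𝔉.F) (X' : 𝔉'.F) (φ : Φ.f.obj X ⟶ X'),
            FeynmanTriple.colimMap Φ O φ ≫ σ'.hom.app X' =
              σ.hom.app X ≫ FeynmanTriple.colimMap Φ P φ) ∧
          (𝔉.decOpMap U σ).comp (fdec P) = (fdec O).comp (𝔉'.decOpMap U σ')) := by
  have hF := h𝔉.hereditary.liftsDecompositions h𝔉.iso_condition
    (Core.inclusion _ ⋙ Comma.snd _ _) (Comma.snd (𝟭 𝔉.F) (𝟭 𝔉.F)) (Iso.refl _)
  have hF' := h𝔉'.hereditary.liftsDecompositions h𝔉'.iso_condition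
    (Core.inclusion _ ⋙ Comma.snd _ _) (Comma.snd (𝟭 𝔉'.F) (𝟭 𝔉'.F)) (Iso.refl _)
  have hf := h𝔉.iso_condition.liftsDecompositions h𝔉'.iso_condition Φ.v Φ.f Φ.iso
  choose B hB using fun O : 𝔉.Ops C => exists_kanBraided Φ.f O.functor
    (tensorArrows_final hF hF' hf) (nonempty_isTerminal_unit hF hF' hf
      h𝔉.iso_condition.to_unit_unique h𝔉'.iso_condition.to_unit_unique)
  let push (O : 𝔉.Ops C) : FeynmanTriple.PushStructure Φ O := ⟨B O, hB O⟩
  let τ (O : 𝔉.Ops C) : O.functor ⟶ Φ.f ⋙ (push O).op.functor :=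
    Φ.f.pointwiseLeftKanExtensionUnit O.functor
  have hτ (O : 𝔉.Ops C) : NatTrans.IsMonoidal (τ O) := hB O
  let fdec (O : 𝔉.Ops C) : FeynmanTriple.Hom (𝔉.decOp U O) (𝔉'.decOp U (push O).op) :=
    FeynmanTriple.decHom Φ (FeynmanTriple.elementsTrans Φ U O (push O).op (τ O))
  refine ⟨push, fdec, fun O ⟨b, hb⟩ => ?_, fun O => ⟨h𝔉.dec _, h𝔉'.dec _⟩, fun O X a => rfl,
    fun O => FeynmanTriple.decHom_comp_forget _ _, fun O P σ => ?_⟩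
  · obtain rfl := kanBraided_unique Φ.f O.functor b (B O) hb (hB O)
    rfl
  · have hσ : letI := B O; letI := B P; NatTrans.IsMonoidal (kanDesc (f := Φ.f) σ.hom) :=
      letI := B O; letI := B P; letI := hB O; letI := hB P; kanDesc_isMonoidal Φ.f O.functor σ.hom
    let σ' : FeynmanTriple.Ops.Hom 𝔉' (push O).op (push P).op :=
      { hom := kanDesc σ.hom, isMonoidal := hσ }
    refine ⟨σ', fun X X' φ => kanMap_kanDesc σ.hom φ, ?_⟩
    refine FeynmanTriple.decMap_comp_decHom Φ _ _ _ _ ?_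
    ext X : 2
    exact ((U.map_comp _ _).symm.trans
      (congrArg U.map (kanMap_kanDesc σ.hom (𝟙 (Φ.f.obj X))).symm)).trans (U.map_comp _ _)
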